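/- **Conventions.** Let $k$ be a field and $p\in k[x]$ a polynomial with $p(0)=0$. A ($\mathbb Z$-graded) matrix factorization over a commutative ring $S$ with potential $\varphi\in S$ is a $\mathbb Z$-graded $S$-module $M$ with an endomorphism $d=d_++d_-$, $d_\pm$ of degree $\pm1$, such that $d^2=\varphi$; $M_+$ denotes the complex $(M,d_+)$. Morphisms commute with $d$ and preserve the $\mathbb Z/2$-grading. Tensor products carry $d(a\otimes b)=da\otimes b+(-1)^{\deg a}a\otimes db$, and potentials add. The Koszul matrix factorization of $(x_1,\dots,x_m)$, $(y_1,\dots,y_m)$ is the tensor product over $i$ of the two-term factorizations with $d_+=x_i\colon S\to S$ from degree $-1$ to degree $0$ and $d_-=y_i\colon S\to S$ back. If $M^i=0$ for all $i>0$, put $\mathcal H(M)=H^0(M_+)$, a module annihilated by $\varphi$, regarded as a matrix factorization concentrated in degree $0$; there is a natural morphism $M\to\mathcal H(M)$. A morphism $f\colon M\to M'$ of matrix factorizations over $S$ with potential $\varphi$ that preserves the $\mathbb Z$-grading (so that it is a chain map $M_+\to M'_+$) is a *near-isomorphism over $S$* if for every matrix factorization $D$ on a projective $S$-module with potential $-\varphi$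 the induced map $H^t(M\otimes_S D)\to H^t(M'\otimes_S D)$ on total homology $\ker d/\operatorname{im} d$ is an isomorphism. A chain map of complexes of matrix factorizations is a *degree-wise near-isomorphism* if it is a near-isomorphism in each homological degree. **The Khovanov–Rozansky complex.** Let $T$ be an oriented tangle diagram, and let $\mathcal G(T)$ be the oriented graph whose vertices are the crossings and the endpoints of $T$ and whose edges are the segments between them. Let $\tilde{\mathcal S}$ be the polynomial ring over $k$ with one variable $t_{x,e}$ for each flag of $\mathcal G(T)$ (each end of an edge $e$, at the vertex $x$), and one further variable $t_o$ for each closed component $o$ of $T$ without crossings. * For an edge $e$ with tail variable $a$ and head variable $b$, $L_e$ is the Koszul matrix factorization of $b-a$ and $\frac{p(b)-p(a)}{b-a}$. A closed component $o$ without crossings is treated as an edge whose two ends are one marked point: it contributes the Koszul matrix factorization of $0$ and $p'(t_o)$. * At a crossing $x$ let $t_i,t_j$ be the variables of the outgoing edges on the left and on the right, and $t_k,t_\ell$ those of the incoming edges on the right and on the left. Choose a Koszul matrix factorization $L'_x$ on $(t_i+t_j-t_k-t_\ell,\ t_it_j-t_kt_\ell)$ and a Koszul matrix factorization $L''_x$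 on $(t_i-t_\ell,\ t_j-t_k)$, both with potential $p(t_i)+p(t_j)-p(t_k)-p(t_\ell)$. Choose morphisms $\rho_x^+\colon L'_x\to L''_x$ and $\rho_x^-\colon L''_x\to L'_x$ which descend along the natural maps to $\mathcal H(\rho_x^+)$, the projection $\tilde{\mathcal S}/(t_i+t_j-t_k-t_\ell,\,t_it_j-t_kt_\ell)\to\tilde{\mathcal S}/(t_i-t_\ell,\,t_j-t_k)$, and $\mathcal H(\rho_x^-)$, the map in the opposite direction given by multiplication by $t_i-t_k$. Such choices exist. Let $L_x$ be the two-term complex $\rho^+_x\colon L'_x\to L''_x$ if $x$ is positive and $\rho^-_x\colon L''_x\to L'_x$ if $x$ is negative, with $L''_x$ in homological degree $0$, and let $\mathcal H(L_x)$ be the complex obtained by applying $\mathcal H$ to its terms and its differential. Put $$\mathcal R_p(T)=\Big(\bigotimes_e L_e\Big)\otimes\Big(\bigotimes_x L_x\Big),\qquad \widehat{\mathcal R}_p(T)=\Big(\bigotimes_e L_e\Big)\otimes\Big(\bigotimes_x \mathcal H(L_x)\Big),$$ tensor products over $\tilde{\mathcal S}$, with the factors of the closed components without crossings included among the $L_e$.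 The potential of both complexes is $\varphi_T=\sum_{\ell}\epsilon_\ell\,p(t_\ell)$, the sum over the endpoints $\ell$ of $T$, with $\epsilon_\ell=1$ if the edge at $\ell$ is directed into $\ell$ and $\epsilon_\ell=-1$ otherwise. It lies in the subring $\mathcal S_T\subset\tilde{\mathcal S}$ generated over $k$ by the variables at the endpoints, so that both are also complexes of matrix factorizations over $\mathcal S_T$. **Proposition 2.4.** For every oriented tangle diagram $T$ and all choices as above, the natural chain map $\mathcal R_p(T)\to\widehat{\mathcal R}_p(T)$, the tensor product of the identity of $\bigotimes_e L_e$ with the natural maps $L_x\to\mathcal H(L_x)$, is a degree-wise near-isomorphism, both over $\tilde{\mathcal S}$ and over $\mathcal S_T$. -/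

import Mathlib

open TensorProduct DirectSum

universe u v v' w w'

theorem isInternal_of_decompose {S : Type u} [CommRing S] {M : Type v} [AddCommGroup M]
    [Module S M] (A : ℤ → Submodule S M) (D : M →ₗ[S] ⨁ i, A i)
    (left : ∀ m, DirectSum.coeLinearMap A (D m) = m)
    (right : ∀ i, ∀ a (ha : a ∈ A i), D a = DirectSum.lof S ℤ (fun i => A i) i ⟨a, ha⟩) :
    DirectSum.IsInternal A := by
  have h : D ∘ₗ DirectSum.coeLinearMap A = LinearMap.id := by
    apply DirectSum.linearMap_ext
    intro i
    ext1 a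
    simp [right i a a.2]
  refine ⟨fun x y hxy => ?_, fun m => ⟨D m, left m⟩⟩
  have hx := LinearMap.congr_fun h x
  have hy := LinearMap.congr_fun h y
  simp only [LinearMap.comp_apply, LinearMap.id_apply] at hx hy
  rw [← hx, ← hy]
  exact congrArg D hxy

/-- A `ℤ`-graded matrix factorization with potential `φ` over `S`: a `ℤ`-graded module with an
operator `d = dPlus + dMinus`, the summands having degrees `+1` and `-1`, such that `d² = φ`. -/
structure MatrixFactorization (S : Type u) [CommRing S] (φ : S) where
  carrier : Type v
  [addCommGroup : AddCommGroup carrier]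
  [module : Module S carrier]
  grade : ℤ → Submodule S carrier
  isInternal : DirectSum.IsInternal grade
  dPlus : carrier →ₗ[S] carrier
  dMinus : carrier →ₗ[S] carrier
  dPlus_mem : ∀ i, ∀ a ∈ grade i, dPlus a ∈ grade (i + 1)
  dMinus_mem : ∀ i, ∀ a ∈ grade i, dMinus a ∈ grade (i - 1)
  sq : ∀ a, (dPlus + dMinus) ((dPlus + dMinus) a) = φ • a

attribute [instance] MatrixFactorization.addCommGroup MatrixFactorization.module

namespace MatrixFactorization

variable {S : Type u} [CommRing S] {φ ψ : S}

/-- The total differential. -/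
def d (M : MatrixFactorization.{u, v} S φ) : M.carrier →ₗ[S] M.carrier := M.dPlus + M.dMinus

theorem d_d (M : MatrixFactorization.{u, v} S φ) (a : M.carrier) : M.d (M.d a) = φ • a := M.sq a

theorem homogeneous_induction (M : MatrixFactorization.{u, v} S φ) {P : M.carrier → Prop}
    (a : M.carrier) (zero : P 0) (add : ∀ a b, P a → P b → P (a + b))
    (homog : ∀ i, ∀ a ∈ M.grade i, P a) : P a := by
  have ha : a ∈ iSup M.grade := by rw [M.isInternal.submodule_iSup_eq_top]; trivial
  exact Submodule.iSup_induction (motive := P) M.grade ha homog zero add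

theorem grade_disjoint (M : MatrixFactorization.{u, v} S φ) {i j : ℤ} (hij : i ≠ j)
    {a : M.carrier} (hi : a ∈ M.grade i) (hj : a ∈ M.grade j) : a = 0 := by
  have := M.isInternal.submodule_iSupIndep.pairwiseDisjoint hij
  exact (Submodule.disjoint_def.1 this) a hi hj

/-- The decomposition of a matrix factorization into its homogeneous components. -/
noncomputable def decomp (M : MatrixFactorization.{u, v} S φ) :
    M.carrier ≃ₗ[S] ⨁ i, M.grade i :=
  (LinearEquiv.ofBijective (DirectSum.coeLinearMap M.grade) M.isInternal).symm

theorem decomp_of_mem (M : MatrixFactorization.{u, v} S φ) {i : ℤ} {a : M.carrier}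
    (ha : a ∈ M.grade i) :
    M.decomp a = DirectSum.lof S ℤ (fun i => M.grade i) i ⟨a, ha⟩ := by
  rw [decomp, LinearEquiv.symm_apply_eq]
  exact (DirectSum.coeLinearMap_lof M.grade i ⟨a, ha⟩).symm

/-- The operator acting on the component of degree `i` by `(-1) ^ i`. -/
noncomputable def sgn (M : MatrixFactorization.{u, v} S φ) : M.carrier →ₗ[S] M.carrier :=
  (DirectSum.toModule S ℤ M.carrier
    (fun i => ((i.negOnePow : ℤˣ) : ℤ) • (M.grade i).subtype)) ∘ₗ M.decomp.toLinearMap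

theorem sgn_of_mem (M : MatrixFactorization.{u, v} S φ) {i : ℤ} {a : M.carrier}
    (ha : a ∈ M.grade i) : M.sgn a = ((i.negOnePow : ℤˣ) : ℤ) • a := by
  simp [sgn, M.decomp_of_mem ha]

theorem sgn_sgn (M : MatrixFactorization.{u, v} S φ) (a : M.carrier) : M.sgn (M.sgn a) = a := by
  refine M.homogeneous_induction (P := fun a => M.sgn (M.sgn a) = a) a (by simp) (fun a b ha hb => by simp [ha, hb]) ?_
  intro i a ha
  rw [M.sgn_of_mem ha, map_zsmul, M.sgn_of_mem ha, smul_smul]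
  norm_cast
  simp [Int.units_mul_self]

theorem sgn_d (M : MatrixFactorization.{u, v} S φ) (a : M.carrier) :
    M.sgn (M.d a) = - M.d (M.sgn a) := by
  refine M.homogeneous_induction (P := fun a => M.sgn (M.d a) = - M.d (M.sgn a)) a (by simp) (fun a b ha hb => by simp [ha, hb, add_comm]) ?_
  intro i a ha
  have h1 := M.dPlus_mem i a ha
  have h2 := M.dMinus_mem i a ha
  simp only [d, LinearMap.add_apply, map_add]
  rw [M.sgn_of_mem h1, M.sgn_of_mem h2, M.sgn_of_mem ha]
  simp [Int.negOnePow_sub, Int.negOnePow_add]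
  abel

/-- The part of `M` in all degrees of the same parity as `i`. -/
def parityPart (M : MatrixFactorization.{u, v} S φ) (i : ℤ) : Submodule S M.carrier :=
  ⨆ j : {j : ℤ // Even (j - i)}, M.grade j

theorem mem_parityPart (M : MatrixFactorization.{u, v} S φ) {i j : ℤ} (h : Even (j - i))
    {a : M.carrier} (ha : a ∈ M.grade j) : a ∈ M.parityPart i :=
  (le_iSup (fun j : {j : ℤ // Even (j - i)} => M.grade j) ⟨j, h⟩) ha

theorem parityPart_le (M : MatrixFactorization.{u, v} S φ) {i j : ℤ} (h : Even (j - i)) :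
    M.parityPart j ≤ M.parityPart i := by
  refine iSup_le fun k a ha => M.mem_parityPart ?_ ha
  have := k.2.add h
  simpa using this

theorem sgn_of_mem_parityPart (M : MatrixFactorization.{u, v} S φ) {i : ℤ} {a : M.carrier}
    (ha : a ∈ M.parityPart i) : M.sgn a = ((i.negOnePow : ℤˣ) : ℤ) • a := by
  refine Submodule.iSup_induction (motive := fun a => M.sgn a = ((i.negOnePow : ℤˣ) : ℤ) • a)
    _ ha ?_ (by simp) (fun a b ha hb => by simp [ha, hb])
  intro j a ha
  rw [M.sgn_of_mem ha, (Int.negOnePow_eq_iff _ _).2 j.2]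

/-- A morphism of matrix factorizations with the same potential: a linear map that commutes with
`d` and preserves the `ℤ/2`-grading. -/
structure Hom (M : MatrixFactorization.{u, v} S φ) (N : MatrixFactorization.{u, v'} S φ) where
  toLin : M.carrier →ₗ[S] N.carrier
  comm : ∀ a, toLin (M.d a) = N.d (toLin a)
  even : ∀ i, ∀ a ∈ M.grade i, toLin a ∈ N.parityPart i

namespace Hom

variable {M : MatrixFactorization.{u, v} S φ} {N : MatrixFactorization.{u, v'} S φ}
  {P : MatrixFactorization.{u, w} S φ}

theorem ext {f g : Hom M N} (h : ∀ a, f.toLin a = g.toLin a) : f = g := by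
  cases f; cases g
  congr
  exact LinearMap.ext h

theorem map_parityPart (f : Hom M N) {i : ℤ} {a : M.carrier} (ha : a ∈ M.parityPart i) :
    f.toLin a ∈ N.parityPart i := by
  refine Submodule.iSup_induction (motive := fun a => f.toLin a ∈ N.parityPart i)
    _ ha ?_ (by simp) (fun a b ha hb => by simpa using Submodule.add_mem _ ha hb)
  intro j a ha
  exact N.parityPart_le j.2 (f.even j a ha)

theorem sgn_comm (f : Hom M N) (a : M.carrier) : f.toLin (M.sgn a) = N.sgn (f.toLin a) := by
  refine M.homogeneous_induction (P := fun a => f.toLin (M.sgn a) = N.sgn (f.toLin a)) a (by simp) (fun a b ha hb => by simp [ha, hb]) ?_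
  intro i a ha
  rw [M.sgn_of_mem ha, N.sgn_of_mem_parityPart (f.even i a ha), map_zsmul]

/-- A morphism is graded if it preserves the `ℤ`-grading; it is then a chain map both for `dPlus`
and for `dMinus`. -/
def IsGraded (f : Hom M N) : Prop := ∀ i, ∀ a ∈ M.grade i, f.toLin a ∈ N.grade i

def id (M : MatrixFactorization.{u, v} S φ) : Hom M M where
  toLin := LinearMap.id
  comm _ := rfl
  even i a ha := M.mem_parityPart (by simp) ha

def comp (g : Hom N P) (f : Hom M N) : Hom M P where
  toLin := g.toLin ∘ₗ f.toLin
  comm a := by simp [f.comm, g.comm]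
  even i a ha := g.map_parityPart (f.even i a ha)

def zero (M : MatrixFactorization.{u, v} S φ) (N : MatrixFactorization.{u, v'} S φ) :
    Hom M N where
  toLin := 0
  comm _ := by simp
  even _ _ _ := by simp

def add (f g : Hom M N) : Hom M N where
  toLin := f.toLin + g.toLin
  comm a := by simp [f.comm, g.comm]
  even i a ha := Submodule.add_mem _ (f.even i a ha) (g.even i a ha)

def zsmul (n : ℤ) (f : Hom M N) : Hom M N where
  toLin := n • f.toLin
  comm a := by simp [f.comm]
  even i a ha := by
    simpa using (N.parityPart i).toAddSubgroup.zsmul_mem (f.even i a ha) n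

end Hom

/-- The same matrix factorization, for an equal potential. -/
def ofEq (h : φ = ψ) (M : MatrixFactorization.{u, v} S φ) : MatrixFactorization.{u, v} S ψ where
  carrier := M.carrier
  grade := M.grade
  isInternal := M.isInternal
  dPlus := M.dPlus
  dMinus := M.dMinus
  dPlus_mem := M.dPlus_mem
  dMinus_mem := M.dMinus_mem
  sq := h ▸ M.sq

def Hom.ofEq (h : φ = ψ) {M : MatrixFactorization.{u, v} S φ}
    {N : MatrixFactorization.{u, v'} S φ} (f : Hom M N) : Hom (M.ofEq h) (N.ofEq h) where
  toLin := f.toLin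
  comm := f.comm
  even := f.even

/-! ### Tensor products -/

/-- The degree `n` part of `M ⊗ N`, spanned by the `a ⊗ b` with `deg a + deg b = n`. -/
def tensorGrade (M : MatrixFactorization.{u, v} S φ) (N : MatrixFactorization.{u, v'} S ψ)
    (n : ℤ) : Submodule S (M.carrier ⊗[S] N.carrier) :=
  ⨆ p : {p : ℤ × ℤ // p.1 + p.2 = n},
    LinearMap.range (TensorProduct.mapIncl (M.grade p.1.1) (N.grade p.1.2))

section tensor

variable (M : MatrixFactorization.{u, v} S φ) (N : MatrixFactorization.{u, v'} S ψ)

theorem tmul_mem_tensorGrade {i j n : ℤ} (h : i + j = n) {a : M.carrier} {b : N.carrier}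
    (ha : a ∈ M.grade i) (hb : b ∈ N.grade j) : a ⊗ₜ[S] b ∈ tensorGrade M N n := by
  refine (le_iSup (fun p : {p : ℤ × ℤ // p.1 + p.2 = n} =>
    LinearMap.range (TensorProduct.mapIncl (M.grade p.1.1) (N.grade p.1.2))) ⟨(i, j), h⟩) ?_
  exact ⟨(⟨a, ha⟩ : M.grade i) ⊗ₜ (⟨b, hb⟩ : N.grade j), rfl⟩

theorem tensorGrade_le {n : ℤ} {Q : Submodule S (M.carrier ⊗[S] N.carrier)}
    (h : ∀ i j, i + j = n → ∀ a ∈ M.grade i, ∀ b ∈ N.grade j, a ⊗ₜ[S] b ∈ Q) :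
    tensorGrade M N n ≤ Q := by
  refine iSup_le fun p => ?_
  rintro _ ⟨t, rfl⟩
  induction t using TensorProduct.induction_on with
  | zero => simp
  | tmul a b => exact h _ _ p.2 a a.2 b b.2
  | add a b ha hb => simpa using Submodule.add_mem _ ha hb

theorem tensor_hom_ext {X : Type*} [AddCommGroup X] [Module S X]
    {f g : M.carrier ⊗[S] N.carrier →ₗ[S] X}
    (h : ∀ i j, ∀ a ∈ M.grade i, ∀ b ∈ N.grade j, f (a ⊗ₜ b) = g (a ⊗ₜ b)) : f = g := by
  refine TensorProduct.ext' fun a b => ?_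
  refine M.homogeneous_induction (P := fun a => f (a ⊗ₜ b) = g (a ⊗ₜ b)) a (by simp)
    (fun a b ha hb => by simp [TensorProduct.add_tmul, ha, hb]) ?_
  intro i a ha
  refine N.homogeneous_induction (P := fun b => f (a ⊗ₜ b) = g (a ⊗ₜ b)) b (by simp)
    (fun a b ha hb => by simp [TensorProduct.tmul_add, ha, hb]) ?_
  intro j b hb
  exact h i j a ha b hb

theorem tensorGrade_isInternal : DirectSum.IsInternal (tensorGrade M N) := by
  classical
  let inc (p : ℤ × ℤ) : (M.grade p.1) ⊗[S] (N.grade p.2) →ₗ[S] tensorGrade M N (p.1 + p.2) :=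
    (TensorProduct.mapIncl (M.grade p.1) (N.grade p.2)).codRestrict _ (fun t => by
      refine (le_iSup (fun q : {q : ℤ × ℤ // q.1 + q.2 = p.1 + p.2} =>
        LinearMap.range (TensorProduct.mapIncl (M.grade q.1.1) (N.grade q.1.2))) ⟨p, rfl⟩) ?_
      exact ⟨t, rfl⟩)
  let D : M.carrier ⊗[S] N.carrier →ₗ[S] ⨁ n, tensorGrade M N n :=
    (DirectSum.toModule S (ℤ × ℤ) _ (fun p =>
        DirectSum.lof S ℤ (fun n => tensorGrade M N n) (p.1 + p.2) ∘ₗ inc p)) ∘ₗ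
      (TensorProduct.directSum S S (fun i => M.grade i) (fun i => N.grade i)).toLinearMap ∘ₗ
      TensorProduct.map M.decomp.toLinearMap N.decomp.toLinearMap
  have hD : ∀ i j a (ha : a ∈ M.grade i) b (hb : b ∈ N.grade j),
      D (a ⊗ₜ b) = DirectSum.lof S ℤ (fun n => tensorGrade M N n) (i + j)
        ⟨a ⊗ₜ b, tmul_mem_tensorGrade M N rfl ha hb⟩ := by
    intro i j a ha b hb
    simp only [D, LinearMap.comp_apply, TensorProduct.map_tmul, LinearEquiv.coe_coe,
      M.decomp_of_mem ha, N.decomp_of_mem hb, TensorProduct.directSum_lof_tmul_lof,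
      DirectSum.toModule_lof]
    rfl
  refine isInternal_of_decompose _ D ?_ ?_
  · intro m
    have : DirectSum.coeLinearMap (tensorGrade M N) ∘ₗ D = LinearMap.id := by
      refine tensor_hom_ext M N ?_
      intro i j a ha b hb
      simp [hD i j a ha b hb]
    exact LinearMap.congr_fun this m
  · intro n t ht
    have key : ∀ t ∈ tensorGrade M N n, ∃ ht, D t = DirectSum.lof S ℤ
        (fun n => tensorGrade M N n) n ⟨t, ht⟩ := by
      intro t ht
      refine Submodule.iSup_induction (motive := fun t => ∃ ht, D t = DirectSum.lof S ℤ
        (fun n => tensorGrade M N n) n ⟨t, ht⟩) _ ht ?_ ⟨Submodule.zero_mem _, ?_⟩ ?_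
      · rintro ⟨⟨i, j⟩, rfl⟩ _ ⟨x, rfl⟩
        have e : D ∘ₗ TensorProduct.mapIncl (M.grade i) (N.grade j) =
            DirectSum.lof S ℤ (fun n => tensorGrade M N n) (i + j) ∘ₗ inc (i, j) :=
          TensorProduct.ext' fun a b => hD i j a a.2 b b.2
        exact ⟨(inc (i, j) x).2, LinearMap.congr_fun e x⟩
      · rw [map_zero]; symm; exact map_zero _
      · rintro a b ⟨h1, h2⟩ ⟨h3, h4⟩
        refine ⟨Submodule.add_mem _ h1 h3, ?_⟩
        rw [map_add, h2, h4, ← map_add]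
        rfl
    exact (key t ht).2

/-- The tensor product of matrix factorizations, with
`d (a ⊗ b) = d a ⊗ b + (-1) ^ deg a • a ⊗ d b`. Its potential is the sum of the potentials. -/
noncomputable abbrev tensor : MatrixFactorization.{u, max v v'} S (φ + ψ) where
  carrier := M.carrier ⊗[S] N.carrier
  grade := tensorGrade M N
  isInternal := tensorGrade_isInternal M N
  dPlus := TensorProduct.map M.dPlus LinearMap.id + TensorProduct.map M.sgn N.dPlus
  dMinus := TensorProduct.map M.dMinus LinearMap.id + TensorProduct.map M.sgn N.dMinus
  dPlus_mem n := by
    refine tensorGrade_le M N (Q := (tensorGrade M N (n + 1)).comap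
      (TensorProduct.map M.dPlus LinearMap.id + TensorProduct.map M.sgn N.dPlus)) ?_
    intro i j h a ha b hb
    rw [Submodule.mem_comap, LinearMap.add_apply]
    refine Submodule.add_mem _ ?_ ?_
    · exact tmul_mem_tensorGrade M N (by omega) (M.dPlus_mem i a ha) hb
    · rw [TensorProduct.map_tmul, M.sgn_of_mem ha]
      exact tmul_mem_tensorGrade M N (by omega)
        ((M.grade i).toAddSubgroup.zsmul_mem ha _) (N.dPlus_mem j b hb)
  dMinus_mem n := by
    refine tensorGrade_le M N (Q := (tensorGrade M N (n - 1)).comap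
      (TensorProduct.map M.dMinus LinearMap.id + TensorProduct.map M.sgn N.dMinus)) ?_
    intro i j h a ha b hb
    rw [Submodule.mem_comap, LinearMap.add_apply]
    refine Submodule.add_mem _ ?_ ?_
    · exact tmul_mem_tensorGrade M N (by omega) (M.dMinus_mem i a ha) hb
    · rw [TensorProduct.map_tmul, M.sgn_of_mem ha]
      exact tmul_mem_tensorGrade M N (by omega)
        ((M.grade i).toAddSubgroup.zsmul_mem ha _) (N.dMinus_mem j b hb)
  sq t := by
    have h : (TensorProduct.map M.dPlus LinearMap.id + TensorProduct.map M.sgn N.dPlus) +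
        (TensorProduct.map M.dMinus LinearMap.id + TensorProduct.map M.sgn N.dMinus) =
        TensorProduct.map M.d LinearMap.id + TensorProduct.map M.sgn N.d := by
      simp only [d, TensorProduct.map_add_left, TensorProduct.map_add_right]
      abel
    rw [h]
    induction t using TensorProduct.induction_on with
    | zero => simp
    | tmul a b =>
      simp [M.d_d, N.d_d, M.sgn_d, M.sgn_sgn, add_smul, TensorProduct.smul_tmul',
        TensorProduct.neg_tmul]
    | add a b ha hb => rw [map_add, map_add, ha, hb, smul_add]

theorem tensor_d : (M.tensor N).d =
    TensorProduct.map M.d LinearMap.id + TensorProduct.map M.sgn N.d := by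
  simp only [d, TensorProduct.map_add_left, TensorProduct.map_add_right]
  abel

theorem tmul_mem_parityPart {i j n : ℤ} (h : i + j = n) {a : M.carrier} {b : N.carrier}
    (ha : a ∈ M.parityPart i) (hb : b ∈ N.parityPart j) :
    (a ⊗ₜ[S] b : (M.tensor N).carrier) ∈ (M.tensor N).parityPart n := by
  refine Submodule.iSup_induction
    (motive := fun a => (a ⊗ₜ[S] b : (M.tensor N).carrier) ∈ (M.tensor N).parityPart n)
    _ ha ?_ ?_ ?_
  · intro i' a ha
    refine Submodule.iSup_induction
      (motive := fun b => (a ⊗ₜ[S] b : (M.tensor N).carrier) ∈ (M.tensor N).parityPart n)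
      _ hb ?_ ?_ ?_
    · intro j' b hb
      refine (M.tensor N).mem_parityPart (j := i' + j') ?_ (tmul_mem_tensorGrade M N rfl ha hb)
      have := i'.2.add j'.2
      have e : (i' : ℤ) + j' - n = i' - i + (j' - j) := by omega
      rwa [e]
    · simp
    · intro x y hx hy
      rw [TensorProduct.tmul_add]
      exact Submodule.add_mem _ hx hy
  · simp
  · intro x y hx hy
    rw [TensorProduct.add_tmul]
    exact Submodule.add_mem _ hx hy

end tensor

/-- The tensor product of two morphisms. -/
noncomputable def Hom.tensor {M : MatrixFactorization.{u, v} S φ}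
    {M' : MatrixFactorization.{u, v'} S φ} {N : MatrixFactorization.{u, w} S ψ}
    {N' : MatrixFactorization.{u, w'} S ψ} (f : Hom M M') (g : Hom N N') :
    Hom (M.tensor N) (M'.tensor N') where
  toLin := TensorProduct.map f.toLin g.toLin
  comm t := by
    rw [tensor_d, tensor_d]
    refine TensorProduct.induction_on t (by simp) ?_ ?_
    · intro a b
      simp [f.comm, g.comm, f.sgn_comm]
    · intro a b ha hb
      rw [map_add, map_add, ha, hb, map_add, map_add]
  even n := by
    refine tensorGrade_le M N (Q := ((M'.tensor N').parityPart n).comap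
      (TensorProduct.map f.toLin g.toLin)) ?_
    intro i j h a ha b hb
    exact tmul_mem_parityPart M' N' h (f.even i a ha) (g.even j b hb)

end MatrixFactorization

namespace MatrixFactorization

variable {S : Type u} [CommRing S] {φ ψ : S}

/-! ### Direct sums -/

section directSum

variable {ι : Type w} [DecidableEq ι] (M : ι → MatrixFactorization.{u, v} S φ)

/-- The degree `n` part of a direct sum. -/
def directSumGrade (n : ℤ) : Submodule S (⨁ i, (M i).carrier) where
  carrier := {a | ∀ i, a i ∈ (M i).grade n}
  zero_mem' _ := Submodule.zero_mem _
  add_mem' ha hb i := Submodule.add_mem _ (ha i) (hb i)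
  smul_mem' c _ ha i := Submodule.smul_mem _ c (ha i)

theorem lof_mem_directSumGrade (i : ι) {n : ℤ} {a : (M i).carrier} (ha : a ∈ (M i).grade n) :
    DirectSum.lof S ι (fun i => (M i).carrier) i a ∈ directSumGrade M n := by
  intro j
  by_cases h : i = j
  · subst h
    rw [DirectSum.lof_apply]
    exact ha
  · have : DirectSum.lof S ι (fun i => (M i).carrier) i a j = 0 :=
      DirectSum.of_eq_of_ne _ _ _ (Ne.symm h)
    rw [this]
    exact Submodule.zero_mem _

theorem directSum_ext {X : Type*} [AddCommGroup X] [Module S X]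
    {f g : (⨁ i, (M i).carrier) →ₗ[S] X}
    (h : ∀ i n, ∀ a ∈ (M i).grade n, f (DirectSum.lof S ι (fun i => (M i).carrier) i a) =
      g (DirectSum.lof S ι (fun i => (M i).carrier) i a)) : f = g := by
  refine DirectSum.linearMap_ext S fun i => LinearMap.ext fun a => ?_
  refine (M i).homogeneous_induction
    (P := fun a => f (DirectSum.lof S ι (fun i => (M i).carrier) i a) =
      g (DirectSum.lof S ι (fun i => (M i).carrier) i a)) a (by simp)
    (fun a b ha hb => by simp [ha, hb]) ?_
  exact h i

theorem mem_of_lof_mem {X : Type*} [AddCommGroup X] [Module S X] (n : ℤ)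
    {f : (⨁ i, (M i).carrier) →ₗ[S] X} {Q : Submodule S X}
    (h : ∀ i, ∀ a ∈ (M i).grade n, f (DirectSum.lof S ι (fun i => (M i).carrier) i a) ∈ Q)
    {a : ⨁ i, (M i).carrier} (ha : a ∈ directSumGrade M n) : f a ∈ Q := by
  classical
  rw [← DirectSum.sum_support_of a, map_sum]
  exact Submodule.sum_mem _ fun i _ => h i _ (ha i)

theorem directSumGrade_isInternal : DirectSum.IsInternal (directSumGrade M) := by
  classical
  let inc (i : ι) (n : ℤ) : (M i).grade n →ₗ[S] directSumGrade M n :=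
    (DirectSum.lof S ι (fun i => (M i).carrier) i ∘ₗ ((M i).grade n).subtype).codRestrict _
      (fun a => lof_mem_directSumGrade M i a.2)
  let D : (⨁ i, (M i).carrier) →ₗ[S] ⨁ n, directSumGrade M n :=
    DirectSum.toModule S ι _ (fun i =>
      (DirectSum.lmap (fun n => inc i n)) ∘ₗ (M i).decomp.toLinearMap)
  have hD : ∀ i n a (ha : a ∈ (M i).grade n),
      D (DirectSum.lof S ι (fun i => (M i).carrier) i a) =
      DirectSum.lof S ℤ (fun n => directSumGrade M n) n ⟨_, lof_mem_directSumGrade M i ha⟩ := by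
    intro i n a ha
    simp only [D, DirectSum.toModule_lof, LinearMap.comp_apply, LinearEquiv.coe_coe,
      (M i).decomp_of_mem ha, DirectSum.lmap_lof]
    rfl
  refine isInternal_of_decompose _ D ?_ ?_
  · intro m
    have : DirectSum.coeLinearMap (directSumGrade M) ∘ₗ D = LinearMap.id := by
      refine directSum_ext M fun i n a ha => ?_
      rw [LinearMap.comp_apply, hD i n a ha, DirectSum.coeLinearMap_lof]
      rfl
    exact LinearMap.congr_fun this m
  · intro n a ha
    have key : ∀ s : Finset ι, ∃ h, D (∑ i ∈ s, DirectSum.lof S ι (fun i => (M i).carrier) i (a i))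
        = DirectSum.lof S ℤ (fun n => directSumGrade M n) n
          ⟨∑ i ∈ s, DirectSum.lof S ι (fun i => (M i).carrier) i (a i), h⟩ := by
      intro s
      have h : ∀ i, DirectSum.lof S ι (fun i => (M i).carrier) i (a i) ∈ directSumGrade M n :=
        fun i => lof_mem_directSumGrade M i (ha i)
      refine ⟨Submodule.sum_mem _ fun i _ => h i, ?_⟩
      have e : (⟨∑ i ∈ s, DirectSum.lof S ι (fun i => (M i).carrier) i (a i),
          Submodule.sum_mem _ fun i _ => h i⟩ : directSumGrade M n) =
          ∑ i ∈ s, ⟨DirectSum.lof S ι (fun i => (M i).carrier) i (a i), h i⟩ := by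
        ext1
        simp
      rw [e, map_sum, map_sum]
      exact Finset.sum_congr rfl fun i _ => hD i n _ (ha i)
    have e : ∑ i ∈ DFinsupp.support a, DirectSum.lof S ι (fun i => (M i).carrier) i (a i) = a :=
      DirectSum.sum_support_of a
    obtain ⟨h, h'⟩ := key (DFinsupp.support a)
    simp only [e] at h'
    exact h'

/-- The direct sum of matrix factorizations with a common potential. -/
noncomputable abbrev directSum : MatrixFactorization.{u, max v w} S φ where
  carrier := ⨁ i, (M i).carrier
  grade := directSumGrade M
  isInternal := directSumGrade_isInternal M
  dPlus := DirectSum.lmap fun i => (M i).dPlus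
  dMinus := DirectSum.lmap fun i => (M i).dMinus
  dPlus_mem n a ha i := (M i).dPlus_mem n _ (ha i)
  dMinus_mem n a ha i := (M i).dMinus_mem n _ (ha i)
  sq a := by
    ext i
    exact (M i).sq (a i)

theorem directSum_d : (directSum M).d = DirectSum.lmap fun i => (M i).d := by
  ext i a j
  rfl

/-- The inclusion of a summand. -/
noncomputable def Hom.ofSummand (i : ι) : Hom (M i) (directSum M) where
  toLin := DirectSum.lof S ι (fun i => (M i).carrier) i
  comm a := by rw [directSum_d, DirectSum.lmap_lof]
  even n a ha := (directSum M).mem_parityPart (by simp) (lof_mem_directSumGrade M i ha)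

variable {M}

/-- The morphism out of a direct sum given by a family of morphisms. -/
noncomputable def Hom.desc {N : MatrixFactorization.{u, v'} S φ} (f : ∀ i, Hom (M i) N) :
    Hom (directSum M) N where
  toLin := DirectSum.toModule S ι N.carrier fun i => (f i).toLin
  comm a := by
    rw [directSum_d]
    have : (DirectSum.toModule S ι N.carrier fun i => (f i).toLin) ∘ₗ
        (DirectSum.lmap fun i => (M i).d) =
        N.d ∘ₗ (DirectSum.toModule S ι N.carrier fun i => (f i).toLin) := by
      refine directSum_ext M fun i n a ha => ?_
      simp [(f i).comm]
    exact LinearMap.congr_fun this a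
  even n a ha := by
    refine mem_of_lof_mem M n ?_ ha
    intro i a ha
    simpa using (f i).even n a ha

theorem Hom.desc_lof {N : MatrixFactorization.{u, v'} S φ} (f : ∀ i, Hom (M i) N) (i : ι)
    (a : (M i).carrier) :
    (Hom.desc f).toLin (DirectSum.lof S ι (fun i => (M i).carrier) i a) = (f i).toLin a :=
  DirectSum.toModule_lof (M := fun i => (M i).carrier) (φ := fun i => (f i).toLin) S i a

end directSum

/-! ### Modules as matrix factorizations, and the functor `fH` -/

/-- A module `N` annihilated by `φ`, as a matrix factorization concentrated in degree `0`. -/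
abbrev ofModule (N : Type v) [AddCommGroup N] [Module S N] (h : ∀ a : N, φ • a = 0) :
    MatrixFactorization.{u, v} S φ where
  carrier := N
  grade i := if i = 0 then ⊤ else ⊥
  isInternal := by
    refine isInternal_of_decompose _ (DirectSum.lof S ℤ _ 0 ∘ₗ
      LinearMap.codRestrict _ LinearMap.id (fun a => by simp)) (fun a => ?_) ?_
    · rw [LinearMap.comp_apply, DirectSum.coeLinearMap_lof]
      rfl
    · intro i a ha
      by_cases hi : i = 0
      · subst hi
        rfl
      · have : a = 0 := by simpa [hi] using ha
        subst this
        rw [map_zero]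
        exact (map_zero (DirectSum.lof S ℤ _ i)).symm
  dPlus := 0
  dMinus := 0
  dPlus_mem i a _ := by simp
  dMinus_mem i a _ := by simp
  sq a := by simp [h a]

/-- The base ring in degree `0`, the unit of the tensor product. -/
abbrev unit (S : Type u) [CommRing S] : MatrixFactorization.{u, u} S 0 :=
  ofModule S (fun a => zero_smul S a)

/-- The zero matrix factorization. -/
abbrev zeroObj (φ : S) : MatrixFactorization.{u, v} S φ :=
  ofModule PUnit.{v + 1} (fun _ => rfl)

/-- `M` vanishes in all positive degrees. -/
def IsNonpos (M : MatrixFactorization.{u, v} S φ) : Prop := ∀ i, 0 < i → M.grade i = ⊥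

/-- The submodule generated by the image of `dPlus` and by all `M^i` with `i ≠ 0`. -/
def fHKer (M : MatrixFactorization.{u, v} S φ) : Submodule S M.carrier :=
  LinearMap.range M.dPlus ⊔ ⨆ i : {i : ℤ // i ≠ 0}, M.grade i

theorem grade_le_fHKer (M : MatrixFactorization.{u, v} S φ) {i : ℤ} (hi : i ≠ 0) :
    M.grade i ≤ M.fHKer :=
  (le_iSup (fun i : {i : ℤ // i ≠ 0} => M.grade i) ⟨i, hi⟩).trans le_sup_right

theorem smul_mem_fHKer (M : MatrixFactorization.{u, v} S φ) (hM : M.IsNonpos) (a : M.carrier) :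
    φ • a ∈ M.fHKer := by
  refine M.homogeneous_induction (P := fun a => φ • a ∈ M.fHKer) a (by simp)
    (fun a b ha hb => by rw [smul_add]; exact Submodule.add_mem _ ha hb) ?_
  intro i a ha
  by_cases hi : i = 0
  · subst hi
    have h0 : M.dPlus a = 0 := by
      have := M.dPlus_mem 0 a ha
      rw [hM _ (by norm_num)] at this
      simpa using this
    rw [← M.sq a]
    simp only [LinearMap.add_apply, h0, zero_add]
    refine Submodule.add_mem _ (Submodule.mem_sup_left ⟨_, rfl⟩) ?_
    exact M.grade_le_fHKer (i := 0 - 1 - 1) (by norm_num)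
      (M.dMinus_mem _ _ (M.dMinus_mem _ _ ha))
  · exact M.grade_le_fHKer hi (Submodule.smul_mem _ _ ha)

/-- For `M` with `M^i = 0` for all `i > 0`, the module `H⁰(M_+) = M⁰ / dPlus M⁻¹`, placed in
degree `0`. It is written as the quotient of all of `M` by the image of `dPlus` and the `M^i` with
`i ≠ 0`. -/
abbrev fH (M : MatrixFactorization.{u, v} S φ) (hM : M.IsNonpos) :
    MatrixFactorization.{u, v} S φ :=
  ofModule (M.carrier ⧸ M.fHKer) (fun a => by
    obtain ⟨a, rfl⟩ := M.fHKer.mkQ_surjective a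
    rw [← map_smul, Submodule.mkQ_apply, Submodule.Quotient.mk_eq_zero]
    exact M.smul_mem_fHKer hM a)

/-- `M.fHKer` is what it should be: its degree `0` part is the image of `M⁻¹` under `dPlus`. -/
theorem mem_fHKer_iff (M : MatrixFactorization.{u, v} S φ) {a : M.carrier} (ha : a ∈ M.grade 0) :
    a ∈ M.fHKer ↔ ∃ b ∈ M.grade (-1), M.dPlus b = a := by
  constructor
  · intro h
    let Q : Submodule S M.carrier := (M.grade (-1)).map M.dPlus
    have hQ : Q ≤ M.grade 0 := by
      rintro _ ⟨b, hb, rfl⟩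
      exact M.dPlus_mem (-1) b hb
    have hle : M.fHKer ≤ Q ⊔ ⨆ i : {i : ℤ // i ≠ 0}, M.grade i := by
      refine sup_le ?_ le_sup_right
      rintro _ ⟨b, rfl⟩
      refine M.homogeneous_induction
        (P := fun b => M.dPlus b ∈ Q ⊔ ⨆ i : {i : ℤ // i ≠ 0}, M.grade i) b (by simp)
        (fun a b ha hb => by rw [map_add]; exact Submodule.add_mem _ ha hb) ?_
      intro i b hb
      by_cases hi : i = -1
      · subst hi
        exact Submodule.mem_sup_left ⟨b, hb, rfl⟩
      · refine Submodule.mem_sup_right ?_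
        exact (le_iSup (fun i : {i : ℤ // i ≠ 0} => M.grade i) ⟨i + 1, by omega⟩)
          (M.dPlus_mem i b hb)
    obtain ⟨x, hx, y, hy, hxy⟩ := Submodule.mem_sup.1 (hle h)
    have hy0 : y ∈ M.grade 0 := by
      have : y = a - x := by rw [← hxy]; abel
      rw [this]
      exact Submodule.sub_mem _ ha (hQ hx)
    have hd := M.isInternal.submodule_iSupIndep 0
    have hy' : y ∈ ⨆ j, ⨆ (_ : j ≠ (0 : ℤ)), M.grade j := by
      rwa [iSup_subtype']
    have : y = 0 := Submodule.disjoint_def.1 hd y hy0 hy'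
    rw [this, add_zero] at hxy
    obtain ⟨b, hb, rfl⟩ := hx
    exact ⟨b, hb, hxy⟩
  · rintro ⟨b, _, rfl⟩
    exact Submodule.mem_sup_left ⟨b, rfl⟩

/-- The natural map `M → fH M`. -/
def Hom.toFH (M : MatrixFactorization.{u, v} S φ) (hM : M.IsNonpos) : Hom M (M.fH hM) where
  toLin := M.fHKer.mkQ
  comm a := by
    have h : M.d a ∈ M.fHKer := by
      refine M.homogeneous_induction (P := fun a => M.d a ∈ M.fHKer) a (by simp)
        (fun a b ha hb => by rw [map_add]; exact Submodule.add_mem _ ha hb) ?_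
      intro i a ha
      refine Submodule.add_mem _ (Submodule.mem_sup_left ⟨a, rfl⟩) ?_
      by_cases hi : i - 1 = 0
      · have h1 := hM i (by omega)
        have h0 : a = 0 := by rw [h1] at ha; simpa using ha
        rw [h0, map_zero]
        exact Submodule.zero_mem _
      · exact M.grade_le_fHKer hi (M.dMinus_mem i a ha)
    have h2 : M.fHKer.mkQ (M.d a) = 0 := by
      rw [Submodule.mkQ_apply, Submodule.Quotient.mk_eq_zero]
      exact h
    rw [h2]
    simp [d]
  even i a ha := by
    by_cases hi : i = 0
    · subst hi
      exact (M.fH hM).mem_parityPart (j := 0) (by simp) (by simp)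
    · have : M.fHKer.mkQ a = 0 := by
        rw [Submodule.mkQ_apply, Submodule.Quotient.mk_eq_zero]
        exact M.grade_le_fHKer hi ha
      rw [this]
      exact Submodule.zero_mem _

/-- The map `fH M → fH N` induced by a morphism `f` that descends to the quotients. -/
def Hom.mapFH {M : MatrixFactorization.{u, v} S φ} {N : MatrixFactorization.{u, v'} S φ}
    (hM : M.IsNonpos) (hN : N.IsNonpos) (f : Hom M N)
    (hf : M.fHKer ≤ N.fHKer.comap f.toLin) : Hom (M.fH hM) (N.fH hN) where
  toLin := M.fHKer.mapQ N.fHKer f.toLin hf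
  comm a := by simp [d]
  even i a ha := by
    by_cases hi : i = 0
    · subst hi
      exact (N.fH hN).mem_parityPart (j := 0) (by simp) (by simp)
    · have : a = 0 := by simpa [hi] using ha
      rw [this, map_zero]
      exact Submodule.zero_mem _

/-! ### Koszul matrix factorizations -/

/-- The degree `i` part of `S ⊕ S`, the first summand in degree `-1`, the second in degree `0`. -/
def twoTermGrade (S : Type u) [CommRing S] (i : ℤ) : Submodule S (S × S) where
  carrier := {a | (i ≠ -1 → a.1 = 0) ∧ (i ≠ 0 → a.2 = 0)}
  zero_mem' := ⟨fun _ => rfl, fun _ => rfl⟩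
  add_mem' ha hb := ⟨fun h => by simp [ha.1 h, hb.1 h], fun h => by simp [ha.2 h, hb.2 h]⟩
  smul_mem' c _ ha := ⟨fun h => by simp [ha.1 h], fun h => by simp [ha.2 h]⟩

theorem mem_twoTermGrade (i : ℤ) (a : S × S) :
    a ∈ twoTermGrade S i ↔ (i ≠ -1 → a.1 = 0) ∧ (i ≠ 0 → a.2 = 0) := Iff.rfl

theorem twoTermGrade_isInternal (S : Type u) [CommRing S] :
    DirectSum.IsInternal (twoTermGrade S) := by
  let p : S × S →ₗ[S] twoTermGrade S (-1) := LinearMap.codRestrict _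
    (LinearMap.inl S S S ∘ₗ LinearMap.fst S S S) (fun a => by simp [mem_twoTermGrade])
  let q : S × S →ₗ[S] twoTermGrade S 0 := LinearMap.codRestrict _
    (LinearMap.inr S S S ∘ₗ LinearMap.snd S S S) (fun a => by simp [mem_twoTermGrade])
  refine isInternal_of_decompose _
    (DirectSum.lof S ℤ (fun i => twoTermGrade S i) (-1) ∘ₗ p +
      DirectSum.lof S ℤ (fun i => twoTermGrade S i) 0 ∘ₗ q) (fun a => ?_) ?_
  · simp only [LinearMap.add_apply, LinearMap.comp_apply, map_add, DirectSum.coeLinearMap_lof]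
    exact Prod.ext (add_zero _) (zero_add _)
  · rintro i ⟨a, b⟩ h
    have h' := (mem_twoTermGrade _ _).1 h
    simp only [LinearMap.add_apply, LinearMap.comp_apply]
    by_cases h1 : i = -1
    · subst h1
      have hb : b = 0 := h'.2 (by norm_num)
      subst hb
      have e : q (a, 0) = 0 := rfl
      rw [e, map_zero, add_zero]
      rfl
    · have ha : a = 0 := h'.1 h1
      subst ha
      have e : p (0, b) = 0 := rfl
      rw [e, map_zero, zero_add]
      by_cases h0 : i = 0
      · subst h0
        rfl
      · have hb : b = 0 := h'.2 h0
        subst hb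
        have e : q (0, 0) = 0 := rfl
        rw [e, map_zero]
        exact (map_zero (DirectSum.lof S ℤ (fun i => twoTermGrade S i) i)).symm

/-- The matrix factorization `S ⇄ S` with `dPlus = x : S → S` from degree `-1` to degree `0` and
`dMinus = y : S → S` from degree `0` to degree `-1`. -/
abbrev twoTerm (x y : S) : MatrixFactorization.{u, u} S (x * y) where
  carrier := S × S
  grade := twoTermGrade S
  isInternal := twoTermGrade_isInternal S
  dPlus := LinearMap.inr S S S ∘ₗ (x • LinearMap.fst S S S)
  dMinus := LinearMap.inl S S S ∘ₗ (y • LinearMap.snd S S S)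
  dPlus_mem i a ha := by
    refine ⟨fun _ => rfl, fun h => ?_⟩
    have : a.1 = 0 := ha.1 (by omega)
    simp [this]
  dMinus_mem i a ha := by
    refine ⟨fun h => ?_, fun _ => rfl⟩
    have : a.2 = 0 := ha.2 (by omega)
    simp [this]
  sq a := by
    ext
    · simp; ring
    · simp; ring

theorem twoTerm_isNonpos (x y : S) : (twoTerm x y).IsNonpos := by
  intro i hi
  rw [eq_bot_iff]
  intro a ha
  rw [Submodule.mem_bot]
  exact Prod.ext (ha.1 (by omega)) (ha.2 (by omega))

theorem IsNonpos.tensor {M : MatrixFactorization.{u, v} S φ} {N : MatrixFactorization.{u, v'} S ψ}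
    (hM : M.IsNonpos) (hN : N.IsNonpos) : (M.tensor N).IsNonpos := by
  intro n hn
  rw [eq_bot_iff]
  refine tensorGrade_le M N ?_
  intro i j hij a ha b hb
  by_cases hi : 0 < i
  · rw [hM i hi, Submodule.mem_bot] at ha
    simp [ha]
  · rw [hN j (by omega), Submodule.mem_bot] at hb
    simp [hb]

/-- The Koszul matrix factorization of a pair of sequences `(x₁, x₂)`, `(y₁, y₂)`. -/
noncomputable abbrev koszul₂ (x₁ x₂ y₁ y₂ : S) (h : x₁ * y₁ + x₂ * y₂ = φ) :
    MatrixFactorization.{u, u} S φ :=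
  ((twoTerm x₁ y₁).tensor (twoTerm x₂ y₂)).ofEq h

theorem koszul₂_isNonpos (x₁ x₂ y₁ y₂ : S) (h : x₁ * y₁ + x₂ * y₂ = φ) :
    (koszul₂ x₁ x₂ y₁ y₂ h).IsNonpos :=
  (twoTerm_isNonpos x₁ y₁).tensor (twoTerm_isNonpos x₂ y₂)

/-- The generator of the degree `0` part of a Koszul matrix factorization. -/
def koszulOne (x₁ x₂ y₁ y₂ : S) (h : x₁ * y₁ + x₂ * y₂ = φ) :
    (koszul₂ x₁ x₂ y₁ y₂ h).carrier :=
  ((0, 1) : S × S) ⊗ₜ[S] ((0, 1) : S × S)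

/-- The tensor product of a finite sequence of matrix factorizations. -/
noncomputable def tensorFamily : {n : ℕ} → {φ : Fin n → S} →
    (∀ i, MatrixFactorization.{u, u} S (φ i)) → MatrixFactorization.{u, u} S (∑ i, φ i)
  | 0, _, _ => (unit S).ofEq (by simp)
  | _ + 1, _, M => ((M 0).tensor (tensorFamily fun i => M i.succ)).ofEq (by
      rw [Fin.sum_univ_succ])

/-! ### Total homology and near-isomorphisms -/

/-- The total homology `ker d / im d`; it is meant for potential `0`, where `im d ≤ ker d`. -/
abbrev Ht (M : MatrixFactorization.{u, v} S φ) : Type v :=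
  LinearMap.ker M.d ⧸ (LinearMap.range M.d).submoduleOf (LinearMap.ker M.d)

/-- The map induced by a morphism on total homology. -/
def Ht.map {M : MatrixFactorization.{u, v} S φ} {N : MatrixFactorization.{u, v'} S φ}
    (f : Hom M N) : M.Ht →ₗ[S] N.Ht :=
  Submodule.mapQ _ _
    (f.toLin.restrict (p := LinearMap.ker M.d) (q := LinearMap.ker N.d) (fun a ha => by
      rw [LinearMap.mem_ker] at ha ⊢
      rw [← f.comm, ha, map_zero]))
    (by
      rintro ⟨_, _⟩ ⟨b, rfl⟩
      exact ⟨f.toLin b, (f.comm b).symm⟩)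

/-- A near-isomorphism: a graded morphism `f : M → N` such that, for each matrix factorization `D`
of potential `-φ` on a projective `S`-module, `f ⊗ D` induces an isomorphism
`Ht (M ⊗ D) → Ht (N ⊗ D)`. -/
def IsNearIso {M : MatrixFactorization.{u, v} S φ} {N : MatrixFactorization.{u, v'} S φ}
    (f : Hom M N) : Prop :=
  f.IsGraded ∧ ∀ D : MatrixFactorization.{u, w} S (-φ), Module.Projective S D.carrier →
    Function.Bijective (Ht.map (f.tensor (Hom.id D)))

/-! ### Restriction of scalars -/

section restrictScalars

variable {R : Type u} [CommRing R] [Algebra R S] {χ : R}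

/-- A matrix factorization over `S`, regarded as one over `R` when its potential comes from `R`. -/
abbrev restrictScalars (h : algebraMap R S χ = φ) (M : MatrixFactorization.{u, v} S φ) :
    MatrixFactorization.{u, v} R χ :=
  letI : Module R M.carrier := Module.compHom M.carrier (algebraMap R S)
  haveI : IsScalarTower R S M.carrier := ⟨fun r s m => by
    rw [Algebra.smul_def, mul_smul]; rfl⟩
  { carrier := M.carrier
    grade := fun i => (M.grade i).restrictScalars R
    isInternal := M.isInternal
    dPlus := M.dPlus.restrictScalars R
    dMinus := M.dMinus.restrictScalars R
    dPlus_mem := M.dPlus_mem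
    dMinus_mem := M.dMinus_mem
    sq := fun a => (M.sq a).trans (congrArg (· • a) h.symm) }

theorem restrictScalars_mem_parityPart (h : algebraMap R S χ = φ)
    (M : MatrixFactorization.{u, v} S φ) {i : ℤ} {a : M.carrier} (ha : a ∈ M.parityPart i) :
    a ∈ (M.restrictScalars h).parityPart i := by
  refine Submodule.iSup_induction (motive := fun a => a ∈ (M.restrictScalars h).parityPart i)
    _ ha ?_ (Submodule.zero_mem _) (fun a b ha hb => Submodule.add_mem _ ha hb)
  intro j a ha
  exact (M.restrictScalars h).mem_parityPart j.2 ha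

/-- A morphism over `S`, regarded as a morphism over `R`. -/
def Hom.restrictScalars (h : algebraMap R S χ = φ) {M : MatrixFactorization.{u, v} S φ}
    {N : MatrixFactorization.{u, v'} S φ} (f : Hom M N) :
    Hom (M.restrictScalars h) (N.restrictScalars h) where
  toLin :=
    { toFun := f.toLin
      map_add' := f.toLin.map_add
      map_smul' := fun r a => f.toLin.map_smul (algebraMap R S r) a }
  comm := f.comm
  even i a ha := restrictScalars_mem_parityPart h N (f.even i a ha)

end restrictScalars

end MatrixFactorization

/-! ### Complexes of matrix factorizations -/

/-- A complex of matrix factorizations over `S` with potential `φ`. -/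
structure MFComplex (S : Type u) [CommRing S] (φ : S) where
  obj : ℤ → MatrixFactorization.{u, v} S φ
  δ : ∀ n, MatrixFactorization.Hom (obj n) (obj (n + 1))
  δ_δ : ∀ n a, (δ (n + 1)).toLin ((δ n).toLin a) = 0

namespace MFComplex

open MatrixFactorization

variable {S : Type u} [CommRing S] {φ ψ : S}

/-- A chain map between complexes of matrix factorizations. -/
structure Hom (C : MFComplex.{u, v} S φ) (E : MFComplex.{u, v'} S φ) where
  f : ∀ n, MatrixFactorization.Hom (C.obj n) (E.obj n)
  comm : ∀ n a, (f (n + 1)).toLin ((C.δ n).toLin a) = (E.δ n).toLin ((f n).toLin a)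

def ofEq (h : φ = ψ) (C : MFComplex.{u, v} S φ) : MFComplex.{u, v} S ψ where
  obj n := (C.obj n).ofEq h
  δ n := (C.δ n).ofEq h
  δ_δ n a := C.δ_δ n a

def Hom.ofEq (h : φ = ψ) {C : MFComplex.{u, v} S φ} {E : MFComplex.{u, v'} S φ} (g : Hom C E) :
    Hom (C.ofEq h) (E.ofEq h) where
  f n := (g.f n).ofEq h
  comm n a := g.comm n a

def Hom.id (C : MFComplex.{u, v} S φ) : Hom C C where
  f _ := MatrixFactorization.Hom.id _
  comm _ _ := rfl

/-- The complex `A → B` with `A` in homological degree `-1` and `B` in homological degree `0`. -/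
def twoTermNeg {A B : MatrixFactorization.{u, v} S φ} (ρ : MatrixFactorization.Hom A B) :
    MFComplex.{u, v} S φ where
  obj n := match n with
    | .negSucc 0 => A
    | .ofNat 0 => B
    | _ => zeroObj φ
  δ n := match n with
    | .negSucc 0 => ρ
    | .negSucc (_ + 1) => MatrixFactorization.Hom.zero _ _
    | .ofNat _ => MatrixFactorization.Hom.zero _ _
  δ_δ n := match n with
    | .negSucc 0 => fun _ => rfl
    | .negSucc (_ + 1) => fun _ => map_zero _
    | .ofNat _ => fun _ => map_zero _

/-- The complex `A → B` with `A` in homological degree `0` and `B` in homological degree `1`. -/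
def twoTermPos {A B : MatrixFactorization.{u, v} S φ} (ρ : MatrixFactorization.Hom A B) :
    MFComplex.{u, v} S φ where
  obj n := match n with
    | .ofNat 0 => A
    | .ofNat 1 => B
    | _ => zeroObj φ
  δ n := match n with
    | .ofNat 0 => ρ
    | .ofNat (_ + 1) => MatrixFactorization.Hom.zero _ _
    | .negSucc _ => MatrixFactorization.Hom.zero _ _
  δ_δ n := match n with
    | .ofNat 0 => fun _ => rfl
    | .ofNat (_ + 1) => fun _ => map_zero _
    | .negSucc _ => fun _ => map_zero _

/-- The chain map between two-term complexes given by a commutative square. -/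
def Hom.twoTermNeg {A B : MatrixFactorization.{u, v} S φ} {A' B' : MatrixFactorization.{u, v'} S φ}
    {ρ : MatrixFactorization.Hom A B} {ρ' : MatrixFactorization.Hom A' B'}
    (f : MatrixFactorization.Hom A A') (g : MatrixFactorization.Hom B B')
    (h : ∀ a, g.toLin (ρ.toLin a) = ρ'.toLin (f.toLin a)) :
    Hom (twoTermNeg ρ) (twoTermNeg ρ') where
  f n := match n with
    | .negSucc 0 => f
    | .ofNat 0 => g
    | .negSucc (_ + 1) => MatrixFactorization.Hom.zero _ _
    | .ofNat (_ + 1) => MatrixFactorization.Hom.zero _ _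
  comm n := match n with
    | .negSucc 0 => h
    | .negSucc (_ + 1) => fun _ => map_zero _
    | .ofNat _ => fun _ => map_zero _

/-- The chain map between two-term complexes given by a commutative square. -/
def Hom.twoTermPos {A B : MatrixFactorization.{u, v} S φ} {A' B' : MatrixFactorization.{u, v'} S φ}
    {ρ : MatrixFactorization.Hom A B} {ρ' : MatrixFactorization.Hom A' B'}
    (f : MatrixFactorization.Hom A A') (g : MatrixFactorization.Hom B B')
    (h : ∀ a, g.toLin (ρ.toLin a) = ρ'.toLin (f.toLin a)) :
    Hom (twoTermPos ρ) (twoTermPos ρ') where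
  f n := match n with
    | .ofNat 0 => f
    | .ofNat 1 => g
    | .ofNat (_ + 2) => MatrixFactorization.Hom.zero _ _
    | .negSucc _ => MatrixFactorization.Hom.zero _ _
  comm n := match n with
    | .ofNat 0 => h
    | .ofNat (_ + 1) => fun _ => map_zero _
    | .negSucc _ => fun _ => map_zero _

/-- The base ring in both degrees `0`, the unit of the tensor product of complexes. -/
def unit (S : Type u) [CommRing S] : MFComplex.{u, u} S 0 where
  obj n := match n with
    | .ofNat 0 => MatrixFactorization.unit S
    | _ => zeroObj 0
  δ _ := MatrixFactorization.Hom.zero _ _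
  δ_δ _ _ := rfl

/-- The tensor product of a matrix factorization with a complex. -/
noncomputable abbrev tensorLeft (M : MatrixFactorization.{u, v} S φ) (C : MFComplex.{u, v'} S ψ) :
    MFComplex.{u, max v v'} S (φ + ψ) where
  obj n := M.tensor (C.obj n)
  δ n := (MatrixFactorization.Hom.id M).tensor (C.δ n)
  δ_δ n a := by
    refine TensorProduct.induction_on a (by simp) ?_ (fun a b ha hb => by
      rw [map_add, map_add, ha, hb, add_zero])
    intro a b
    simp [MatrixFactorization.Hom.tensor, C.δ_δ]

noncomputable def Hom.tensorLeft (M : MatrixFactorization.{u, v} S φ)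
    {C : MFComplex.{u, v'} S ψ} {E : MFComplex.{u, w'} S ψ} (g : Hom C E) :
    Hom (tensorLeft M C) (tensorLeft M E) where
  f n := (MatrixFactorization.Hom.id M).tensor (g.f n)
  comm n a := by
    refine TensorProduct.induction_on a (by simp) ?_ (fun a b ha hb => by
      simp only [map_add, ha, hb])
    intro a b
    exact congrArg (fun t => a ⊗ₜ[S] t) (g.comm n b)

/-- The differential of `C ⊗ E` on the summand `C^p ⊗ E^q`, `p + q = n`: it is
`a ⊗ b ↦ δ a ⊗ b + (-1) ^ p • a ⊗ δ b`. -/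
noncomputable def tensorδ (C : MFComplex.{u, v} S φ) (E : MFComplex.{u, v'} S ψ) (n : ℤ)
    (p : {p : ℤ × ℤ // p.1 + p.2 = n}) :
    MatrixFactorization.Hom ((C.obj p.1.1).tensor (E.obj p.1.2))
      (directSum fun q : {q : ℤ × ℤ // q.1 + q.2 = n + 1} =>
        (C.obj q.1.1).tensor (E.obj q.1.2)) :=
  ((Hom.ofSummand (fun q : {q : ℤ × ℤ // q.1 + q.2 = n + 1} =>
      (C.obj q.1.1).tensor (E.obj q.1.2))
      ⟨(p.1.1 + 1, p.1.2), by have := p.2; dsimp only; omega⟩).comp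
    ((C.δ p.1.1).tensor (MatrixFactorization.Hom.id (E.obj p.1.2)))).add
  (((Hom.ofSummand (fun q : {q : ℤ × ℤ // q.1 + q.2 = n + 1} =>
      (C.obj q.1.1).tensor (E.obj q.1.2))
      ⟨(p.1.1, p.1.2 + 1), by have := p.2; dsimp only; omega⟩).comp
    ((MatrixFactorization.Hom.id (C.obj p.1.1)).tensor (E.δ p.1.2))).zsmul
      ((p.1.1.negOnePow : ℤˣ) : ℤ))

theorem tensorδ_tmul (C : MFComplex.{u, v} S φ) (E : MFComplex.{u, v'} S ψ) (n : ℤ)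
    (p : {p : ℤ × ℤ // p.1 + p.2 = n}) (a : (C.obj p.1.1).carrier) (b : (E.obj p.1.2).carrier) :
    (tensorδ C E n p).toLin (a ⊗ₜ b) =
    DirectSum.lof S _ (fun q : {q : ℤ × ℤ // q.1 + q.2 = n + 1} =>
        ((C.obj q.1.1).tensor (E.obj q.1.2)).carrier)
      ⟨(p.1.1 + 1, p.1.2), by have := p.2; dsimp only; omega⟩ ((C.δ p.1.1).toLin a ⊗ₜ b) +
    ((p.1.1.negOnePow : ℤˣ) : ℤ) •
      DirectSum.lof S _ (fun q : {q : ℤ × ℤ // q.1 + q.2 = n + 1} =>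
        ((C.obj q.1.1).tensor (E.obj q.1.2)).carrier)
      ⟨(p.1.1, p.1.2 + 1), by have := p.2; dsimp only; omega⟩ (a ⊗ₜ (E.δ p.1.2).toLin b) :=
  rfl

/-- The tensor product of complexes of matrix factorizations. -/
noncomputable abbrev tensor (C : MFComplex.{u, v} S φ) (E : MFComplex.{u, v'} S ψ) :
    MFComplex.{u, max v v'} S (φ + ψ) where
  obj n := directSum fun p : {p : ℤ × ℤ // p.1 + p.2 = n} => (C.obj p.1.1).tensor (E.obj p.1.2)
  δ n := Hom.desc (tensorδ C E n)
  δ_δ n x := by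
    have : (Hom.desc (tensorδ C E (n + 1))).toLin ∘ₗ (Hom.desc (tensorδ C E n)).toLin = 0 := by
      refine DirectSum.linearMap_ext S fun p => TensorProduct.ext' fun a b => ?_
      have h1 := Hom.desc_lof (tensorδ C E n) p (a ⊗ₜ b)
      rw [tensorδ_tmul] at h1
      refine (congrArg (Hom.desc (tensorδ C E (n + 1))).toLin h1).trans ?_
      rw [map_add, map_zsmul, Hom.desc_lof, Hom.desc_lof, tensorδ_tmul, tensorδ_tmul, C.δ_δ,
        E.δ_δ, TensorProduct.zero_tmul, TensorProduct.tmul_zero, map_zero, map_zero, smul_zero,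
        zero_add, add_zero, Int.negOnePow_succ, Units.val_neg, neg_smul]
      exact neg_add_cancel _
    exact LinearMap.congr_fun this x

/-- The tensor product of chain maps. -/
noncomputable def Hom.tensor {C : MFComplex.{u, v} S φ} {C' : MFComplex.{u, v'} S φ}
    {E : MFComplex.{u, w} S ψ} {E' : MFComplex.{u, w'} S ψ} (g : Hom C C') (h : Hom E E') :
    Hom (C.tensor E) (C'.tensor E') where
  f n := Hom.desc fun p => (Hom.ofSummand (fun p : {p : ℤ × ℤ // p.1 + p.2 = n} =>
    (C'.obj p.1.1).tensor (E'.obj p.1.2)) p).comp ((g.f p.1.1).tensor (h.f p.1.2))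
  comm n x := by
    let F (n : ℤ) := Hom.desc fun p => (Hom.ofSummand (fun p : {p : ℤ × ℤ // p.1 + p.2 = n} =>
      (C'.obj p.1.1).tensor (E'.obj p.1.2)) p).comp ((g.f p.1.1).tensor (h.f p.1.2))
    have : (F (n + 1)).toLin ∘ₗ (Hom.desc (tensorδ C E n)).toLin =
        (Hom.desc (tensorδ C' E' n)).toLin ∘ₗ (F n).toLin := by
      refine DirectSum.linearMap_ext S fun p => TensorProduct.ext' fun a b => ?_
      have h1 := Hom.desc_lof (tensorδ C E n) p (a ⊗ₜ b)
      rw [tensorδ_tmul] at h1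
      have h2 := Hom.desc_lof (fun p => (Hom.ofSummand (fun p : {p : ℤ × ℤ // p.1 + p.2 = n} =>
        (C'.obj p.1.1).tensor (E'.obj p.1.2)) p).comp ((g.f p.1.1).tensor (h.f p.1.2))) p (a ⊗ₜ b)
      refine (congrArg (F (n + 1)).toLin h1).trans
        (Eq.trans ?_ (congrArg (Hom.desc (tensorδ C' E' n)).toLin h2).symm)
      have h3 := (Hom.desc_lof (tensorδ C' E' n) p ((g.f p.1.1).toLin a ⊗ₜ (h.f p.1.2).toLin b))
      rw [tensorδ_tmul, ← g.comm, ← h.comm] at h3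
      refine Eq.trans ?_ h3.symm
      rw [map_add, map_zsmul, Hom.desc_lof, Hom.desc_lof]
      rfl
    exact LinearMap.congr_fun this x

/-- The tensor product of a finite sequence of complexes. -/
noncomputable def tensorFamily : {n : ℕ} → {φ : Fin n → S} →
    (∀ i, MFComplex.{u, u} S (φ i)) → MFComplex.{u, u} S (∑ i, φ i)
  | 0, _, _ => (unit S).ofEq (by simp)
  | _ + 1, _, C => ((C 0).tensor (tensorFamily fun i => C i.succ)).ofEq (by
      rw [Fin.sum_univ_succ])

/-- The tensor product of a finite sequence of chain maps. -/
noncomputable def Hom.tensorFamily : {n : ℕ} → {φ : Fin n → S} →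
    {C E : ∀ i, MFComplex.{u, u} S (φ i)} → (∀ i, Hom (C i) (E i)) →
    Hom (tensorFamily C) (tensorFamily E)
  | 0, _, _, _, _ => (Hom.id (unit S)).ofEq (by simp)
  | _ + 1, _, _, _, g => ((g 0).tensor (Hom.tensorFamily fun i => g i.succ)).ofEq (by
      rw [Fin.sum_univ_succ])

/-- A chain map that is a near-isomorphism in each homological degree. -/
def IsDegreewiseNearIso {C : MFComplex.{u, v} S φ} {E : MFComplex.{u, v'} S φ} (g : Hom C E) :
    Prop :=
  ∀ n, IsNearIso.{u, v, v', w} (g.f n)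

section restrictScalars

variable {R : Type u} [CommRing R] [Algebra R S] {χ : R}

/-- A complex of matrix factorizations over `S`, regarded as one over `R`. -/
def restrictScalars (h : algebraMap R S χ = φ) (C : MFComplex.{u, v} S φ) :
    MFComplex.{u, v} R χ where
  obj n := (C.obj n).restrictScalars h
  δ n := (C.δ n).restrictScalars h
  δ_δ n a := C.δ_δ n a

def Hom.restrictScalars (h : algebraMap R S χ = φ) {C : MFComplex.{u, v} S φ}
    {E : MFComplex.{u, v'} S φ} (g : Hom C E) :
    Hom (C.restrictScalars h) (E.restrictScalars h) where
  f n := (g.f n).restrictScalars h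
  comm n a := g.comm n a

end restrictScalars

end MFComplex

/-! ### The factorizations attached to crossings and edges -/

section Crossing

open MatrixFactorization

variable {k : Type w} [CommRing k] {S : Type u} [CommRing S] [Algebra k S]

/-- The polynomial `(p(a) - p(b)) / (a - b)` evaluated at elements `a`, `b` of a `k`-algebra. -/
noncomputable def dividedDifference (p : Polynomial k) (a b : S) : S :=
  p.sum fun n c => c • ∑ i ∈ Finset.range n, a ^ i * b ^ (n - 1 - i)

theorem sub_mul_dividedDifference (p : Polynomial k) (a b : S) :
    (a - b) * dividedDifference p a b = Polynomial.aeval a p - Polynomial.aeval b p := by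
  rw [dividedDifference, Polynomial.aeval_eq_sum_range, Polynomial.aeval_eq_sum_range,
    Polynomial.sum_over_range _ (fun n => by simp), Finset.mul_sum, ← Finset.sum_sub_distrib]
  refine Finset.sum_congr rfl fun n _ => ?_
  rw [mul_smul_comm, ← smul_sub, mul_comm, (Commute.all a b).geom_sum₂_mul]

/-- The potential of a crossing with outgoing variables `ti`, `tj` and incoming variables
`tk`, `tl`. -/
noncomputable def crossingPotential (p : Polynomial k) (ti tj tk tl : S) : S :=
  Polynomial.aeval ti p + Polynomial.aeval tj p - Polynomial.aeval tk p - Polynomial.aeval tl p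

/-- The choices entering the Khovanov-Rozansky complex of a crossing:
* a Koszul matrix factorization `L'` on the sequence `(ti + tj - tk - tl, ti tj - tk tl)` and a
  Koszul matrix factorization `L''` on the sequence `(ti - tl, tj - tk)`, both of potential
  `p(ti) + p(tj) - p(tk) - p(tl)`;
* morphisms `ρPos : L' → L''` and `ρNeg : L'' → L'` that induce maps on `fH L'`, `fH L''`, the
  former the projection (it sends the class of `1` to the class of `1`), the latter
  multiplication by `ti - tk` (it sends the class of `1` to `ti - tk` times the class of `1`).
As `fH L'` and `fH L''` are cyclic modules, the last conditions determine the induced maps. -/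
structure CrossingModel (p : Polynomial k) (ti tj tk tl : S) where
  y₁' : S
  y₂' : S
  potential' : (ti + tj - tk - tl) * y₁' + (ti * tj - tk * tl) * y₂' =
    crossingPotential p ti tj tk tl
  y₁'' : S
  y₂'' : S
  potential'' : (ti - tl) * y₁'' + (tj - tk) * y₂'' = crossingPotential p ti tj tk tl
  ρPos : Hom (koszul₂ _ _ _ _ potential') (koszul₂ _ _ _ _ potential'')
  ρPos_descends : (koszul₂ _ _ _ _ potential').fHKer ≤
    (koszul₂ _ _ _ _ potential'').fHKer.comap ρPos.toLin
  ρPos_one :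
    (Hom.mapFH (koszul₂_isNonpos _ _ _ _ potential') (koszul₂_isNonpos _ _ _ _ potential'')
      ρPos ρPos_descends).toLin (Submodule.Quotient.mk (koszulOne _ _ _ _ potential')) =
    Submodule.Quotient.mk (koszulOne _ _ _ _ potential'')
  ρNeg : Hom (koszul₂ _ _ _ _ potential'') (koszul₂ _ _ _ _ potential')
  ρNeg_descends : (koszul₂ _ _ _ _ potential'').fHKer ≤
    (koszul₂ _ _ _ _ potential').fHKer.comap ρNeg.toLin
  ρNeg_one :
    (Hom.mapFH (koszul₂_isNonpos _ _ _ _ potential'') (koszul₂_isNonpos _ _ _ _ potential')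
      ρNeg ρNeg_descends).toLin (Submodule.Quotient.mk (koszulOne _ _ _ _ potential'')) =
    (ti - tk) • Submodule.Quotient.mk (koszulOne _ _ _ _ potential')

namespace CrossingModel

variable {p : Polynomial k} {ti tj tk tl : S} (c : CrossingModel p ti tj tk tl)

/-- The matrix factorization `L'` of the singular resolution. -/
noncomputable abbrev L' : MatrixFactorization.{u, u} S (crossingPotential p ti tj tk tl) :=
  koszul₂ _ _ _ _ c.potential'

/-- The matrix factorization `L''` of the oriented smoothing. -/
noncomputable abbrev L'' : MatrixFactorization.{u, u} S (crossingPotential p ti tj tk tl) :=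
  koszul₂ _ _ _ _ c.potential''

theorem L'_isNonpos : c.L'.IsNonpos := koszul₂_isNonpos _ _ _ _ c.potential'

theorem L''_isNonpos : c.L''.IsNonpos := koszul₂_isNonpos _ _ _ _ c.potential''

/-- The two-term complex `L` of a crossing: `ρPos : L' → L''` for a positive crossing and
`ρNeg : L'' → L'` for a negative one, in each case with `L''` in homological degree `0`. -/
noncomputable def L (positive : Bool) :
    MFComplex.{u, u} S (crossingPotential p ti tj tk tl) :=
  match positive with
  | true => MFComplex.twoTermNeg (A := c.L') (B := c.L'') c.ρPos
  | false => MFComplex.twoTermPos (A := c.L'') (B := c.L') c.ρNeg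

/-- The complex `fH L`, obtained by applying `fH` to each term of `L`. -/
noncomputable def fHL (positive : Bool) :
    MFComplex.{u, u} S (crossingPotential p ti tj tk tl) :=
  match positive with
  | true => MFComplex.twoTermNeg (Hom.mapFH c.L'_isNonpos c.L''_isNonpos c.ρPos c.ρPos_descends)
  | false => MFComplex.twoTermPos (Hom.mapFH c.L''_isNonpos c.L'_isNonpos c.ρNeg c.ρNeg_descends)

/-- The natural map `L → fH L`. -/
noncomputable def toFHL (positive : Bool) : MFComplex.Hom (c.L positive) (c.fHL positive) :=
  match positive with
  | true => MFComplex.Hom.twoTermNeg (Hom.toFH c.L' c.L'_isNonpos) (Hom.toFH c.L'' c.L''_isNonpos)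
      (fun _ => rfl)
  | false => MFComplex.Hom.twoTermPos (Hom.toFH c.L'' c.L''_isNonpos)
      (Hom.toFH c.L' c.L'_isNonpos) (fun _ => rfl)

end CrossingModel

end Crossing

/-! ### Tangle diagrams -/

/-- The two sides of a strand through a crossing, looking in the direction of the orientation. -/
inductive Side
  | left
  | right
  deriving DecidableEq

instance : Fintype Side := ⟨{Side.left, Side.right}, fun x => by cases x <;> simp⟩

theorem Side.sum_eq {M : Type*} [AddCommMonoid M] (f : Side → M) :
    ∑ s, f s = f .left + f .right := by
  have h : (Finset.univ : Finset Side) = {Side.left, Side.right} := rfl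
  rw [h, Finset.sum_pair (by simp)]

/-- The combinatorial data of an oriented tangle diagram. Its crossings, edges (segments between
crossings or endpoints), closed components without crossings, and endpoints (where a strand starts,
resp. stops) are numbered. At each crossing two edges end and two edges start, on the left and on
the right; each edge starts at a crossing or at an endpoint, and stops at a crossing or at an
endpoint. Every oriented tangle diagram in a disk determines such data; that the resulting graph
is planar is not required. -/
structure TangleDiagram where
  numCrossings : ℕ
  numEdges : ℕ
  numCircles : ℕ
  numStarts : ℕ
  numStops : ℕ
  /-- The sign of each crossing. -/
  positive : Fin numCrossings → Bool
  /-- The vertex (and the place at this vertex) where an edge starts. -/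
  tail : Fin numEdges ≃ (Fin numCrossings × Side) ⊕ Fin numStarts
  /-- The vertex (and the place at this vertex) where an edge stops. -/
  head : Fin numEdges ≃ (Fin numCrossings × Side) ⊕ Fin numStops

namespace TangleDiagram

open MatrixFactorization

variable (T : TangleDiagram)

/-- The flags of the graph of `T`: each edge has a flag at its tail and one at its head. Each
closed component without crossings carries one marked point. -/
inductive Flag
  | tail (e : Fin T.numEdges)
  | head (e : Fin T.numEdges)
  | mark (o : Fin T.numCircles)

/-- The flag of the edge that leaves the crossing `x` on the given side. -/
def outFlag (x : Fin T.numCrossings) (s : Side) : T.Flag := .tail (T.tail.symm (.inl (x, s)))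

/-- The flag of the edge that enters the crossing `x` on the given side. -/
def inFlag (x : Fin T.numCrossings) (s : Side) : T.Flag := .head (T.head.symm (.inl (x, s)))

/-- The flag at an endpoint where a strand starts. -/
def startFlag (s : Fin T.numStarts) : T.Flag := .tail (T.tail.symm (.inr s))

/-- The flag at an endpoint where a strand stops. -/
def stopFlag (s : Fin T.numStops) : T.Flag := .head (T.head.symm (.inr s))

/-- The flags at the endpoints of the tangle. -/
def leafFlags : Set T.Flag := Set.range T.startFlag ∪ Set.range T.stopFlag

section

variable {k : Type u} [Field k]

/-- The polynomial ring over `k` in the variables indexed by the flags. -/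
abbrev FlagRing (k : Type u) [Field k] : Type u := MvPolynomial T.Flag k

/-- The subring generated by the variables at the endpoints of the tangle. -/
noncomputable abbrev LeafRing (k : Type u) [Field k] : Subalgebra k (T.FlagRing k) :=
  MvPolynomial.supported k T.leafFlags

/-- The variable of a flag. -/
noncomputable abbrev t (k : Type u) [Field k] (f : T.Flag) : T.FlagRing k := MvPolynomial.X f

/-- The choice of the factorizations and maps at a crossing. The outgoing edges on the left and
right carry `ti` and `tj`, the incoming edges on the right and left carry `tk` and `tl`. -/
abbrev CrossingChoice (p : Polynomial k) (x : Fin T.numCrossings) : Type u :=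
  CrossingModel p (T.t k (T.outFlag x .left)) (T.t k (T.outFlag x .right))
    (T.t k (T.inFlag x .right)) (T.t k (T.inFlag x .left))

/-- The factorization of an edge: the Koszul matrix factorization of the pair `b - a`,
`(p(b) - p(a)) / (b - a)`, with `a` and `b` the variables at its tail and its head. -/
noncomputable abbrev Ledge (p : Polynomial k) (e : Fin T.numEdges) :=
  twoTerm (T.t k (.head e) - T.t k (.tail e))
    (dividedDifference p (T.t k (.head e)) (T.t k (.tail e)))

/-- The factorization of a closed component without crossings, seen as an edge whose tail and head
are the same marked point. -/
noncomputable abbrev Lcircle (p : Polynomial k) (o : Fin T.numCircles) :=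
  twoTerm (T.t k (.mark o) - T.t k (.mark o))
    (dividedDifference p (T.t k (.mark o)) (T.t k (.mark o)))

/-- The tensor product of the factorizations of all edges. -/
noncomputable abbrev edges (p : Polynomial k) :=
  (tensorFamily (T.Ledge p)).tensor (tensorFamily (T.Lcircle p))

/-- The Khovanov-Rozansky complex. -/
noncomputable def KR (p : Polynomial k) (c : ∀ x, T.CrossingChoice p x) :=
  MFComplex.tensorLeft (T.edges p) (MFComplex.tensorFamily fun x => (c x).L (T.positive x))

/-- The complex obtained by replacing the complex `L` of each crossing by `fH L`. -/
noncomputable def KRhat (p : Polynomial k) (c : ∀ x, T.CrossingChoice p x) :=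
  MFComplex.tensorLeft (T.edges p) (MFComplex.tensorFamily fun x => (c x).fHL (T.positive x))

/-- The natural map, the tensor product of the identity on the factorizations of the edges with
the maps `L → fH L` at the crossings. -/
noncomputable def toKRhat (p : Polynomial k) (c : ∀ x, T.CrossingChoice p x) :
    MFComplex.Hom (T.KR p c) (T.KRhat p c) :=
  MFComplex.Hom.tensorLeft (T.edges p)
    (MFComplex.Hom.tensorFamily fun x => (c x).toFHL (T.positive x))

/-- The potential of the tangle: the sum of the `p(t)` over the endpoints where a strand stops
minus the sum of the `p(t)` over the endpoints where a strand starts. -/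
noncomputable def leafPotential (p : Polynomial k) : T.LeafRing k :=
  (∑ s : Fin T.numStops, Polynomial.aeval (⟨T.t k (T.stopFlag s),
    MvPolynomial.X_mem_supported.2 (Or.inr ⟨s, rfl⟩)⟩ : T.LeafRing k) p) -
  ∑ s : Fin T.numStarts, Polynomial.aeval (⟨T.t k (T.startFlag s),
    MvPolynomial.X_mem_supported.2 (Or.inl ⟨s, rfl⟩)⟩ : T.LeafRing k) p

theorem algebraMap_leafPotential (p : Polynomial k) :
    algebraMap (T.LeafRing k) (T.FlagRing k) (T.leafPotential p) =
      ((∑ e, (T.t k (.head e) - T.t k (.tail e)) *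
          dividedDifference p (T.t k (.head e)) (T.t k (.tail e))) +
        ∑ o, (T.t k (.mark o) - T.t k (.mark o)) *
          dividedDifference p (T.t k (.mark o)) (T.t k (.mark o))) +
      ∑ x, crossingPotential p (T.t k (T.outFlag x .left)) (T.t k (T.outFlag x .right))
        (T.t k (T.inFlag x .right)) (T.t k (T.inFlag x .left)) := by
  have h1 : ∑ e, Polynomial.aeval (T.t k (.head e)) p =
      ∑ x, (Polynomial.aeval (T.t k (T.inFlag x .left)) p +
        Polynomial.aeval (T.t k (T.inFlag x .right)) p) +
      ∑ s, Polynomial.aeval (T.t k (T.stopFlag s)) p := by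
    rw [← Equiv.sum_comp T.head.symm, Fintype.sum_sum_type, Fintype.sum_prod_type]
    simp only [Side.sum_eq]
    rfl
  have h2 : ∑ e, Polynomial.aeval (T.t k (.tail e)) p =
      ∑ x, (Polynomial.aeval (T.t k (T.outFlag x .left)) p +
        Polynomial.aeval (T.t k (T.outFlag x .right)) p) +
      ∑ s, Polynomial.aeval (T.t k (T.startFlag s)) p := by
    rw [← Equiv.sum_comp T.tail.symm, Fintype.sum_sum_type, Fintype.sum_prod_type]
    simp only [Side.sum_eq]
    rfl
  have h3 : ∀ (f : T.Flag) (h : T.t k f ∈ T.LeafRing k),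
      algebraMap (T.LeafRing k) (T.FlagRing k)
        (Polynomial.aeval (⟨T.t k f, h⟩ : T.LeafRing k) p) = Polynomial.aeval (T.t k f) p := by
    intro f h
    rw [← Polynomial.aeval_algebraMap_apply]
    rfl
  have h4 : ∑ o, (T.t k (.mark o) - T.t k (.mark o)) *
      dividedDifference p (T.t k (.mark o)) (T.t k (.mark o)) = 0 :=
    Finset.sum_eq_zero fun o _ => by rw [sub_self, zero_mul]
  rw [h4, add_zero]
  simp only [leafPotential, map_sub, map_sum, h3, sub_mul_dividedDifference, Finset.sum_sub_distrib, h1, h2, crossingPotential,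
    Finset.sum_add_distrib]
  ring

end

end TangleDiagram

/-! ### The crossing factorizations exist -/

namespace MatrixFactorization

variable {S : Type u} [CommRing S] {φ : S}

theorem Hom.IsGraded.dPlus_comm {M : MatrixFactorization.{u, v} S φ}
    {N : MatrixFactorization.{u, v'} S φ} {f : Hom M N} (hf : f.IsGraded) (a : M.carrier) :
    f.toLin (M.dPlus a) = N.dPlus (f.toLin a) := by
  refine M.homogeneous_induction (P := fun a => f.toLin (M.dPlus a) = N.dPlus (f.toLin a)) a
    (by simp) (fun a b ha hb => by simp only [map_add, ha, hb]) ?_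
  intro i a ha
  have h1 : f.toLin (M.dPlus a) - N.dPlus (f.toLin a) ∈ N.grade (i + 1) :=
    Submodule.sub_mem _ (hf _ _ (M.dPlus_mem i a ha)) (N.dPlus_mem i _ (hf i a ha))
  have h2 : f.toLin (M.dPlus a) - N.dPlus (f.toLin a) =
      N.dMinus (f.toLin a) - f.toLin (M.dMinus a) := by
    have h := f.comm a
    simp only [d, LinearMap.add_apply, map_add] at h
    rw [sub_eq_sub_iff_add_eq_add, h, add_comm]
  have h3 : f.toLin (M.dPlus a) - N.dPlus (f.toLin a) ∈ N.grade (i - 1) := by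
    rw [h2]
    exact Submodule.sub_mem _ (N.dMinus_mem i _ (hf i a ha)) (hf _ _ (M.dMinus_mem i a ha))
  exact sub_eq_zero.1 (N.grade_disjoint (by omega) h1 h3)

theorem Hom.IsGraded.descends {M : MatrixFactorization.{u, v} S φ}
    {N : MatrixFactorization.{u, v'} S φ} {f : Hom M N} (hf : f.IsGraded) :
    M.fHKer ≤ N.fHKer.comap f.toLin := by
  refine sup_le ?_ (iSup_le fun i a ha => N.grade_le_fHKer i.2 (hf _ a ha))
  rintro _ ⟨a, rfl⟩
  exact Submodule.mem_sup_left ⟨f.toLin a, (hf.dPlus_comm a).symm⟩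

theorem twoTerm_sgn (x y : S) (a : S × S) : (twoTerm x y).sgn a = (-a.1, a.2) := by
  have h1 : (twoTerm x y).sgn (a.1, 0) = (-a.1, 0) := by
    have h : ((a.1, 0) : S × S) ∈ (twoTerm x y).grade (-1) := by simp [mem_twoTermGrade]
    rw [(twoTerm x y).sgn_of_mem h]
    simp
  have h2 : (twoTerm x y).sgn (0, a.2) = (0, a.2) := by
    have h : ((0, a.2) : S × S) ∈ (twoTerm x y).grade 0 := by simp [mem_twoTermGrade]
    rw [(twoTerm x y).sgn_of_mem h]
    simp
  have h3 : a = (a.1, 0) + (0, a.2) := by simp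
  rw [h3, map_add, h1, h2]
  simp

/-- The graded linear map between Koszul complexes of length two with matrix `m` in degree `-1`,
and given by `c₀` in degree `0` and by `c₂` in degree `-2`. -/
noncomputable def koszulLin (c₀ m₁₁ m₁₂ m₂₁ m₂₂ c₂ : S) :
    (S × S) ⊗[S] (S × S) →ₗ[S] (S × S) ⊗[S] (S × S) :=
  TensorProduct.lift (LinearMap.mk₂ S (fun u v =>
    (c₀ * (u.2 * v.2)) • ((0, 1) ⊗ₜ (0, 1)) +
    (m₁₁ * (u.1 * v.2) + m₁₂ * (u.2 * v.1)) • ((1, 0) ⊗ₜ (0, 1)) +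
    (m₂₁ * (u.1 * v.2) + m₂₂ * (u.2 * v.1)) • ((0, 1) ⊗ₜ (1, 0)) +
    (c₂ * (u.1 * v.1)) • ((1, 0) ⊗ₜ (1, 0)))
    (fun _ _ _ => by simp only [Prod.fst_add, Prod.snd_add]; module)
    (fun _ _ _ => by simp only [Prod.smul_fst, Prod.smul_snd, smul_eq_mul]; module)
    (fun _ _ _ => by simp only [Prod.fst_add, Prod.snd_add]; module)
    (fun _ _ _ => by simp only [Prod.smul_fst, Prod.smul_snd, smul_eq_mul]; module))

theorem koszulLin_tmul (c₀ m₁₁ m₁₂ m₂₁ m₂₂ c₂ : S) (u v : S × S) :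
    koszulLin c₀ m₁₁ m₁₂ m₂₁ m₂₂ c₂ (u ⊗ₜ v) =
    (c₀ * (u.2 * v.2)) • ((0, 1) ⊗ₜ (0, 1)) +
    (m₁₁ * (u.1 * v.2) + m₁₂ * (u.2 * v.1)) • ((1, 0) ⊗ₜ (0, 1)) +
    (m₂₁ * (u.1 * v.2) + m₂₂ * (u.2 * v.1)) • ((0, 1) ⊗ₜ (1, 0)) +
    (c₂ * (u.1 * v.1)) • ((1, 0) ⊗ₜ (1, 0)) := rfl

theorem tmul_eq (u v : S × S) : u ⊗ₜ[S] v =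
    (u.2 * v.2) • ((0, 1) ⊗ₜ (0, 1)) + (u.1 * v.2) • ((1, 0) ⊗ₜ (0, 1)) +
    (u.2 * v.1) • ((0, 1) ⊗ₜ (1, 0)) + (u.1 * v.1) • ((1, 0) ⊗ₜ (1, 0)) := by
  have h : ∀ u : S × S, u = u.1 • (1, 0) + u.2 • (0, 1) := fun u => by simp
  conv_lhs => rw [h u, h v]
  simp only [TensorProduct.add_tmul, TensorProduct.tmul_add, TensorProduct.smul_tmul_smul]
  module

theorem koszulLin_mem {x₁ x₂ y₁ y₂ z₁ z₂ w₁ w₂ : S} (c₀ m₁₁ m₁₂ m₂₁ m₂₂ c₂ : S) (n : ℤ)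
    {a : (S × S) ⊗[S] (S × S)} (ha : a ∈ tensorGrade (twoTerm x₁ y₁) (twoTerm x₂ y₂) n) :
    koszulLin c₀ m₁₁ m₁₂ m₂₁ m₂₂ c₂ a ∈ tensorGrade (twoTerm z₁ w₁) (twoTerm z₂ w₂) n := by
  refine tensorGrade_le (twoTerm x₁ y₁) (twoTerm x₂ y₂)
    (Q := (tensorGrade (twoTerm z₁ w₁) (twoTerm z₂ w₂) n).comap
      (koszulLin c₀ m₁₁ m₁₂ m₂₁ m₂₂ c₂)) ?_ ha
  rintro i j hij u hu v hv
  rw [Submodule.mem_comap, koszulLin_tmul]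
  have e0 : ((0, 1) : S × S) ∈ twoTermGrade S 0 := by simp [mem_twoTermGrade]
  have e1 : ((1, 0) : S × S) ∈ twoTermGrade S (-1) := by simp [mem_twoTermGrade]
  refine Submodule.add_mem _ (Submodule.add_mem _ (Submodule.add_mem _ ?_ ?_) ?_) ?_
  · by_cases h : i = 0 ∧ j = 0
    · exact Submodule.smul_mem _ _ (tmul_mem_tensorGrade (twoTerm z₁ w₁) (twoTerm z₂ w₂)
        (by omega) e0 e0)
    · have : u.2 * v.2 = 0 := by
        by_cases hi : i = 0
        · rw [hv.2 (by omega), mul_zero]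
        · rw [hu.2 hi, zero_mul]
      simp [this]
  · by_cases h : n = -1
    · exact Submodule.smul_mem _ _ (tmul_mem_tensorGrade (twoTerm z₁ w₁) (twoTerm z₂ w₂)
        (by omega) e1 e0)
    · have h1 : u.1 * v.2 = 0 := by
        by_cases hi : i = -1
        · rw [hv.2 (by omega), mul_zero]
        · rw [hu.1 hi, zero_mul]
      have h2 : u.2 * v.1 = 0 := by
        by_cases hi : i = 0
        · rw [hv.1 (by omega), mul_zero]
        · rw [hu.2 hi, zero_mul]
      simp [h1, h2]
  · by_cases h : n = -1
    · exact Submodule.smul_mem _ _ (tmul_mem_tensorGrade (twoTerm z₁ w₁) (twoTerm z₂ w₂)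
        (by omega) e0 e1)
    · have h1 : u.1 * v.2 = 0 := by
        by_cases hi : i = -1
        · rw [hv.2 (by omega), mul_zero]
        · rw [hu.1 hi, zero_mul]
      have h2 : u.2 * v.1 = 0 := by
        by_cases hi : i = 0
        · rw [hv.1 (by omega), mul_zero]
        · rw [hu.2 hi, zero_mul]
      simp [h1, h2]
  · by_cases h : i = -1 ∧ j = -1
    · exact Submodule.smul_mem _ _ (tmul_mem_tensorGrade (twoTerm z₁ w₁) (twoTerm z₂ w₂)
        (by omega) e1 e1)
    · have : u.1 * v.1 = 0 := by
        by_cases hi : i = -1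
        · rw [hv.1 (by omega), mul_zero]
        · rw [hu.1 hi, zero_mul]
      simp [this]

/-- The differential of `koszul₂`, as an explicit map. -/
noncomputable def koszulD (x₁ x₂ y₁ y₂ : S) : (S × S) ⊗[S] (S × S) →ₗ[S] (S × S) ⊗[S] (S × S) :=
  TensorProduct.map (LinearMap.inr S S S ∘ₗ (x₁ • LinearMap.fst S S S) +
      LinearMap.inl S S S ∘ₗ (y₁ • LinearMap.snd S S S)) LinearMap.id +
    TensorProduct.map (LinearMap.prodMap (-LinearMap.id) LinearMap.id)
      (LinearMap.inr S S S ∘ₗ (x₂ • LinearMap.fst S S S) +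
        LinearMap.inl S S S ∘ₗ (y₂ • LinearMap.snd S S S))

theorem koszulD_tmul (x₁ x₂ y₁ y₂ : S) (u v : S × S) :
    koszulD x₁ x₂ y₁ y₂ (u ⊗ₜ v) =
    (x₁ * u.1 * v.2 + x₂ * u.2 * v.1) • ((0, 1) ⊗ₜ (0, 1)) +
    (y₁ * u.2 * v.2 - x₂ * u.1 * v.1) • ((1, 0) ⊗ₜ (0, 1)) +
    (x₁ * u.1 * v.1 + y₂ * u.2 * v.2) • ((0, 1) ⊗ₜ (1, 0)) +
    (y₁ * u.2 * v.1 - y₂ * u.1 * v.2) • ((1, 0) ⊗ₜ (1, 0)) := by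
  have h1 : koszulD x₁ x₂ y₁ y₂ (u ⊗ₜ v) =
      ((y₁ * u.2, x₁ * u.1) : S × S) ⊗ₜ[S] v +
        ((-u.1, u.2) : S × S) ⊗ₜ[S] ((y₂ * v.2, x₂ * v.1) : S × S) := by
    simp [koszulD]
  rw [h1, tmul_eq _ v, tmul_eq (-u.1, u.2)]
  dsimp only
  module

theorem koszul₂_d {x₁ x₂ y₁ y₂ : S} (h : x₁ * y₁ + x₂ * y₂ = φ) :
    (koszul₂ x₁ x₂ y₁ y₂ h).d = koszulD x₁ x₂ y₁ y₂ := by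
  have h1 : (twoTerm x₁ y₁).sgn = LinearMap.prodMap (-LinearMap.id) LinearMap.id :=
    LinearMap.ext fun a => twoTerm_sgn x₁ y₁ a
  have h2 := tensor_d (twoTerm x₁ y₁) (twoTerm x₂ y₂)
  rw [h1] at h2
  exact h2

theorem koszulLin_koszulD {x₁ x₂ y₁ y₂ z₁ z₂ w₁ w₂ : S} (c₀ m₁₁ m₁₂ m₂₁ m₂₂ c₂ : S)
    (e₁ : z₁ * m₁₁ + z₂ * m₂₁ = c₀ * x₁) (e₂ : z₁ * m₁₂ + z₂ * m₂₂ = c₀ * x₂)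
    (e₃ : m₁₁ * y₁ + m₁₂ * y₂ = c₀ * w₁) (e₄ : m₂₁ * y₁ + m₂₂ * y₂ = c₀ * w₂)
    (e₅ : c₂ * z₁ = m₂₂ * x₁ - m₂₁ * x₂) (e₆ : c₂ * z₂ = m₁₁ * x₂ - m₁₂ * x₁)
    (e₇ : c₂ * y₁ = m₂₂ * w₁ - m₁₂ * w₂) (e₈ : c₂ * y₂ = m₁₁ * w₂ - m₂₁ * w₁) :
    koszulLin c₀ m₁₁ m₁₂ m₂₁ m₂₂ c₂ ∘ₗ koszulD x₁ x₂ y₁ y₂ =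
      koszulD z₁ z₂ w₁ w₂ ∘ₗ koszulLin c₀ m₁₁ m₁₂ m₂₁ m₂₂ c₂ := by
  refine TensorProduct.ext' fun u v => ?_
  simp only [LinearMap.comp_apply, koszulD_tmul, koszulLin_tmul, map_add, map_smul, mul_zero,
    mul_one, zero_smul, add_zero, zero_add, sub_zero, zero_sub]
  match_scalars
  · linear_combination (-u.1 * v.2) * e₁ - u.2 * v.1 * e₂
  · linear_combination (u.2 * v.2) * e₃ + u.1 * v.1 * e₆
  · linear_combination (u.2 * v.2) * e₄ - u.1 * v.1 * e₅
  · linear_combination (-u.1 * v.2) * e₈ + u.2 * v.1 * e₇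

/-- The morphism of Koszul matrix factorizations given by compatible matrices. -/
noncomputable def Hom.koszul {x₁ x₂ y₁ y₂ z₁ z₂ w₁ w₂ : S} (h : x₁ * y₁ + x₂ * y₂ = φ)
    (h' : z₁ * w₁ + z₂ * w₂ = φ) (c₀ m₁₁ m₁₂ m₂₁ m₂₂ c₂ : S)
    (e₁ : z₁ * m₁₁ + z₂ * m₂₁ = c₀ * x₁) (e₂ : z₁ * m₁₂ + z₂ * m₂₂ = c₀ * x₂)
    (e₃ : m₁₁ * y₁ + m₁₂ * y₂ = c₀ * w₁) (e₄ : m₂₁ * y₁ + m₂₂ * y₂ = c₀ * w₂)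
    (e₅ : c₂ * z₁ = m₂₂ * x₁ - m₂₁ * x₂) (e₆ : c₂ * z₂ = m₁₁ * x₂ - m₁₂ * x₁)
    (e₇ : c₂ * y₁ = m₂₂ * w₁ - m₁₂ * w₂) (e₈ : c₂ * y₂ = m₁₁ * w₂ - m₂₁ * w₁) :
    Hom (koszul₂ x₁ x₂ y₁ y₂ h) (koszul₂ z₁ z₂ w₁ w₂ h') where
  toLin := koszulLin c₀ m₁₁ m₁₂ m₂₁ m₂₂ c₂
  comm a := by
    rw [koszul₂_d, koszul₂_d]
    exact LinearMap.congr_fun (koszulLin_koszulD c₀ m₁₁ m₁₂ m₂₁ m₂₂ c₂ e₁ e₂ e₃ e₄ e₅ e₆ e₇ e₈) a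
  even n a ha := mem_parityPart _ (by simp) (koszulLin_mem c₀ m₁₁ m₁₂ m₂₁ m₂₂ c₂ n ha)

end MatrixFactorization

section Crossing

open MatrixFactorization

variable {k : Type w} [CommRing k] {S : Type u} [CommRing S] [Algebra k S]

theorem crossingPotential_mem (p : Polynomial k) (ti tj tk tl : S) :
    ∃ y₁ y₂, (ti + tj - tk - tl) * y₁ + (ti * tj - tk * tl) * y₂ =
      crossingPotential p ti tj tk tl := by
  have key : ∀ n : ℕ, ∃ y₁ y₂, (ti + tj - tk - tl) * y₁ + (ti * tj - tk * tl) * y₂ =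
      ti ^ n + tj ^ n - tk ^ n - tl ^ n := by
    intro n
    induction n using Nat.twoStepInduction with
    | zero => exact ⟨0, 0, by ring⟩
    | one => exact ⟨1, 0, by ring⟩
    | more n h1 h2 =>
      obtain ⟨a, b, h1⟩ := h1
      obtain ⟨c, d, h2⟩ := h2
      refine ⟨(tk ^ (n + 1) + tl ^ (n + 1)) + (ti + tj) * c - ti * tj * a,
        -(tk ^ n + tl ^ n) + (ti + tj) * d - ti * tj * b, ?_⟩
      linear_combination (ti + tj) * h2 - ti * tj * h1
  induction p using Polynomial.induction_on' with
  | add p q hp hq =>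
    obtain ⟨a, b, h1⟩ := hp
    obtain ⟨c, d, h2⟩ := hq
    refine ⟨a + c, b + d, ?_⟩
    simp only [crossingPotential, map_add] at h1 h2 ⊢
    linear_combination h1 + h2
  | monomial n r =>
    obtain ⟨a, b, h⟩ := key n
    refine ⟨algebraMap k S r * a, algebraMap k S r * b, ?_⟩
    simp only [crossingPotential, Polynomial.aeval_monomial]
    linear_combination algebraMap k S r * h

/-- Choices as in `CrossingModel` exist. -/
theorem CrossingModel.nonempty (p : Polynomial k) (ti tj tk tl : S) :
    Nonempty (CrossingModel p ti tj tk tl) := by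
  obtain ⟨y₁, y₂, h⟩ := crossingPotential_mem p ti tj tk tl
  have h' : (ti - tl) * (y₁ + tk * y₂) + (tj - tk) * (y₁ + ti * y₂) =
      crossingPotential p ti tj tk tl := by
    rw [← h]; ring
  let f := Hom.koszul h h' 1 1 tk 1 ti (ti - tk) (by ring) (by ring) (by ring) (by ring)
    (by ring) (by ring) (by ring) (by ring)
  let g := Hom.koszul h' h (ti - tk) ti (-tk) (-1) 1 1 (by ring) (by ring) (by ring) (by ring)
    (by ring) (by ring) (by ring) (by ring)
  have hf : f.IsGraded := fun n _ ha => koszulLin_mem _ _ _ _ _ _ n ha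
  have hg : g.IsGraded := fun n _ ha => koszulLin_mem _ _ _ _ _ _ n ha
  have hf1 : f.toLin (koszulOne _ _ _ _ h) = koszulOne _ _ _ _ h' := by
    refine (koszulLin_tmul _ _ _ _ _ _ _ _).trans ?_
    simp [koszulOne]
  have hg1 : g.toLin (koszulOne _ _ _ _ h') = (ti - tk) • koszulOne _ _ _ _ h := by
    refine (koszulLin_tmul _ _ _ _ _ _ _ _).trans ?_
    simp [koszulOne]
    rfl
  exact ⟨⟨y₁, y₂, h, _, _, h', f, hf.descends,
    congrArg (Submodule.Quotient.mk (p := (koszul₂ _ _ _ _ h').fHKer)) hf1, g, hg.descends,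
    congrArg (Submodule.Quotient.mk (p := (koszul₂ _ _ _ _ h).fHKer)) hg1⟩⟩

end Crossing

/-! In each homological degree the natural map f : M → N is graded and surjective, and M is bounded
below. The theorem reduces to a property of `dPlus` alone: the kernel K of f is acyclic for `dPlus`.

This property suffices for the following reason. Let D be a factorization of potential -φ on a
projective module, and grade M ⊗ D by the degree in M, forgetting the grading of D. Then `dPlus` ⊗ 1
raises the degree by one, while `dMinus` ⊗ 1 and the term with the differential of D do not raise
it. As D is flat, K ⊗ D is the kernel of f ⊗ D and is acyclic for `dPlus` ⊗ 1. Removing top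
components one after the other, which stops because M is bounded below, gives acyclicity for the
full differential (`KerExact.add`). The long exact sequence then yields the isomorphism on total
homology (`isNearIso_of_kerExact`). Acyclicity of K does not mention scalars, so the same fact
serves over the full polynomial ring and over the subring of the endpoints.

Acyclicity of K is proved by replacing one crossing at a time, with f ⊗ g = (1 ⊗ g) ∘ (f ⊗ 1)
(`ExactOn.tensor`). The Koszul complex of a crossing must then remain a resolution after tensoring
with the cyclic modules of the crossings already replaced. Every flag has its own variable, so these
modules are quotients by ideals that do not involve the variables of the present crossing. Modulo
such an ideal both sequences of the crossing are still regular (`isRegularPair_smoothing`,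
`isRegularPair_singular`): a difference of a variable and a polynomial not involving it is monic in
that variable, and modulo the linear form the quadric is, up to sign, a product of two such
differences. Finally, the factors of the edges are flat, so tensoring with them preserves acyclicity
(`KerExact.id_tensor`). -/

/-! ### Acyclic kernels and the filtration argument. -/

section KerExact

variable {S : Type*} [CommRing S] {X Y Z : Type*} [AddCommGroup X] [Module S X]
  [AddCommGroup Y] [Module S Y] [AddCommGroup Z] [Module S Z]

/-- The kernel of `f` is acyclic for the operator `d`. -/
def KerExact (d : X →ₗ[S] X) (f : X →ₗ[S] Y) : Prop :=
  ∀ a, f a = 0 → d a = 0 → ∃ b, f b = 0 ∧ d b = a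

/-- The kernel of the composite is an extension of ker g by ker f: a primitive of `f a` in ker g is
lifted through f, and the remaining error is a cycle in ker f. -/
theorem KerExact.comp {dX : X →ₗ[S] X} {dY : Y →ₗ[S] Y} {f : X →ₗ[S] Y} {g : Y →ₗ[S] Z}
    (hf : KerExact dX f) (hg : KerExact dY g) (hs : Function.Surjective f)
    (hc : ∀ a, f (dX a) = dY (f a)) (hd : ∀ a, dX (dX a) = 0) : KerExact dX (g ∘ₗ f) := by
  intro a h1 h2
  obtain ⟨b, hb1, hb2⟩ := hg (f a) h1 (by rw [← hc, h2, map_zero])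
  obtain ⟨a', rfl⟩ := hs b
  obtain ⟨c, hc1, hc2⟩ := hf (a - dX a') (by rw [map_sub, hc, hb2, sub_self])
    (by rw [map_sub, h2, hd, sub_self])
  refine ⟨a' + c, ?_, by rw [map_add, hc2]; abel⟩
  rw [LinearMap.comp_apply, map_add, hc1, add_zero, hb1]

theorem KerExact.congr {X' Y' : Type*} [AddCommGroup X'] [Module S X'] [AddCommGroup Y']
    [Module S Y'] {d : X →ₗ[S] X} {f : X →ₗ[S] Y} {d' : X' →ₗ[S] X'} {f' : X' →ₗ[S] Y'}
    (h : KerExact d f) (e : X ≃ₗ[S] X') (e' : Y ≃ₗ[S] Y') (hd : ∀ a, e (d a) = d' (e a))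
    (hf : ∀ a, e' (f a) = f' (e a)) : KerExact d' f' := by
  intro a h1 h2
  obtain ⟨a, rfl⟩ := e.surjective a
  rw [← hf, map_eq_zero_iff _ e'.injective] at h1
  rw [← hd, map_eq_zero_iff _ e.injective] at h2
  obtain ⟨b, hb, rfl⟩ := h a h1 h2
  exact ⟨e b, by rw [← hf, hb, map_zero], (hd b).symm⟩

/-- Flatness enters twice: it keeps the restriction of d to ker f exact, and it identifies ker f ⊗ D
with the kernel of f ⊗ D. -/
theorem KerExact.rTensor {d : X →ₗ[S] X} {f : X →ₗ[S] Y} (h : KerExact d f)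
    (hf : ∀ a, f a = 0 → f (d a) = 0) (hd : ∀ a, d (d a) = 0)
    (D : Type*) [AddCommGroup D] [Module S D] [Module.Flat S D] :
    KerExact (d.rTensor D) (f.rTensor D) := by
  let dK : LinearMap.ker f →ₗ[S] LinearMap.ker f := d.restrict hf
  let ι := (LinearMap.ker f).subtype
  have hK : Function.Exact dK dK := by
    rintro ⟨a, ha⟩
    constructor
    · intro h0
      obtain ⟨b, hb1, hb2⟩ := h a ha (congrArg Subtype.val h0)
      exact ⟨⟨b, hb1⟩, Subtype.ext hb2⟩
    · rintro ⟨b, hb⟩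
      rw [← hb]
      exact Subtype.ext (hd b)
  have hKD := Module.Flat.rTensor_exact D hK
  have hι : Function.Exact (ι.rTensor D) (f.rTensor D) :=
    Module.Flat.rTensor_exact D f.exact_subtype_ker_map
  have hinj : Function.Injective (ι.rTensor D) :=
    Module.Flat.rTensor_preserves_injective_linearMap ι Subtype.val_injective
  have hcomm : ∀ z, ι.rTensor D (dK.rTensor D z) = d.rTensor D (ι.rTensor D z) := by
    intro z
    rw [← LinearMap.comp_apply, ← LinearMap.comp_apply, ← LinearMap.rTensor_comp,
      ← LinearMap.rTensor_comp]
    rfl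
  intro z h1 h2
  obtain ⟨z, rfl⟩ := (hι z).1 h1
  rw [← hcomm, map_eq_zero_iff _ hinj] at h2
  obtain ⟨y, rfl⟩ := (hKD z).1 h2
  exact ⟨ι.rTensor D y, (hι _).2 ⟨y, rfl⟩, (hcomm y).symm⟩

theorem KerExact.lTensor {d : X →ₗ[S] X} {f : X →ₗ[S] Y} (h : KerExact d f)
    (hf : ∀ a, f a = 0 → f (d a) = 0) (hd : ∀ a, d (d a) = 0)
    (D : Type*) [AddCommGroup D] [Module S D] [Module.Flat S D] :
    KerExact (d.lTensor D) (f.lTensor D) :=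
  (h.rTensor hf hd D).congr (TensorProduct.comm S X D) (TensorProduct.comm S Y D)
    (fun a => LinearMap.congr_fun (TensorProduct.ext' fun _ _ => rfl :
      (TensorProduct.comm S X D).toLinearMap ∘ₗ d.rTensor D =
      d.lTensor D ∘ₗ (TensorProduct.comm S X D).toLinearMap) a)
    (fun a => LinearMap.congr_fun (TensorProduct.ext' fun _ _ => rfl :
      (TensorProduct.comm S Y D).toLinearMap ∘ₗ f.rTensor D =
      f.lTensor D ∘ₗ (TensorProduct.comm S X D).toLinearMap) a)

/-- A system of projections onto the components of a grading that is bounded below by `b`. -/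
structure IsBddProj (b : ℤ) (π : ℤ → X →ₗ[S] X) : Prop where
  self : ∀ i z, π i (π i z) = π i z
  ne : ∀ i j z, i ≠ j → π i (π j z) = 0
  sum : ∀ z, ∃ n, ∀ m ≥ n, ∑ j ∈ Finset.Icc b m, π j z = z

variable {b : ℤ} {π : ℤ → X →ₗ[S] X}

/-- The tensor product is graded by one factor only; D is an arbitrary module. -/
theorem IsBddProj.rTensor (h : IsBddProj b π) (D : Type*) [AddCommGroup D] [Module S D] :
    IsBddProj b fun j => (π j).rTensor D where
  self i z := by
    rw [← LinearMap.comp_apply, ← LinearMap.rTensor_comp]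
    congr 2
    exact LinearMap.ext (h.self i)
  ne i j z hij := by
    have : π i ∘ₗ π j = 0 := LinearMap.ext fun z => h.ne i j z hij
    rw [← LinearMap.comp_apply, ← LinearMap.rTensor_comp, this, LinearMap.rTensor_zero,
      LinearMap.zero_apply]
  sum z := by
    induction z using TensorProduct.induction_on with
    | zero => exact ⟨0, by simp⟩
    | tmul x y =>
      obtain ⟨n, hn⟩ := h.sum x
      refine ⟨n, fun m hm => ?_⟩
      simp only [LinearMap.rTensor_tmul]
      rw [← TensorProduct.sum_tmul, hn m hm]
    | add x y hx hy =>
      obtain ⟨n, hn⟩ := hx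
      obtain ⟨n', hn'⟩ := hy
      refine ⟨max n n', fun m hm => ?_⟩
      simp only [map_add, Finset.sum_add_distrib]
      rw [hn m (le_of_max_le_left hm), hn' m (le_of_max_le_right hm)]

theorem IsBddProj.congr {X' : Type*} [AddCommGroup X'] [Module S X'] {π' : ℤ → X' →ₗ[S] X'}
    (h : IsBddProj b π) (e : X ≃ₗ[S] X') (he : ∀ j z, e (π j z) = π' j (e z)) :
    IsBddProj b π' where
  self i z := by
    obtain ⟨z, rfl⟩ := e.surjective z
    rw [← he, ← he, h.self]
  ne i j z hij := by
    obtain ⟨z, rfl⟩ := e.surjective z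
    rw [← he, ← he, h.ne i j z hij, map_zero]
  sum z := by
    obtain ⟨z, rfl⟩ := e.surjective z
    obtain ⟨n, hn⟩ := h.sum z
    refine ⟨n, fun m hm => ?_⟩
    simp only [← he]
    rw [← map_sum, hn m hm]

theorem IsBddProj.lTensor (h : IsBddProj b π) (D : Type*) [AddCommGroup D] [Module S D] :
    IsBddProj b fun j => (π j).lTensor D :=
  (h.rTensor D).congr (TensorProduct.comm S X D) fun j z =>
    LinearMap.congr_fun (TensorProduct.ext' fun _ _ => rfl :
      (TensorProduct.comm S X D).toLinearMap ∘ₗ (π j).rTensor D =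
      (π j).lTensor D ∘ₗ (TensorProduct.comm S X D).toLinearMap) z

/-- If `e` raises the degree by one, `r` does not raise it, and the grading is bounded below, then
the acyclicity of the kernel of `f` for `e` implies the acyclicity for `e + r`. -/
theorem KerExact.add (hπ : IsBddProj b π) {d e r : X →ₗ[S] X} {f : X →ₗ[S] Y}
    (h : KerExact e f) (hder : ∀ z, d z = e z + r z)
    (he : ∀ i z, π (i + 1) (e z) = e (π i z))
    (hr : ∀ i z, (∀ j, i < j → π j z = 0) → ∀ j, i < j → π j (r z) = 0)
    (hf : ∀ i z, f z = 0 → f (π i z) = 0) (hfd : ∀ z, f z = 0 → f (d z) = 0)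
    (hdd : ∀ z, d (d z) = 0) : KerExact d f := by
  -- Induction on the number n of degrees b, ..., b + n - 1 in which z may have a component.
  have key : ∀ (n : ℕ) (z : X), (∀ j, b + n ≤ j → π j z = 0) → f z = 0 → d z = 0 →
      ∃ w, f w = 0 ∧ d w = z := by
    intro n
    induction n with
    | zero =>
      intro z hz _ _
      obtain ⟨n, hn⟩ := hπ.sum z
      have h0 : z = 0 := by
        rw [← hn n le_rfl]
        refine Finset.sum_eq_zero fun j hj => hz j ?_
        have := (Finset.mem_Icc.1 hj).1
        simpa using this
      exact ⟨0, map_zero _, by rw [h0, map_zero]⟩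
    | succ n ih =>
      intro z hz hfz hdz
      set i : ℤ := b + n with hi
      have hz' : ∀ j, i < j → π j z = 0 := fun j hj => hz j (by push_cast; omega)
      -- In degree i + 1 the equation d z = 0 sees only e of the top component, since r does not
      -- raise degrees.
      have h1 : e (π i z) = 0 := by
        have h2 : π (i + 1) (d z) = 0 := by rw [hdz, map_zero]
        rwa [hder, map_add, hr i z hz' (i + 1) (by omega), add_zero, he] at h2
      obtain ⟨w, hw1, hw2⟩ := h (π i z) (hf i z hfz) h1
      -- The primitive w may be inhomogeneous; its component of degree i - 1 already suffices and
      -- stays in ker f.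
      have hw3 : e (π (i - 1) w) = π i z := by
        rw [← he, sub_add_cancel, hw2, hπ.self]
      have hfw := hf (i - 1) w hw1
      have hz1 : ∀ j, b + n ≤ j → π j (z - d (π (i - 1) w)) = 0 := by
        intro j hj
        have h3 : π j (r (π (i - 1) w)) = 0 :=
          hr (i - 1) _ (fun j hj => hπ.ne j _ w (by omega)) j (by omega)
        rw [map_sub, hder, map_add, h3, hw3, add_zero]
        by_cases hji : j = i
        · rw [hji, hπ.self, sub_self]
        · rw [hπ.ne j i z hji, hz' j (by omega), sub_self]
      obtain ⟨y, hy1, hy2⟩ := ih _ hz1 (by rw [map_sub, hfz, hfd _ hfw, sub_self])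
        (by rw [map_sub, hdz, hdd, sub_self])
      exact ⟨y + π (i - 1) w, by rw [map_add, hy1, hfw, add_zero],
        by rw [map_add, hy2, sub_add_cancel]⟩
  intro z hfz hdz
  obtain ⟨n, hn⟩ := hπ.sum z
  -- The number of degrees from b to n; the maximum makes it zero, not negative, when n < b.
  refine key (max n (b - 1) + 1 - b).toNat z (fun j hj => ?_) hfz hdz
  have hj' : n < j := by omega
  rw [← hn n le_rfl, map_sum]
  exact Finset.sum_eq_zero fun l hl => hπ.ne j l z (by have := (Finset.mem_Icc.1 hl).2; omega)

end KerExact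

/-! ### Homogeneous projections and the criterion for near-isomorphisms. -/

namespace MatrixFactorization

variable {S : Type u} [CommRing S] {φ ψ : S}

theorem linearMap_ext (M : MatrixFactorization.{u, v} S φ) {X : Type*} [AddCommGroup X] [Module S X]
    {f g : M.carrier →ₗ[S] X} (h : ∀ i, ∀ a ∈ M.grade i, f a = g a) : f = g :=
  LinearMap.ext fun a => M.homogeneous_induction (P := fun a => f a = g a) a
    (by rw [map_zero, map_zero]) (fun a b ha hb => by rw [map_add, map_add, ha, hb]) h

/-- The projection onto the component of degree `j`. -/
noncomputable def proj (M : MatrixFactorization.{u, v} S φ) (j : ℤ) : M.carrier →ₗ[S] M.carrier :=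
  (M.grade j).subtype ∘ₗ DirectSum.component S ℤ (fun i => M.grade i) j ∘ₗ M.decomp.toLinearMap

section proj

variable (M : MatrixFactorization.{u, v} S φ)

theorem proj_of_mem {i : ℤ} {a : M.carrier} (ha : a ∈ M.grade i) : M.proj i a = a := by
  simp only [proj, LinearMap.comp_apply, LinearEquiv.coe_coe, M.decomp_of_mem ha,
    DirectSum.component.lof_self]
  rfl

theorem proj_of_mem_of_ne {i j : ℤ} {a : M.carrier} (ha : a ∈ M.grade i) (hij : i ≠ j) :
    M.proj j a = 0 := by
  simp only [proj, LinearMap.comp_apply, LinearEquiv.coe_coe, M.decomp_of_mem ha]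
  have : DirectSum.component S ℤ (fun i => M.grade i) j
      (DirectSum.lof S ℤ (fun i => M.grade i) i ⟨a, ha⟩) = 0 :=
    DirectSum.of_eq_of_ne _ _ _ hij.symm
  rw [this, map_zero]

theorem proj_mem (j : ℤ) (a : M.carrier) : M.proj j a ∈ M.grade j :=
  Subtype.property _

theorem proj_dPlus (i : ℤ) : M.proj (i + 1) ∘ₗ M.dPlus = M.dPlus ∘ₗ M.proj i := by
  refine M.linearMap_ext fun j a ha => ?_
  rw [LinearMap.comp_apply, LinearMap.comp_apply]
  by_cases h : j = i
  · subst h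
    rw [M.proj_of_mem ha, M.proj_of_mem (M.dPlus_mem j a ha)]
  · rw [M.proj_of_mem_of_ne ha h, M.proj_of_mem_of_ne (M.dPlus_mem j a ha) (by omega), map_zero]

theorem proj_dMinus (i : ℤ) : M.proj i ∘ₗ M.dMinus = M.dMinus ∘ₗ M.proj (i + 1) := by
  refine M.linearMap_ext fun j a ha => ?_
  rw [LinearMap.comp_apply, LinearMap.comp_apply]
  by_cases h : j = i + 1
  · subst h
    have := M.dMinus_mem _ a ha
    rw [add_sub_cancel_right] at this
    rw [M.proj_of_mem ha, M.proj_of_mem this]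
  · rw [M.proj_of_mem_of_ne ha h, M.proj_of_mem_of_ne (M.dMinus_mem j a ha) (by omega), map_zero]

theorem proj_sgn (i : ℤ) : M.proj i ∘ₗ M.sgn = M.sgn ∘ₗ M.proj i := by
  refine M.linearMap_ext fun j a ha => ?_
  rw [LinearMap.comp_apply, LinearMap.comp_apply, M.sgn_of_mem ha, map_zsmul]
  by_cases h : j = i
  · subst h
    rw [M.proj_of_mem ha, M.sgn_of_mem ha]
  · rw [M.proj_of_mem_of_ne ha h, map_zero, smul_zero]

/-- The component of degree 2 of d² is the square of `dPlus`, while multiplication by φ has degree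
0. -/
theorem dPlus_dPlus (a : M.carrier) : M.dPlus (M.dPlus a) = 0 := by
  refine LinearMap.congr_fun (f := M.dPlus ∘ₗ M.dPlus) (g := 0)
    (M.linearMap_ext fun i a ha => ?_) a
  have h := congrArg (M.proj (i + 1 + 1)) (M.sq a)
  have h1 := M.dPlus_mem _ _ (M.dPlus_mem i a ha)
  have h2 := M.dMinus_mem _ _ (M.dPlus_mem i a ha)
  have h3 := M.dPlus_mem _ _ (M.dMinus_mem i a ha)
  have h4 := M.dMinus_mem _ _ (M.dMinus_mem i a ha)
  simp only [LinearMap.add_apply, map_add, map_smul] at h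
  rwa [M.proj_of_mem h1, M.proj_of_mem_of_ne h2 (by omega), M.proj_of_mem_of_ne h3 (by omega),
    M.proj_of_mem_of_ne h4 (by omega), M.proj_of_mem_of_ne ha (by omega), smul_zero, add_zero,
    add_zero, add_zero] at h

/-- `M` vanishes in all degrees below `b`. -/
def IsBddBelow (b : ℤ) : Prop := ∀ i, i < b → M.grade i = ⊥

theorem isBddProj {b : ℤ} (hM : M.IsBddBelow b) : IsBddProj b M.proj where
  self i z := M.proj_of_mem (M.proj_mem i z)
  ne i j z hij := M.proj_of_mem_of_ne (M.proj_mem j z) hij.symm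
  sum z := by
    refine M.homogeneous_induction (P := fun z => ∃ n, ∀ m ≥ n, ∑ j ∈ Finset.Icc b m,
      M.proj j z = z) z ⟨0, by simp⟩ ?_ ?_
    · rintro x y ⟨n, hn⟩ ⟨n', hn'⟩
      refine ⟨max n n', fun m hm => ?_⟩
      simp only [map_add, Finset.sum_add_distrib]
      rw [hn m (le_of_max_le_left hm), hn' m (le_of_max_le_right hm)]
    · intro i a ha
      refine ⟨i, fun m hm => ?_⟩
      by_cases hi : i < b
      · have h0 : a = 0 := by rw [hM i hi] at ha; simpa using ha
        simp [h0]
      · rw [Finset.sum_eq_single i, M.proj_of_mem ha]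
        · exact fun j _ hj => M.proj_of_mem_of_ne ha hj.symm
        · intro h
          exact absurd (Finset.mem_Icc.2 ⟨by omega, hm⟩) h

end proj

theorem Hom.IsGraded.proj_comm {M : MatrixFactorization.{u, v} S φ}
    {N : MatrixFactorization.{u, v'} S φ} {f : Hom M N} (hf : f.IsGraded) (i : ℤ) :
    f.toLin ∘ₗ M.proj i = N.proj i ∘ₗ f.toLin := by
  refine M.linearMap_ext fun j a ha => ?_
  rw [LinearMap.comp_apply, LinearMap.comp_apply]
  by_cases h : j = i
  · subst h
    rw [M.proj_of_mem ha, N.proj_of_mem (hf j a ha)]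
  · rw [M.proj_of_mem_of_ne ha h, N.proj_of_mem_of_ne (hf j a ha) h, map_zero]

/-- The long exact sequence of ker f → M → N by hand. The potential is only propositionally zero
because the application has potential φ + -φ. -/
theorem Ht.map_bijective {M : MatrixFactorization.{u, v} S φ} {N : MatrixFactorization.{u, v'} S φ}
    (f : Hom M N) (hφ : φ = 0) (hs : Function.Surjective f.toLin) (h : KerExact M.d f.toLin) :
    Function.Bijective (Ht.map f) := by
  have hdd : ∀ a, M.d (M.d a) = 0 := fun a => (M.d_d a).trans (smul_eq_zero_of_left hφ a)
  constructor
  · rw [injective_iff_map_eq_zero]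
    intro x hx
    obtain ⟨⟨a, ha⟩, rfl⟩ := Submodule.Quotient.mk_surjective _ x
    rw [LinearMap.mem_ker] at ha
    rw [Ht.map, Submodule.mapQ_apply, Submodule.Quotient.mk_eq_zero] at hx
    obtain ⟨c, hc⟩ : ∃ c, N.d c = f.toLin a := hx
    obtain ⟨c, rfl⟩ := hs c
    obtain ⟨b, hb1, hb2⟩ := h (a - M.d c) (by rw [map_sub, f.comm, hc, sub_self])
      (by rw [map_sub, ha, hdd, sub_self])
    rw [Submodule.Quotient.mk_eq_zero]
    exact ⟨b + c, by rw [map_add, hb2]; exact sub_add_cancel _ _⟩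
  · intro y
    obtain ⟨⟨n, hn⟩, rfl⟩ := Submodule.Quotient.mk_surjective _ y
    rw [LinearMap.mem_ker] at hn
    obtain ⟨a, ha⟩ := hs n
    -- Any lift a of the cycle n has `d a` in ker f; subtracting a primitive b in ker f makes the
    -- lift a cycle.
    obtain ⟨b, hb1, hb2⟩ := h (M.d a) (by rw [f.comm, ha, hn]) (hdd a)
    refine ⟨Submodule.Quotient.mk ⟨a - b, by rw [LinearMap.mem_ker, map_sub, hb2, sub_self]⟩, ?_⟩
    rw [Ht.map, Submodule.mapQ_apply]
    congr 1
    refine Subtype.ext ?_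
    change f.toLin (a - b) = n
    rw [map_sub, hb1, sub_zero, ha]

/-- A graded surjection of matrix factorizations that are bounded below is a near-isomorphism if its
kernel is acyclic for `dPlus`. -/
theorem isNearIso_of_kerExact {M : MatrixFactorization.{u, v} S φ}
    {N : MatrixFactorization.{u, v'} S φ} {f : Hom M N} {b : ℤ} (hM : M.IsBddBelow b)
    (hf : f.IsGraded) (hs : Function.Surjective f.toLin) (h : KerExact M.dPlus f.toLin) :
    IsNearIso.{u, v, v', w} f := by
  refine ⟨hf, fun D hD => ?_⟩
  refine Ht.map_bijective _ (add_neg_cancel φ) (LinearMap.rTensor_surjective D.carrier hs) ?_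
  -- D is flat because it is projective; no flatness of M is needed.
  have hE := h.rTensor (fun a ha => by rw [hf.dPlus_comm, ha, map_zero]) M.dPlus_dPlus D.carrier
  -- The degree is that of M alone: `dMinus` lowers it and the differential of D preserves it, so
  -- both belong to r.
  refine KerExact.add (f := f.toLin.rTensor D.carrier) ((M.isBddProj hM).rTensor D.carrier)
    (r := M.dMinus.rTensor D.carrier + TensorProduct.map M.sgn D.d) hE ?_ ?_ ?_ ?_ ?_ ?_
  · intro z
    rw [tensor_d, d, TensorProduct.map_add_left, LinearMap.add_apply, LinearMap.add_apply,
      LinearMap.add_apply, ← add_assoc]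
    rfl
  · intro i z
    rw [← LinearMap.comp_apply, ← LinearMap.comp_apply, ← LinearMap.rTensor_comp,
      ← LinearMap.rTensor_comp, M.proj_dPlus]
  · intro i z hz j hj
    rw [LinearMap.add_apply, map_add, ← LinearMap.comp_apply, ← LinearMap.rTensor_comp,
      M.proj_dMinus, LinearMap.rTensor_comp, LinearMap.comp_apply, hz _ (by omega), map_zero,
      zero_add, ← LinearMap.comp_apply, LinearMap.rTensor_comp_map, M.proj_sgn,
      ← LinearMap.map_comp_rTensor, LinearMap.comp_apply, hz _ hj, map_zero]
  · intro i z hz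
    rw [← LinearMap.comp_apply, ← LinearMap.rTensor_comp, hf.proj_comm, LinearMap.rTensor_comp,
      LinearMap.comp_apply, hz, map_zero]
  · intro z hz
    have h1 := (f.tensor (Hom.id D)).comm z
    have h2 : (f.tensor (Hom.id D)).toLin z = 0 := hz
    rw [h2, map_zero] at h1
    exact h1
  · intro z
    exact ((M.tensor D).d_d z).trans (smul_eq_zero_of_left (add_neg_cancel φ) z)

end MatrixFactorization

/-! ### Acyclic kernels under tensor products and direct sums. -/

namespace MatrixFactorization

variable {S : Type u} [CommRing S] {φ ψ : S}

theorem IsBddBelow.tensor {M : MatrixFactorization.{u, v} S φ} {N : MatrixFactorization.{u, v'} S ψ}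
    {b b' : ℤ} (hM : M.IsBddBelow b) (hN : N.IsBddBelow b') : (M.tensor N).IsBddBelow (b + b') := by
  intro n hn
  rw [eq_bot_iff]
  refine tensorGrade_le M N fun i j hij x hx y hy => ?_
  by_cases hi : i < b
  · rw [hM i hi, Submodule.mem_bot] at hx
    simp [hx]
  · rw [hN j (by omega), Submodule.mem_bot] at hy
    simp [hy]

theorem Hom.IsGraded.tensor {M : MatrixFactorization.{u, v} S φ}
    {M' : MatrixFactorization.{u, v'} S φ} {N : MatrixFactorization.{u, w} S ψ}
    {N' : MatrixFactorization.{u, w'} S ψ} {f : Hom M M'} {g : Hom N N'}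
    (hf : f.IsGraded) (hg : g.IsGraded) : (f.tensor g).IsGraded := fun n _ ha =>
  tensorGrade_le M N (Q := (tensorGrade M' N' n).comap (TensorProduct.map f.toLin g.toLin))
    (fun i j h a ha b hb => tmul_mem_tensorGrade M' N' h (hf i a ha) (hg j b hb)) ha

theorem Hom.isGraded_id (M : MatrixFactorization.{u, v} S φ) : (Hom.id M).IsGraded :=
  fun _ _ ha => ha

/-- The kernel of `f` is acyclic for `dPlus` after tensoring with `Q`. -/
def ExactOn (Q : Type*) [AddCommGroup Q] [Module S Q] {M : MatrixFactorization.{u, v} S φ}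
    {N : MatrixFactorization.{u, v'} S φ} (f : Hom M N) : Prop :=
  KerExact (M.dPlus.lTensor Q) (f.toLin.lTensor Q)

section tensorStep

variable {Q : Type*} [AddCommGroup Q] [Module S Q] {M : MatrixFactorization.{u, v} S φ}
  {M' : MatrixFactorization.{u, v'} S φ} {N : MatrixFactorization.{u, w} S ψ}
  {N' : MatrixFactorization.{u, w'} S ψ} {f : Hom M M'} {g : Hom N N'}

/-- In the grading by the degree in M the term `sgn` ⊗ `N.dPlus` has degree 0. So `KerExact.add`
leaves only `M.dPlus` ⊗ 1, where flatness of N applies. -/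
theorem ExactOn.tensor_id {b : ℤ} (hM : M.IsBddBelow b) (hf : f.IsGraded)
    [Module.Flat S N.carrier] (h : ExactOn Q f) : ExactOn Q (f.tensor (Hom.id N)) := by
  have hcomm := (hf.tensor (Hom.isGraded_id N)).dPlus_comm
  have hcomm' : f.toLin.rTensor N.carrier ∘ₗ (M.tensor N).dPlus =
      (M'.tensor N).dPlus ∘ₗ f.toLin.rTensor N.carrier := LinearMap.ext hcomm
  have hE : KerExact ((M.dPlus.rTensor N.carrier).lTensor Q)
      ((f.toLin.rTensor N.carrier).lTensor Q) := by
    refine KerExact.congr (KerExact.rTensor h ?_ ?_ N.carrier) (TensorProduct.assoc S Q _ _)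
      (TensorProduct.assoc S Q _ _) ?_ ?_
    · intro a ha
      have : f.toLin ∘ₗ M.dPlus = M'.dPlus ∘ₗ f.toLin := LinearMap.ext hf.dPlus_comm
      rw [← LinearMap.comp_apply, ← LinearMap.lTensor_comp, this, LinearMap.lTensor_comp,
        LinearMap.comp_apply, ha, map_zero]
    · intro a
      have : M.dPlus ∘ₗ M.dPlus = 0 := LinearMap.ext M.dPlus_dPlus
      rw [← LinearMap.comp_apply, ← LinearMap.lTensor_comp, this, LinearMap.lTensor_zero,
        LinearMap.zero_apply]
    · intro z
      refine LinearMap.congr_fun (f := (TensorProduct.assoc S Q _ _).toLinearMap ∘ₗ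
        (M.dPlus.lTensor Q).rTensor N.carrier) (g := (M.dPlus.rTensor N.carrier).lTensor Q ∘ₗ
        (TensorProduct.assoc S Q _ _).toLinearMap) ?_ z
      exact TensorProduct.ext_threefold fun _ _ _ => rfl
    · intro z
      refine LinearMap.congr_fun (f := (TensorProduct.assoc S Q _ _).toLinearMap ∘ₗ
        (f.toLin.lTensor Q).rTensor N.carrier) (g := (f.toLin.rTensor N.carrier).lTensor Q ∘ₗ
        (TensorProduct.assoc S Q _ _).toLinearMap) ?_ z
      exact TensorProduct.ext_threefold fun _ _ _ => rfl
  refine KerExact.add (((M.isBddProj hM).rTensor N.carrier).lTensor Q)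
    (r := (TensorProduct.map M.sgn N.dPlus).lTensor Q) hE ?_ ?_ ?_ ?_ ?_ ?_
  · intro z
    exact LinearMap.congr_fun (LinearMap.lTensor_add Q (M.dPlus.rTensor N.carrier) _) z
  · intro i z
    rw [← LinearMap.comp_apply, ← LinearMap.comp_apply, ← LinearMap.lTensor_comp,
      ← LinearMap.lTensor_comp, ← LinearMap.rTensor_comp, ← LinearMap.rTensor_comp, M.proj_dPlus]
  · intro i z hz j hj
    rw [← LinearMap.comp_apply, ← LinearMap.lTensor_comp, LinearMap.rTensor_comp_map, M.proj_sgn,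
      ← LinearMap.map_comp_rTensor, LinearMap.lTensor_comp, LinearMap.comp_apply, hz _ hj, map_zero]
  · intro i z hz
    have hz' : (f.toLin.rTensor N.carrier).lTensor Q z = 0 := hz
    change (f.toLin.rTensor N.carrier).lTensor Q _ = 0
    rw [← LinearMap.comp_apply, ← LinearMap.lTensor_comp, ← LinearMap.rTensor_comp, hf.proj_comm,
      LinearMap.rTensor_comp, LinearMap.lTensor_comp, LinearMap.comp_apply, hz', map_zero]
  · intro z hz
    have hz' : (f.toLin.rTensor N.carrier).lTensor Q z = 0 := hz
    change (f.toLin.rTensor N.carrier).lTensor Q _ = 0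
    rw [← LinearMap.comp_apply, ← LinearMap.lTensor_comp, hcomm', LinearMap.lTensor_comp,
      LinearMap.comp_apply, hz', map_zero]
  · intro z
    have : (M.tensor N).dPlus ∘ₗ (M.tensor N).dPlus = 0 := LinearMap.ext (M.tensor N).dPlus_dPlus
    rw [← LinearMap.comp_apply, ← LinearMap.lTensor_comp, this, LinearMap.lTensor_zero,
      LinearMap.zero_apply]

/-- Factor f ⊗ g as (1 ⊗ g) ∘ (f ⊗ 1). Since M' carries neither `dPlus` nor a sign, `dPlus` on M' ⊗
N is 1 ⊗ `N.dPlus`, and M' can be absorbed into the coefficients. This is why exactness is tracked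
with coefficients, and why g is tested on Q ⊗ M'. -/
theorem ExactOn.tensor {b : ℤ} (hM : M.IsBddBelow b) (hf : f.IsGraded)
    (hfs : Function.Surjective f.toLin) (hd : M'.dPlus = 0)
    (hsgn : M'.sgn = LinearMap.id) [Module.Flat S N.carrier] (h : ExactOn Q f)
    (h' : ExactOn (Q ⊗[S] M'.carrier) g) : ExactOn Q (f.tensor g) := by
  have hdP : (M'.tensor N).dPlus = N.dPlus.lTensor M'.carrier := by
    change TensorProduct.map M'.dPlus LinearMap.id + TensorProduct.map M'.sgn N.dPlus = _
    rw [hd, hsgn, TensorProduct.map_zero_left, zero_add]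
    rfl
  have h2 : KerExact ((M'.tensor N).dPlus.lTensor Q) ((g.toLin.lTensor M'.carrier).lTensor Q) := by
    rw [hdP]
    refine KerExact.congr h' (TensorProduct.assoc S Q _ _) (TensorProduct.assoc S Q _ _) ?_ ?_
    · intro z
      refine LinearMap.congr_fun (f := (TensorProduct.assoc S Q _ _).toLinearMap ∘ₗ
        N.dPlus.lTensor (Q ⊗[S] M'.carrier)) (g := (N.dPlus.lTensor M'.carrier).lTensor Q ∘ₗ
        (TensorProduct.assoc S Q _ _).toLinearMap) ?_ z
      exact TensorProduct.ext_threefold fun _ _ _ => rfl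
    · intro z
      refine LinearMap.congr_fun (f := (TensorProduct.assoc S Q _ _).toLinearMap ∘ₗ
        g.toLin.lTensor (Q ⊗[S] M'.carrier)) (g := (g.toLin.lTensor M'.carrier).lTensor Q ∘ₗ
        (TensorProduct.assoc S Q _ _).toLinearMap) ?_ z
      exact TensorProduct.ext_threefold fun _ _ _ => rfl
  have h1 := h.tensor_id hM hf (N := N)
  have hcomm : (f.tensor (Hom.id N)).toLin ∘ₗ (M.tensor N).dPlus =
      (M'.tensor N).dPlus ∘ₗ (f.tensor (Hom.id N)).toLin :=
    LinearMap.ext (hf.tensor (Hom.isGraded_id N)).dPlus_comm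
  have h3 := KerExact.comp h1 h2 ?_ ?_ ?_
  · rw [← LinearMap.lTensor_comp] at h3
    have e : g.toLin.lTensor M'.carrier ∘ₗ (f.tensor (Hom.id N)).toLin = (f.tensor g).toLin :=
      TensorProduct.ext' fun _ _ => rfl
    rwa [e] at h3
  · exact LinearMap.lTensor_surjective Q (LinearMap.rTensor_surjective N.carrier hfs)
  · intro z
    rw [← LinearMap.comp_apply, ← LinearMap.lTensor_comp, hcomm, LinearMap.lTensor_comp,
      LinearMap.comp_apply]
  · intro z
    have : (M.tensor N).dPlus ∘ₗ (M.tensor N).dPlus = 0 := LinearMap.ext (M.tensor N).dPlus_dPlus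
    rw [← LinearMap.comp_apply, ← LinearMap.lTensor_comp, this, LinearMap.lTensor_zero,
      LinearMap.zero_apply]

/-- Tensoring on the left with a flat matrix factorization. -/
theorem KerExact.id_tensor {b : ℤ} (hN : N.IsBddBelow b) (hg : g.IsGraded)
    [Module.Flat S M.carrier] (h : KerExact N.dPlus g.toLin) :
    KerExact (M.tensor N).dPlus ((Hom.id M).tensor g).toLin := by
  have hcomm := ((Hom.isGraded_id M).tensor hg).dPlus_comm
  have h0 := h.lTensor (fun a ha => by rw [hg.dPlus_comm, ha, map_zero]) N.dPlus_dPlus M.carrier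
  have hsg : M.sgn ∘ₗ M.sgn = LinearMap.id := LinearMap.ext M.sgn_sgn
  -- `sgn` ⊗ 1 is an involution commuting with 1 ⊗ `N.dPlus` and compatible with 1 ⊗ g, so twisting
  -- the differential by it preserves acyclicity.
  have hE : KerExact (TensorProduct.map M.sgn N.dPlus) (g.toLin.lTensor M.carrier) := by
    intro z h1 h2
    have e : TensorProduct.map M.sgn N.dPlus =
        N.dPlus.lTensor M.carrier ∘ₗ M.sgn.rTensor N.carrier := TensorProduct.ext' fun _ _ => rfl
    have e' : g.toLin.lTensor M.carrier ∘ₗ M.sgn.rTensor N.carrier =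
        M.sgn.rTensor N'.carrier ∘ₗ g.toLin.lTensor M.carrier := TensorProduct.ext' fun _ _ => rfl
    have hss : ∀ z, M.sgn.rTensor N.carrier (M.sgn.rTensor N.carrier z) = z := fun z => by
      rw [← LinearMap.comp_apply, ← LinearMap.rTensor_comp, hsg, LinearMap.rTensor_id,
        LinearMap.id_apply]
    have hgs : ∀ z, g.toLin.lTensor M.carrier z = 0 →
        g.toLin.lTensor M.carrier (M.sgn.rTensor N.carrier z) = 0 := fun z hz => by
      rw [← LinearMap.comp_apply, e', LinearMap.comp_apply, hz, map_zero]
    have e'' : N.dPlus.lTensor M.carrier ∘ₗ M.sgn.rTensor N.carrier =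
        M.sgn.rTensor N.carrier ∘ₗ N.dPlus.lTensor M.carrier := TensorProduct.ext' fun _ _ => rfl
    rw [e, e'', LinearMap.comp_apply] at h2
    have h3 := hss (N.dPlus.lTensor M.carrier z)
    rw [h2, map_zero] at h3
    obtain ⟨w, hw1, hw2⟩ := h0 z h1 h3.symm
    exact ⟨M.sgn.rTensor N.carrier w, hgs w hw1, by rw [e, LinearMap.comp_apply, hss, hw2]⟩
  -- Here the degree is that of N, which `M.dPlus` ⊗ 1 preserves.
  refine KerExact.add ((N.isBddProj hN).lTensor M.carrier) (r := M.dPlus.rTensor N.carrier)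
    hE ?_ ?_ ?_ ?_ ?_ (M.tensor N).dPlus_dPlus
  · intro z
    exact add_comm _ _
  · intro i z
    rw [← LinearMap.comp_apply, ← LinearMap.comp_apply, LinearMap.lTensor_comp_map,
      LinearMap.map_comp_lTensor, N.proj_dPlus]
  · intro i z hz j hj
    rw [← LinearMap.comp_apply, LinearMap.lTensor_comp_rTensor, ← LinearMap.rTensor_comp_lTensor,
      LinearMap.comp_apply, hz _ hj, map_zero]
  · intro i z hz
    have hz' : g.toLin.lTensor M.carrier z = 0 := hz
    change g.toLin.lTensor M.carrier _ = 0
    rw [← LinearMap.comp_apply, ← LinearMap.lTensor_comp, hg.proj_comm, LinearMap.lTensor_comp,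
      LinearMap.comp_apply, hz', map_zero]
  · intro z hz
    rw [hcomm, hz, map_zero]

end tensorStep

section directSum

variable {ι : Type w} [DecidableEq ι]

theorem _root_.KerExact.lmap {X Y : ι → Type*} [∀ i, AddCommGroup (X i)] [∀ i, Module S (X i)]
    [∀ i, AddCommGroup (Y i)] [∀ i, Module S (Y i)] {d : ∀ i, X i →ₗ[S] X i}
    {f : ∀ i, X i →ₗ[S] Y i} (h : ∀ i, KerExact (d i) (f i)) :
    KerExact (DirectSum.lmap d) (DirectSum.lmap f) := by
  classical
  intro a h1 h2
  have h1' : ∀ i, f i (a i) = 0 := fun i => DFunLike.congr_fun h1 i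
  have h2' : ∀ i, d i (a i) = 0 := fun i => DFunLike.congr_fun h2 i
  choose c hc1 hc2 using fun i => h i (a i) (h1' i) (h2' i)
  -- The chosen primitives may be nonzero where a vanishes, so they are cut down to the support of a
  -- to obtain an element of the direct sum.
  let w : ⨁ i, X i := DirectSum.mk X (DFinsupp.support a) fun i => c i
  have hw : ∀ i, w i = if i ∈ DFinsupp.support a then c i else 0 := fun i => by
    by_cases hi : i ∈ DFinsupp.support a
    · rw [if_pos hi]; exact DirectSum.mk_apply_of_mem hi
    · rw [if_neg hi]; exact DirectSum.mk_apply_of_notMem hi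
  refine ⟨w, DFinsupp.ext fun i => ?_, DFinsupp.ext fun i => ?_⟩
  · change f i (w i) = 0
    rw [hw]
    split_ifs
    · exact hc1 i
    · exact map_zero _
  · change d i (w i) = a i
    rw [hw]
    split_ifs with hi
    · exact hc2 i
    · rw [map_zero]
      by_contra h0
      exact hi (DFinsupp.mem_support_iff.2 (Ne.symm h0))

variable {M : ι → MatrixFactorization.{u, v} S φ} {N : ι → MatrixFactorization.{u, v'} S φ}

/-- The direct sum of a family of morphisms. -/
noncomputable def Hom.directSum (f : ∀ i, Hom (M i) (N i)) :
    Hom (MatrixFactorization.directSum M) (MatrixFactorization.directSum N) :=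
  Hom.desc fun i => (Hom.ofSummand N i).comp (f i)

theorem Hom.directSum_toLin (f : ∀ i, Hom (M i) (N i)) :
    (Hom.directSum f).toLin = DirectSum.lmap fun i => (f i).toLin :=
  DirectSum.linearMap_ext S fun i => LinearMap.ext fun a => by
    rw [LinearMap.comp_apply, LinearMap.comp_apply, DirectSum.lmap_lof]
    exact Hom.desc_lof _ i a

theorem Hom.IsGraded.directSum {f : ∀ i, Hom (M i) (N i)} (hf : ∀ i, (f i).IsGraded) :
    (Hom.directSum f).IsGraded := by
  intro n a ha i
  rw [Hom.directSum_toLin]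
  exact hf i n _ (ha i)

theorem Hom.directSum_surjective {f : ∀ i, Hom (M i) (N i)}
    (hf : ∀ i, Function.Surjective (f i).toLin) :
    Function.Surjective (Hom.directSum f).toLin := by
  rw [Hom.directSum_toLin]
  exact (DirectSum.lmap_surjective _).2 hf

theorem IsBddBelow.directSum {b : ℤ} (h : ∀ i, (M i).IsBddBelow b) :
    (MatrixFactorization.directSum M).IsBddBelow b := by
  intro n hn
  rw [eq_bot_iff]
  intro a ha
  rw [Submodule.mem_bot]
  refine DFinsupp.ext fun i => ?_
  have := ha i
  rw [h i n hn] at this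
  exact this

theorem _root_.TensorProduct.directSumRight_symm_lmap {X : ι → Type v} {Y : ι → Type v'}
    [∀ i, AddCommGroup (X i)] [∀ i, Module S (X i)] [∀ i, AddCommGroup (Y i)] [∀ i, Module S (Y i)]
    (Q : Type*) [AddCommGroup Q] [Module S Q] (g : ∀ i, X i →ₗ[S] Y i) (z : ⨁ i, Q ⊗[S] X i) :
    (TensorProduct.directSumRight S S Q Y).symm
      (DirectSum.lmap (fun i => (g i).lTensor Q) z) =
    (DirectSum.lmap g).lTensor Q ((TensorProduct.directSumRight S S Q X).symm z) := by
  refine LinearMap.congr_fun (f := (TensorProduct.directSumRight S S Q Y).symm.toLinearMap ∘ₗ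
    DirectSum.lmap (fun i => (g i).lTensor Q)) (g := (DirectSum.lmap g).lTensor Q ∘ₗ
    (TensorProduct.directSumRight S S Q X).symm.toLinearMap) ?_ z
  refine DirectSum.linearMap_ext S fun i => TensorProduct.ext' fun q x => ?_
  simp only [LinearMap.comp_apply, LinearEquiv.coe_coe, DirectSum.lmap_lof,
    LinearMap.lTensor_tmul, TensorProduct.directSumRight_symm_lof_tmul]

theorem _root_.KerExact.lTensor_lmap {X : ι → Type v} {Y : ι → Type v'}
    [∀ i, AddCommGroup (X i)] [∀ i, Module S (X i)] [∀ i, AddCommGroup (Y i)] [∀ i, Module S (Y i)]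
    {Q : Type*} [AddCommGroup Q] [Module S Q] {d : ∀ i, X i →ₗ[S] X i} {f : ∀ i, X i →ₗ[S] Y i}
    (h : ∀ i, KerExact ((d i).lTensor Q) ((f i).lTensor Q)) :
    KerExact ((DirectSum.lmap d).lTensor Q) ((DirectSum.lmap f).lTensor Q) :=
  (KerExact.lmap h).congr (TensorProduct.directSumRight S S Q X).symm
    (TensorProduct.directSumRight S S Q Y).symm
    (TensorProduct.directSumRight_symm_lmap Q d) (TensorProduct.directSumRight_symm_lmap Q f)

theorem ExactOn.directSum {Q : Type*} [AddCommGroup Q] [Module S Q] {f : ∀ i, Hom (M i) (N i)}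
    (h : ∀ i, ExactOn Q (f i)) : ExactOn Q (Hom.directSum f) := by
  rw [ExactOn, Hom.directSum_toLin]
  exact KerExact.lTensor_lmap h

end directSum

end MatrixFactorization

/-! ### Coordinates of tensors with coefficients. -/

section evalTensor

variable {S : Type*} [CommRing S] {X : Type*} [AddCommGroup X] [Module S X]

/-- The map `Q ⊗ X → Q` induced by a linear form on `X`. -/
noncomputable def evalTensor (Q : Type*) [AddCommGroup Q] [Module S Q] (c : X →ₗ[S] S) :
    Q ⊗[S] X →ₗ[S] Q :=
  (TensorProduct.rid S Q).toLinearMap ∘ₗ c.lTensor Q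

variable {Q : Type*} [AddCommGroup Q] [Module S Q]

@[simp]
theorem evalTensor_tmul (c : X →ₗ[S] S) (q : Q) (a : X) : evalTensor Q c (q ⊗ₜ a) = c a • q := by
  simp [evalTensor]

theorem evalTensor_lTensor (c : X →ₗ[S] S) (d : X →ₗ[S] X) (z : Q ⊗[S] X) :
    evalTensor Q c (d.lTensor Q z) = evalTensor Q (c ∘ₗ d) z := by
  rw [evalTensor, evalTensor, LinearMap.lTensor_comp]
  rfl

theorem evalTensor_add (c c' : X →ₗ[S] S) (z : Q ⊗[S] X) :
    evalTensor Q (c + c') z = evalTensor Q c z + evalTensor Q c' z := by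
  rw [evalTensor, LinearMap.lTensor_add, LinearMap.comp_add]
  rfl

theorem evalTensor_smul (x : S) (c : X →ₗ[S] S) (z : Q ⊗[S] X) :
    evalTensor Q (x • c) z = x • evalTensor Q c z := by
  rw [evalTensor, LinearMap.lTensor_smul, LinearMap.comp_smul]
  rfl

theorem evalTensor_zero (z : Q ⊗[S] X) : evalTensor Q (0 : X →ₗ[S] S) z = 0 := by
  rw [evalTensor, LinearMap.lTensor_zero, LinearMap.comp_zero, LinearMap.zero_apply]

/-- By right exactness the element comes from Q ⊗ P, and on P the form c takes values in the ideal.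
-/
theorem exists_evalTensor_eq_of_mem_ker {P : Submodule S X} {c : X →ₗ[S] S} {x₁ x₂ : S}
    (hP : ∀ a ∈ P, c a ∈ Ideal.span {x₁, x₂}) {z : Q ⊗[S] X} (hz : P.mkQ.lTensor Q z = 0) :
    ∃ α β : Q, evalTensor Q c z = x₁ • α + x₂ • β := by
  obtain ⟨z, rfl⟩ := (lTensor_exact Q (LinearMap.exact_subtype_mkQ P) P.mkQ_surjective z).1 hz
  clear hz
  induction z using TensorProduct.induction_on with
  | zero => exact ⟨0, 0, by simp⟩
  | tmul q a =>
    obtain ⟨s, t, hst⟩ := Ideal.mem_span_pair.1 (hP a.1 a.2)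
    refine ⟨s • q, t • q, ?_⟩
    rw [LinearMap.lTensor_tmul, evalTensor_tmul, Submodule.subtype_apply, ← hst]
    module
  | add a b ha hb =>
    obtain ⟨α, β, h1⟩ := ha
    obtain ⟨α', β', h2⟩ := hb
    exact ⟨α + α', β + β', by rw [map_add, map_add, h1, h2]; module⟩

end evalTensor

/-! ### The Koszul complex of a pair, with coefficients. -/

namespace MatrixFactorization

variable {S : Type u} [CommRing S] {φ : S}

/-- The coordinate of an element of `(S × S) ⊗ (S × S)` given by two linear forms. -/
noncomputable def koszulCoord (f g : S × S →ₗ[S] S) : (S × S) ⊗[S] (S × S) →ₗ[S] S :=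
  LinearMap.mul' S S ∘ₗ TensorProduct.map f g

@[simp]
theorem koszulCoord_tmul (f g : S × S →ₗ[S] S) (u v : S × S) :
    koszulCoord f g (u ⊗ₜ v) = f u * g v := by
  simp [koszulCoord]

-- An index 0 selects the generator of degree 0 in the corresponding factor, an index 1 the
-- generator of degree -1.
local notation "c₀₀" => koszulCoord (LinearMap.snd _ _ _) (LinearMap.snd _ _ _)
local notation "c₁₀" => koszulCoord (LinearMap.fst _ _ _) (LinearMap.snd _ _ _)
local notation "c₀₁" => koszulCoord (LinearMap.snd _ _ _) (LinearMap.fst _ _ _)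
local notation "c₁₁" => koszulCoord (LinearMap.fst _ _ _) (LinearMap.fst _ _ _)

theorem koszulCoord_sum (a : (S × S) ⊗[S] (S × S)) :
    c₀₀ a • ((0, 1) ⊗ₜ (0, 1)) + c₁₀ a • ((1, 0) ⊗ₜ (0, 1)) + c₀₁ a • ((0, 1) ⊗ₜ (1, 0)) +
      c₁₁ a • ((1, 0) ⊗ₜ (1, 0)) = a := by
  induction a using TensorProduct.induction_on with
  | zero => simp
  | tmul u v => simpa using (tmul_eq u v).symm
  | add a b ha hb =>
    conv_rhs => rw [← ha, ← hb]
    simp only [map_add]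
    module

theorem evalTensor_koszulCoord_sum {Q : Type*} [AddCommGroup Q] [Module S Q]
    (z : Q ⊗[S] ((S × S) ⊗[S] (S × S))) :
    evalTensor Q c₀₀ z ⊗ₜ ((0, 1) ⊗ₜ (0, 1)) + evalTensor Q c₁₀ z ⊗ₜ ((1, 0) ⊗ₜ (0, 1)) +
      evalTensor Q c₀₁ z ⊗ₜ ((0, 1) ⊗ₜ (1, 0)) +
      evalTensor Q c₁₁ z ⊗ₜ ((1, 0) ⊗ₜ (1, 0)) = z := by
  induction z using TensorProduct.induction_on with
  | zero => simp
  | tmul q a =>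
    conv_rhs => rw [← koszulCoord_sum a]
    simp only [evalTensor_tmul, TensorProduct.tmul_add, TensorProduct.smul_tmul]
  | add a b ha hb =>
    conv_rhs => rw [← ha, ← hb]
    simp only [map_add, TensorProduct.add_tmul]
    abel

section koszul

/-- The part of degree `1` of the differential of `koszul₂`, as an explicit map. -/
noncomputable def koszulDPlus (x₁ x₂ : S) : (S × S) ⊗[S] (S × S) →ₗ[S] (S × S) ⊗[S] (S × S) :=
  TensorProduct.map (LinearMap.inr S S S ∘ₗ (x₁ • LinearMap.fst S S S)) LinearMap.id +
    TensorProduct.map (LinearMap.prodMap (-LinearMap.id) LinearMap.id)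
      (LinearMap.inr S S S ∘ₗ (x₂ • LinearMap.fst S S S))

/-- The kernel of the natural map of `koszul₂` to its zeroth cohomology, as an explicit
submodule. -/
noncomputable def koszulKer (x₁ x₂ : S) : Submodule S ((S × S) ⊗[S] (S × S)) :=
  Submodule.comap c₀₀ (Ideal.span {x₁, x₂})

variable (x₁ x₂ : S)

theorem koszulDPlus_tmul (u v : S × S) : koszulDPlus x₁ x₂ (u ⊗ₜ[S] v) =
    ((0, x₁ * u.1) : S × S) ⊗ₜ[S] v + ((-u.1, u.2) : S × S) ⊗ₜ[S] ((0, x₂ * v.1) : S × S) := rfl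

/-- This lemma and the next three are the rows of the matrix of the Koszul differential. -/
theorem koszulCoord_snd_snd_dPlus : c₀₀ ∘ₗ koszulDPlus x₁ x₂ = x₁ • c₁₀ + x₂ • c₀₁ := by
  refine TensorProduct.ext' fun u v => ?_
  rw [LinearMap.comp_apply, koszulDPlus_tmul]
  simp
  ring

theorem koszulCoord_fst_snd_dPlus : c₁₀ ∘ₗ koszulDPlus x₁ x₂ = (-x₂) • c₁₁ := by
  refine TensorProduct.ext' fun u v => ?_
  rw [LinearMap.comp_apply, koszulDPlus_tmul]
  simp
  ring

theorem koszulCoord_snd_fst_dPlus : c₀₁ ∘ₗ koszulDPlus x₁ x₂ = x₁ • c₁₁ := by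
  refine TensorProduct.ext' fun u v => ?_
  rw [LinearMap.comp_apply, koszulDPlus_tmul]
  simp
  ring

theorem koszulCoord_fst_fst_dPlus : c₁₁ ∘ₗ koszulDPlus x₁ x₂ = 0 := by
  refine TensorProduct.ext' fun u v => ?_
  rw [LinearMap.comp_apply, koszulDPlus_tmul]
  simp

theorem koszulDPlus_mem_koszulKer (a : (S × S) ⊗[S] (S × S)) :
    koszulDPlus x₁ x₂ a ∈ koszulKer x₁ x₂ := by
  have h := LinearMap.congr_fun (koszulCoord_snd_snd_dPlus x₁ x₂) a
  rw [LinearMap.comp_apply] at h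
  rw [koszulKer, Submodule.mem_comap, h]
  exact Ideal.mem_span_pair.2 ⟨c₁₀ a, c₀₁ a, by simp [mul_comm]⟩

/-- If the coordinate in degree 0 is s x₁ + t x₂, the primitive has coordinates s and t in degree
-1. -/
theorem exists_koszulDPlus_eq {a : (S × S) ⊗[S] (S × S)} (ha : a ∈ koszulKer x₁ x₂) :
    ∃ w, koszulDPlus x₁ x₂ w = c₀₀ a • ((0, 1) ⊗ₜ (0, 1)) := by
  obtain ⟨s, t, hst⟩ : ∃ s t, s * x₁ + t * x₂ = c₀₀ a := Ideal.mem_span_pair.1 ha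
  refine ⟨s • ((1, 0) ⊗ₜ (0, 1)) + t • ((0, 1) ⊗ₜ (1, 0)), ?_⟩
  have e3 : ∀ r : S, ((0, r) : S × S) = r • (0, 1) := fun r => by simp
  rw [map_add, map_smul, map_smul, koszulDPlus_tmul, koszulDPlus_tmul, ← hst]
  dsimp only
  rw [e3 (x₁ * 1), e3 (x₂ * 1), e3 (x₁ * 0), e3 (x₂ * 0), neg_zero]
  simp only [mul_one, mul_zero, zero_smul, TensorProduct.tmul_zero, TensorProduct.zero_tmul,
    add_zero, zero_add, TensorProduct.smul_tmul, TensorProduct.tmul_smul, smul_smul, add_smul]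

/-- The zeroth cohomology of the Koszul complex of `x₁, x₂`. -/
noncomputable def koszulKerEquiv :
    ((S × S) ⊗[S] (S × S) ⧸ koszulKer x₁ x₂) ≃ₗ[S] S ⧸ Ideal.span {x₁, x₂} :=
  Submodule.quotEquivOfEq (koszulKer x₁ x₂) (LinearMap.ker ((Ideal.span {x₁, x₂}).mkQ ∘ₗ c₀₀))
    (by rw [LinearMap.ker_comp, Submodule.ker_mkQ]; rfl) ≪≫ₗ
  LinearMap.quotKerEquivOfSurjective ((Ideal.span {x₁, x₂}).mkQ ∘ₗ c₀₀)
    ((Submodule.mkQ_surjective _).comp fun s => ⟨s • ((0, 1) ⊗ₜ (0, 1)), by simp⟩)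

/-- If `x₁, x₂` is a weakly regular sequence on `Q`, the Koszul complex of `x₁, x₂` on `Q` resolves
the tensor product of `Q` with its zeroth cohomology. -/
theorem kerExact_koszulDPlus {Q : Type*} [AddCommGroup Q] [Module S Q]
    (h₁ : ∀ q : Q, x₁ • q = 0 → q = 0)
    (h₂ : ∀ q q' : Q, x₂ • q = x₁ • q' → ∃ q'', q = x₁ • q'') :
    KerExact ((koszulDPlus x₁ x₂).lTensor Q) ((koszulKer x₁ x₂).mkQ.lTensor Q) := by
  have hd : ∀ z, evalTensor Q c₀₀ ((koszulDPlus x₁ x₂).lTensor Q z) =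
        x₁ • evalTensor Q c₁₀ z + x₂ • evalTensor Q c₀₁ z ∧
      evalTensor Q c₁₀ ((koszulDPlus x₁ x₂).lTensor Q z) = (-x₂) • evalTensor Q c₁₁ z ∧
      evalTensor Q c₀₁ ((koszulDPlus x₁ x₂).lTensor Q z) = x₁ • evalTensor Q c₁₁ z ∧
      evalTensor Q c₁₁ ((koszulDPlus x₁ x₂).lTensor Q z) = 0 := by
    intro z
    refine ⟨?_, ?_, ?_, ?_⟩
    · rw [evalTensor_lTensor, koszulCoord_snd_snd_dPlus, evalTensor_add, evalTensor_smul,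
        evalTensor_smul]
    · rw [evalTensor_lTensor, koszulCoord_fst_snd_dPlus, evalTensor_smul]
    · rw [evalTensor_lTensor, koszulCoord_snd_fst_dPlus, evalTensor_smul]
    · rw [evalTensor_lTensor, koszulCoord_fst_fst_dPlus, evalTensor_zero]
  have hker : ∀ z, (koszulKer x₁ x₂).mkQ.lTensor Q z = 0 →
      ∃ α β : Q, evalTensor Q c₀₀ z = x₁ • α + x₂ • β :=
    fun z hz => exists_evalTensor_eq_of_mem_ker (fun _ ha => ha) hz
  intro z hz hdz
  obtain ⟨α, β, hαβ⟩ := hker z hz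
  obtain ⟨d00, d10, d01, d11⟩ := hd z
  rw [hdz, map_zero] at d00 d10 d01
  -- The coordinate of degree -2 is killed by x₁.
  have z11 := h₁ _ d01.symm
  -- The relation x₁ z₁₀ + x₂ z₀₁ = 0 makes z₀₁ divisible by x₁, say z₀₁ = x₁ γ; cancelling x₁ then
  -- gives z₁₀ = -x₂ γ.
  obtain ⟨γ, hγ⟩ := h₂ (evalTensor Q c₀₁ z) (-evalTensor Q c₁₀ z) (by
    rw [smul_neg, eq_neg_iff_add_eq_zero, add_comm, ← d00])
  have z10 : evalTensor Q c₁₀ z = (-x₂) • γ := by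
    rw [← sub_eq_zero]
    refine h₁ _ ?_
    rw [hγ] at d00
    rw [smul_sub, d00]
    module
  -- α and β produce the coordinate of z in degree 0, and γ produces both coordinates in degree -1.
  let w : Q ⊗[S] ((S × S) ⊗[S] (S × S)) := α ⊗ₜ ((1, 0) ⊗ₜ (0, 1)) +
    β ⊗ₜ ((0, 1) ⊗ₜ (1, 0)) + γ ⊗ₜ ((1, 0) ⊗ₜ (1, 0))
  have w10 : evalTensor Q c₁₀ w = α := by simp [w]
  have w01 : evalTensor Q c₀₁ w = β := by simp [w]
  have w11 : evalTensor Q c₁₁ w = γ := by simp [w]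
  refine ⟨w, ?_, ?_⟩
  · have hm : ∀ a, c₀₀ a = 0 → (koszulKer x₁ x₂).mkQ a = 0 := fun a ha => by
      rw [Submodule.mkQ_apply, Submodule.Quotient.mk_eq_zero, koszulKer, Submodule.mem_comap, ha]
      exact Submodule.zero_mem _
    simp only [w, map_add, LinearMap.lTensor_tmul]
    rw [hm _ (by simp), hm _ (by simp), hm _ (by simp)]
    simp only [TensorProduct.tmul_zero, add_zero]
  · obtain ⟨e00, e10, e01, e11⟩ := hd w
    rw [w10, w01] at e00
    rw [w11] at e10 e01
    rw [← evalTensor_koszulCoord_sum z, ← evalTensor_koszulCoord_sum ((koszulDPlus x₁ x₂).lTensor Q w),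
      e00, e10, e01, e11, hαβ, z10, hγ, z11]

variable {x₁ x₂} {y₁ y₂ : S} (h : x₁ * y₁ + x₂ * y₂ = φ)

/-- The sign operator is defined through the decomposition into degrees; `twoTerm_sgn` makes it
explicit, after which both sides agree by unfolding. -/
theorem koszul₂_dPlus : (koszul₂ x₁ x₂ y₁ y₂ h).dPlus = koszulDPlus x₁ x₂ := by
  have h1 : (twoTerm x₁ y₁).sgn = LinearMap.prodMap (-LinearMap.id) LinearMap.id :=
    LinearMap.ext fun a => twoTerm_sgn x₁ y₁ a
  have h2 : ((twoTerm x₁ y₁).tensor (twoTerm x₂ y₂)).dPlus =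
    TensorProduct.map (twoTerm x₁ y₁).dPlus LinearMap.id +
      TensorProduct.map (twoTerm x₁ y₁).sgn (twoTerm x₂ y₂).dPlus := rfl
  rw [h1] at h2
  exact h2

theorem tmul_mem_koszul₂_fHKer {i j : ℤ} (hij : i + j ≠ 0) {u v : S × S}
    (hu : u ∈ twoTermGrade S i) (hv : v ∈ twoTermGrade S j) :
    u ⊗ₜ[S] v ∈ (koszul₂ x₁ x₂ y₁ y₂ h).fHKer :=
  (koszul₂ x₁ x₂ y₁ y₂ h).grade_le_fHKer hij
    (tmul_mem_tensorGrade (twoTerm x₁ y₁) (twoTerm x₂ y₂) rfl hu hv)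

/-- Both sides contain everything outside degree 0, so only the coordinate in degree 0 matters;
there the image of `dPlus` is the ideal (x₁, x₂). -/
theorem koszul₂_fHKer : (koszul₂ x₁ x₂ y₁ y₂ h).fHKer = koszulKer x₁ x₂ := by
  refine le_antisymm (sup_le ?_ (iSup_le fun i => ?_)) fun a ha => ?_
  · rw [koszul₂_dPlus]
    rintro _ ⟨a, rfl⟩
    exact koszulDPlus_mem_koszulKer x₁ x₂ a
  · refine tensorGrade_le (twoTerm x₁ y₁) (twoTerm x₂ y₂) fun p q hpq u hu v hv => ?_
    refine (congrArg (· ∈ Ideal.span {x₁, x₂}) (koszulCoord_tmul _ _ u v)).mpr ?_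
    have h0 : u.2 * v.2 = 0 := by
      by_cases hp : p = 0
      · rw [hv.2 (by have := i.2; omega), mul_zero]
      · rw [hu.2 hp, zero_mul]
    simp [h0]
  · have e0 : ((0, 1) : S × S) ∈ twoTermGrade S 0 := by simp [mem_twoTermGrade]
    have e1 : ((1, 0) : S × S) ∈ twoTermGrade S (-1) := by simp [mem_twoTermGrade]
    obtain ⟨w, hw⟩ := exists_koszulDPlus_eq x₁ x₂ ha
    have h2 := Submodule.mem_sup_left (T := ⨆ i : {i : ℤ // i ≠ 0}, (koszul₂ x₁ x₂ y₁ y₂ h).grade i)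
      (show _ ∈ LinearMap.range (koszul₂ x₁ x₂ y₁ y₂ h).dPlus from
        ⟨w, (LinearMap.congr_fun (koszul₂_dPlus h) _).trans hw⟩)
    refine (congrArg (· ∈ (koszul₂ x₁ x₂ y₁ y₂ h).fHKer) (koszulCoord_sum a)).mp ?_
    refine Submodule.add_mem _ (Submodule.add_mem _ (Submodule.add_mem _ h2
      (Submodule.smul_mem _ _ (tmul_mem_koszul₂_fHKer h (by norm_num) e1 e0)))
      (Submodule.smul_mem _ _ (tmul_mem_koszul₂_fHKer h (by norm_num) e0 e1)))
      (Submodule.smul_mem _ _ (tmul_mem_koszul₂_fHKer h (by norm_num) e1 e1))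

theorem nonempty_koszul₂_fH_equiv : Nonempty (((koszul₂ x₁ x₂ y₁ y₂ h).fH
    (koszul₂_isNonpos x₁ x₂ y₁ y₂ h)).carrier ≃ₗ[S] S ⧸ Ideal.span {x₁, x₂}) := by
  -- The submodule is generalized so that its equality with `koszulKer` can be substituted inside
  -- the quotient type.
  have key : ∀ P : Submodule S ((S × S) ⊗[S] (S × S)), P = koszulKer x₁ x₂ →
      Nonempty (((S × S) ⊗[S] (S × S) ⧸ P) ≃ₗ[S] S ⧸ Ideal.span {x₁, x₂}) := by
    rintro _ rfl
    exact ⟨koszulKerEquiv x₁ x₂⟩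
  exact key (koszul₂ x₁ x₂ y₁ y₂ h).fHKer (koszul₂_fHKer h)

theorem exactOn_koszul₂_toFH {Q : Type*} [AddCommGroup Q] [Module S Q]
    (h₁ : ∀ q : Q, x₁ • q = 0 → q = 0)
    (h₂ : ∀ q q' : Q, x₂ • q = x₁ • q' → ∃ q'', q = x₁ • q'') :
    ExactOn Q (Hom.toFH (koszul₂ x₁ x₂ y₁ y₂ h) (koszul₂_isNonpos x₁ x₂ y₁ y₂ h)) := by
  -- Generalized for the same reason: the target of the quotient map depends on P.
  have key : ∀ (d : (S × S) ⊗[S] (S × S) →ₗ[S] (S × S) ⊗[S] (S × S))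
      (P : Submodule S ((S × S) ⊗[S] (S × S))), d = koszulDPlus x₁ x₂ → P = koszulKer x₁ x₂ →
      KerExact (d.lTensor Q) (P.mkQ.lTensor Q) := by
    rintro _ _ rfl rfl
    exact kerExact_koszulDPlus x₁ x₂ h₁ h₂
  exact key (koszul₂ x₁ x₂ y₁ y₂ h).dPlus (koszul₂ x₁ x₂ y₁ y₂ h).fHKer (koszul₂_dPlus h)
    (koszul₂_fHKer h)

theorem twoTerm_isBddBelow (x y : S) : (twoTerm x y).IsBddBelow (-1) := by
  intro i hi
  rw [eq_bot_iff]
  intro a ha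
  rw [Submodule.mem_bot]
  exact Prod.ext (ha.1 (by omega)) (ha.2 (by omega))

theorem koszul₂_isBddBelow : (koszul₂ x₁ x₂ y₁ y₂ h).IsBddBelow (-2) :=
  (twoTerm_isBddBelow x₁ y₁).tensor (twoTerm_isBddBelow x₂ y₂)

end koszul

theorem Hom.toFH_isGraded (M : MatrixFactorization.{u, v} S φ) (hM : M.IsNonpos) :
    (Hom.toFH M hM).IsGraded := by
  intro i a ha
  by_cases hi : i = 0
  · subst hi
    simp
  · have : M.fHKer.mkQ a = 0 := by
      rw [Submodule.mkQ_apply, Submodule.Quotient.mk_eq_zero]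
      exact M.grade_le_fHKer hi ha
    change M.fHKer.mkQ a ∈ _
    rw [this]
    exact Submodule.zero_mem _

/-- A factorization concentrated in degree 0 contributes no sign, as `ExactOn.tensor` requires of
its middle factor. -/
theorem ofModule_sgn (N : Type v) [AddCommGroup N] [Module S N] (h : ∀ a : N, φ • a = 0) :
    (ofModule N h).sgn = LinearMap.id :=
  LinearMap.ext fun a => by
    rw [(ofModule N h).sgn_of_mem (i := 0) (by simp)]
    simp

theorem ofModule_isBddBelow (N : Type v) [AddCommGroup N] [Module S N] (h : ∀ a : N, φ • a = 0)
    {b : ℤ} (hb : b ≤ 0) : (ofModule N h).IsBddBelow b :=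
  fun _ hi => if_neg (by omega)

end MatrixFactorization

/-! ### Regular pairs modulo an ideal, and tensor products of cyclic modules. -/

section Ideals

variable {S : Type*} [CommRing S]

/-- If `s, r` is weakly regular modulo `I`, then `s` is regular modulo `I` and `r`. -/
theorem Ideal.mem_sup_span_of_mul_mem_sup_span {I : Ideal S} {r s : S}
    (hs : ∀ g, s * g ∈ I → g ∈ I)
    (hr : ∀ g, r * g ∈ I ⊔ Ideal.span {s} → g ∈ I ⊔ Ideal.span {s}) {g : S}
    (hg : s * g ∈ I ⊔ Ideal.span {r}) : g ∈ I ⊔ Ideal.span {r} := by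
  obtain ⟨a, ha, b, hb, hab⟩ := Submodule.mem_sup.1 hg
  obtain ⟨h, rfl⟩ := Ideal.mem_span_singleton'.1 hb
  -- From s g = a + h r with a in I, r h lies in I + (s). So h = a' + h' s with a' in I, and s (g -
  -- r h') = a + r a' lies in I.
  have h1 : r * h ∈ I ⊔ Ideal.span {s} := by
    have : r * h = -a + g * s := by linear_combination hab
    rw [this]
    exact Submodule.add_mem_sup (neg_mem ha) (Ideal.mem_span_singleton'.2 ⟨g, rfl⟩)
  obtain ⟨a', ha', b', hb', hab'⟩ := Submodule.mem_sup.1 (hr h h1)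
  obtain ⟨h', rfl⟩ := Ideal.mem_span_singleton'.1 hb'
  have h2 : g - r * h' ∈ I := by
    refine hs _ ?_
    have : s * (g - r * h') = a + r * a' := by linear_combination (-1) * hab - r * hab'
    rw [this]
    exact add_mem ha (I.mul_mem_left r ha')
  have : g = (g - r * h') + h' * r := by ring
  rw [this]
  exact Submodule.add_mem_sup h2 (Ideal.mem_span_singleton'.2 ⟨h', rfl⟩)

/-- `x₁, x₂` is a weakly regular sequence modulo `I`. -/
def Ideal.IsRegularPair (I : Ideal S) (x₁ x₂ : S) : Prop :=
  (∀ g, x₁ * g ∈ I → g ∈ I) ∧ ∀ g, x₂ * g ∈ I ⊔ Ideal.span {x₁} → g ∈ I ⊔ Ideal.span {x₁}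

/-- Transported through e, the two regularity conditions on Q become membership statements about
representatives in S. -/
theorem MatrixFactorization.exactOn_koszul₂_toFH_of_equiv {S : Type u} [CommRing S]
    {φ x₁ x₂ y₁ y₂ : S} (h : x₁ * y₁ + x₂ * y₂ = φ) {Q : Type*} [AddCommGroup Q] [Module S Q]
    {I : Ideal S} (e : Q ≃ₗ[S] S ⧸ I) (hI : I.IsRegularPair x₁ x₂) :
    ExactOn Q (Hom.toFH (koszul₂ x₁ x₂ y₁ y₂ h) (koszul₂_isNonpos x₁ x₂ y₁ y₂ h)) := by
  have he : ∀ q, ∃ g : S, e q = Submodule.Quotient.mk g := fun q => by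
    obtain ⟨g, hg⟩ := Submodule.Quotient.mk_surjective _ (e q)
    exact ⟨g, hg.symm⟩
  refine exactOn_koszul₂_toFH h (fun q hq => ?_) fun q q' hq => ?_
  · obtain ⟨g, hg⟩ := he q
    have h1 := congrArg e hq
    rw [map_smul, hg, map_zero, ← Submodule.Quotient.mk_smul, Submodule.Quotient.mk_eq_zero] at h1
    rw [← map_eq_zero_iff e e.injective, hg, Submodule.Quotient.mk_eq_zero]
    exact hI.1 g h1
  · obtain ⟨g, hg⟩ := he q
    obtain ⟨g', hg'⟩ := he q'
    have h1 := congrArg e hq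
    rw [map_smul, map_smul, hg, hg', ← Submodule.Quotient.mk_smul, ← Submodule.Quotient.mk_smul,
      Submodule.Quotient.eq, smul_eq_mul, smul_eq_mul] at h1
    have h2 : x₂ * g ∈ I ⊔ Ideal.span {x₁} := by
      have : x₂ * g = (x₂ * g - x₁ * g') + g' * x₁ := by ring
      rw [this]
      exact Submodule.add_mem_sup h1 (Ideal.mem_span_singleton'.2 ⟨g', rfl⟩)
    obtain ⟨a, ha, b, hb, hab⟩ := Submodule.mem_sup.1 (hI.2 g h2)
    obtain ⟨g'', rfl⟩ := Ideal.mem_span_singleton'.1 hb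
    refine ⟨e.symm (Submodule.Quotient.mk g''), e.injective ?_⟩
    rw [map_smul, e.apply_symm_apply, hg, ← Submodule.Quotient.mk_smul, Submodule.Quotient.eq,
      smul_eq_mul, ← hab]
    convert ha using 1
    ring

/-- The tensor product of two cyclic modules. -/
noncomputable def Ideal.quotTensorQuotEquiv (I J : Ideal S) :
    (S ⧸ I) ⊗[S] (S ⧸ J) ≃ₗ[S] S ⧸ (J ⊔ I) :=
  TensorProduct.quotTensorEquivQuotSMul (S ⧸ J) I ≪≫ₗ
    Submodule.quotEquivOfEq _ _ (by
      -- The submodule I · (S/J) is the image of I in S/J, which leaves a double quotient.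
      have h := Submodule.map_smul'' I (⊤ : Submodule S S) J.mkQ
      rw [Submodule.map_top, Submodule.range_mkQ] at h
      rw [← h, smul_eq_mul, Ideal.mul_top]) ≪≫ₗ
    Submodule.quotientQuotientEquivQuotientSup J I

end Ideals

/-! ### Regular sequences modulo ideals in other variables. -/

namespace MvPolynomial

variable {σ : Type*} {k : Type*} [CommRing k]

/-- The ideal `I` is generated by polynomials in variables not in `A`. -/
def IdealAvoids (A : Set σ) (I : Ideal (MvPolynomial σ k)) : Prop :=
  ∃ s ⊆ (supported k Aᶜ : Set (MvPolynomial σ k)), I = Ideal.span s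

theorem IdealAvoids.mono {A B : Set σ} {I : Ideal (MvPolynomial σ k)} (h : IdealAvoids A I)
    (hB : B ⊆ A) : IdealAvoids B I := by
  obtain ⟨s, hs, rfl⟩ := h
  exact ⟨s, hs.trans (supported_mono (Set.compl_subset_compl.2 hB)), rfl⟩

theorem IdealAvoids.sup {A : Set σ} {I J : Ideal (MvPolynomial σ k)} (hI : IdealAvoids A I)
    (hJ : IdealAvoids A J) : IdealAvoids A (I ⊔ J) := by
  obtain ⟨s, hs, rfl⟩ := hI
  obtain ⟨t, ht, rfl⟩ := hJ
  exact ⟨s ∪ t, Set.union_subset hs ht, (Ideal.span_union s t).symm⟩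

theorem idealAvoids_span {A : Set σ} {s : Set (MvPolynomial σ k)}
    (hs : s ⊆ (supported k Aᶜ : Set (MvPolynomial σ k))) : IdealAvoids A (Ideal.span s) :=
  ⟨s, hs, rfl⟩

/-- Modulo an ideal generated by polynomials not involving `X v`, a difference `X v - f` with `f`
not involving `X v` is regular. -/
theorem IdealAvoids.mem_of_X_sub_mul_mem {v : σ} {I : Ideal (MvPolynomial σ k)}
    (hI : IdealAvoids {v} I) {f : MvPolynomial σ k} (hf : f ∈ supported k {v}ᶜ)
    {g : MvPolynomial σ k} (hg : (X v - f) * g ∈ I) : g ∈ I := by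
  classical
  obtain ⟨s, hs, rfl⟩ := hI
  set I := Ideal.span s with hIs
  -- ψ turns X v into a polynomial variable and ev puts it back. The coefficients stay in the full
  -- ring, so no subring of the remaining variables has to be separated off.
  let ψ : MvPolynomial σ k →ₐ[k] Polynomial (MvPolynomial σ k) :=
    aeval fun w => if w = v then Polynomial.X else Polynomial.C (X w)
  let ev : Polynomial (MvPolynomial σ k) →+* MvPolynomial σ k := Polynomial.evalRingHom (X v)
  have hψv : ψ (X v) = Polynomial.X := by simp [ψ]
  have hev : ∀ a, ev (ψ a) = a := by
    intro a
    induction a using MvPolynomial.induction_on with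
    | C r =>
      rw [← algebraMap_eq, ψ.commutes, Polynomial.algebraMap_apply]
      simp [ev]
    | add a b ha hb => rw [map_add, map_add, ha, hb]
    | mul_X a w ha =>
      rw [map_mul, map_mul, ha]
      by_cases hw : w = v <;> simp [ψ, ev, hw]
  have hψ : ∀ a ∈ supported k ({v}ᶜ : Set σ), ψ a = Polynomial.C a := by
    intro a ha
    refine Algebra.adjoin_induction (p := fun a _ => ψ a = Polynomial.C a) ?_ ?_ ?_ ?_ ha
    · rintro _ ⟨w, hw, rfl⟩
      have : w ≠ v := hw
      simp [ψ, this]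
    · intro r
      rw [ψ.commutes, Polynomial.algebraMap_apply]
    · intro a b _ _ ha hb
      rw [map_add, map_add, ha, hb]
    · intro a b _ _ ha hb
      rw [map_mul, map_mul, ha, hb]
  -- The generators of I do not involve X v, so ψ sends them to constants.
  have h1 : ψ ((X v - f) * g) ∈ I.map Polynomial.C := by
    have h2 : I ≤ (I.map Polynomial.C).comap ψ := by
      refine Ideal.span_le.2 fun a ha => ?_
      change ψ a ∈ I.map Polynomial.C
      rw [hψ a (hs ha)]
      exact Ideal.mem_map_of_mem _ (Ideal.subset_span ha)
    exact h2 hg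
  have hker : RingHom.ker (Polynomial.mapRingHom (Ideal.Quotient.mk I)) = I.map Polynomial.C := by
    rw [Polynomial.ker_mapRingHom, Ideal.mk_ker]
  have h3 : ψ g ∈ I.map Polynomial.C := by
    rw [← hker, RingHom.mem_ker] at h1 ⊢
    rw [map_mul, map_mul, map_sub, hψv, hψ f hf, map_sub] at h1
    simp only [Polynomial.coe_mapRingHom, Polynomial.map_X, Polynomial.map_C] at h1 ⊢
    -- Over the quotient by I the factor is a monic polynomial in one variable, hence regular even
    -- if the quotient has zero divisors.
    exact (Polynomial.monic_X_sub_C _).isRegular.left.eq_iff.1 (h1.trans (mul_zero _).symm)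
  have h4 := Ideal.mem_map_of_mem ev h3
  rw [Ideal.map_map, hev] at h4
  have h5 : ev.comp Polynomial.C = RingHom.id _ := RingHom.ext fun a => by simp [ev]
  rwa [h5, Ideal.map_id] at h4

theorem span_singleton_avoids {A : Set σ} {f : MvPolynomial σ k} (hf : f ∈ supported k Aᶜ) :
    IdealAvoids A (Ideal.span {f}) :=
  idealAvoids_span (Set.singleton_subset_iff.2 hf)

theorem X_mem_supported_of_mem {A : Set σ} {w : σ} (h : w ∈ A) :
    (X w : MvPolynomial σ k) ∈ supported k A :=
  Algebra.subset_adjoin ⟨w, h, rfl⟩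

variable {i j m l : σ} {I : Ideal (MvPolynomial σ k)}

/-- Each form is monic in a variable absent from what precedes it: X i is absent from I, and X j
from both I and X i - X l. -/
theorem isRegularPair_smoothing (hI : IdealAvoids {i, j, m, l} I) (hil : i ≠ l)
    (hij : i ≠ j) (hjm : j ≠ m) (hjl : j ≠ l) : I.IsRegularPair (X i - X l) (X j - X m) := by
  have hX : ∀ {v w : σ}, w ≠ v → (X w : MvPolynomial σ k) ∈ supported k {v}ᶜ :=
    fun h => X_mem_supported_of_mem h
  refine ⟨fun g => (hI.mono (by simp)).mem_of_X_sub_mul_mem (hX hil.symm), fun g => ?_⟩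
  refine IdealAvoids.mem_of_X_sub_mul_mem ((hI.mono (by simp)).sup (span_singleton_avoids ?_))
    (hX hjm.symm)
  exact sub_mem (hX hij) (hX hjl.symm)

/-- Modulo the linear form the quadric is -(X j - X m)(X j - X l), so it suffices that each factor
is regular there. The order is exchanged for this: X j - X w is monic in X j modulo I, and the
linear form is monic in X i modulo I and X j - X w. -/
theorem isRegularPair_singular (hI : IdealAvoids {i, j, m, l} I) (hij : i ≠ j) (him : i ≠ m)
    (hil : i ≠ l) (hjm : j ≠ m) (hjl : j ≠ l) :
    I.IsRegularPair (X i + X j - X m - X l) (X i * X j - X m * X l) := by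
  have hX : ∀ {v w : σ}, w ≠ v → (X w : MvPolynomial σ k) ∈ supported k {v}ᶜ :=
    fun h => X_mem_supported_of_mem h
  have e : (X i + X j - X m - X l : MvPolynomial σ k) = X i - (X m + X l - X j) := by ring
  have hmem : (X m + X l - X j : MvPolynomial σ k) ∈ supported k {i}ᶜ :=
    sub_mem (add_mem (hX him.symm) (hX hil.symm)) (hX hij.symm)
  have hIi : IdealAvoids {i} I := hI.mono (by simp)
  have hIj : IdealAvoids {j} I := hI.mono (by simp)
  have key : ∀ w, w ≠ i → w ≠ j → ∀ g, (X j - X w) * g ∈ I ⊔ Ideal.span {X i + X j - X m - X l} →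
      g ∈ I ⊔ Ideal.span {X i + X j - X m - X l} := by
    intro w hwi hwj g hg
    refine Ideal.mem_sup_span_of_mul_mem_sup_span
      (fun g => hIj.mem_of_X_sub_mul_mem (hX hwj)) (fun g => ?_) hg
    rw [e]
    exact IdealAvoids.mem_of_X_sub_mul_mem
      (hIi.sup (span_singleton_avoids (sub_mem (hX hij.symm) (hX hwi)))) hmem
  -- The factor X j - X m is cancelled first, then X j - X l.
  refine ⟨fun g => ?_, fun g hg => key l hil.symm hjl.symm g (key m him.symm hjm.symm _ ?_)⟩
  · rw [e]
    exact hIi.mem_of_X_sub_mul_mem hmem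
  · have : (X j - X m) * ((X j - X l) * g) = -((X i * X j - X m * X l) * g) +
        (X j * g) * (X i + X j - X m - X l) := by ring
    rw [this]
    exact add_mem (neg_mem hg) (Ideal.mem_sup_right (Ideal.mem_span_singleton'.2 ⟨_, rfl⟩))

end MvPolynomial

/-! ### Resolutions with control of the variables involved. -/

namespace MvPolynomial

open MatrixFactorization

variable {σ : Type} {k : Type u} [CommRing k]

/-- `Q` is a cyclic module whose annihilator is generated by polynomials in variables not in `A`. -/
def ModuleAvoids (k : Type u) [CommRing k] (A : Set σ) (Q : Type*) [AddCommGroup Q] [Module (MvPolynomial σ k) Q] : Prop :=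
  ∃ I : Ideal (MvPolynomial σ k), IdealAvoids A I ∧ Nonempty (Q ≃ₗ[MvPolynomial σ k] _ ⧸ I)

theorem ModuleAvoids.mono {A B : Set σ} {Q : Type*} [AddCommGroup Q] [Module (MvPolynomial σ k) Q]
    (h : ModuleAvoids k A Q) (hB : B ⊆ A) : ModuleAvoids k B Q := by
  obtain ⟨I, hI, e⟩ := h
  exact ⟨I, hI.mono hB, e⟩

/-- The tensor product is cyclic with annihilator the sum of the two ideals, and generators of both
avoid A. -/
theorem ModuleAvoids.tensor {A : Set σ} {Q P : Type*} [AddCommGroup Q]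
    [Module (MvPolynomial σ k) Q] [AddCommGroup P] [Module (MvPolynomial σ k) P]
    (hQ : ModuleAvoids k A Q) (hP : ModuleAvoids k A P) :
    ModuleAvoids k A (Q ⊗[MvPolynomial σ k] P) := by
  obtain ⟨I, hI, ⟨e⟩⟩ := hQ
  obtain ⟨J, hJ, ⟨e'⟩⟩ := hP
  exact ⟨J ⊔ I, hJ.sup hI, ⟨TensorProduct.congr e e' ≪≫ₗ Ideal.quotTensorQuotEquiv I J⟩⟩

theorem moduleAvoids_self (A : Set σ) : ModuleAvoids k A (MvPolynomial σ k) :=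
  ⟨⊥, ⟨∅, Set.empty_subset _, Ideal.span_empty.symm⟩, ⟨(Submodule.quotEquivOfEqBot ⊥ rfl).symm⟩⟩

variable {φ ψ : MvPolynomial σ k}

/-- A graded surjection of flat matrix factorizations whose kernel is acyclic for `dPlus`, also
after tensoring with cyclic modules that do not involve the variables in `B`. -/
structure IsResolution (B : Set σ) (b : ℤ) {M N : MatrixFactorization.{u, u} (MvPolynomial σ k) φ}
    (f : Hom M N) : Prop where
  isGraded : f.IsGraded
  surjective : Function.Surjective f.toLin
  isBddBelow : M.IsBddBelow b
  flat : Module.Flat (MvPolynomial σ k) M.carrier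
  exactOn : ∀ (Q : Type u) [AddCommGroup Q] [Module (MvPolynomial σ k) Q], ModuleAvoids k B Q →
    ExactOn Q f

/-- A resolution of a cyclic module in degree `0` that involves only the variables in `B`. -/
structure IsCyclicResolution (B : Set σ) (b : ℤ)
    {M N : MatrixFactorization.{u, u} (MvPolynomial σ k) φ} (f : Hom M N) : Prop
    extends IsResolution B b f where
  dPlus_eq_zero : N.dPlus = 0
  sgn_eq_id : N.sgn = LinearMap.id
  cyclic : ModuleAvoids k Bᶜ N.carrier

/-- Once f has been applied, g is needed with coefficients Q ⊗ N. These still avoid B', because Q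
does and N involves only B, which is disjoint from B'. -/
theorem IsCyclicResolution.tensor {B B' : Set σ} {b b' : ℤ}
    {M N : MatrixFactorization.{u, u} (MvPolynomial σ k) φ}
    {M' N' : MatrixFactorization.{u, u} (MvPolynomial σ k) ψ} {f : Hom M N} {g : Hom M' N'}
    (hf : IsCyclicResolution B b f) (hg : IsResolution B' b' g) (hB : Disjoint B B') :
    IsResolution (B ∪ B') (b + b') (f.tensor g) where
  isGraded := hf.isGraded.tensor hg.isGraded
  surjective := TensorProduct.map_surjective hf.surjective hg.surjective
  isBddBelow := hf.isBddBelow.tensor hg.isBddBelow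
  flat := by
    have := hf.flat
    have := hg.flat
    exact inferInstanceAs (Module.Flat (MvPolynomial σ k)
      (M.carrier ⊗[MvPolynomial σ k] M'.carrier))
  exactOn Q _ _ hQ := by
    have := hg.flat
    refine ExactOn.tensor hf.isBddBelow hf.isGraded hf.surjective hf.dPlus_eq_zero hf.sgn_eq_id
      (hf.exactOn Q (hQ.mono Set.subset_union_left)) (hg.exactOn _ ?_)
    exact (hQ.mono Set.subset_union_right).tensor
      (hf.cyclic.mono (Set.disjoint_left.1 hB.symm))

theorem IsResolution.directSum {ι : Type} [DecidableEq ι] {B : Set σ} {b : ℤ}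
    {M N : ι → MatrixFactorization.{u, u} (MvPolynomial σ k) φ} {f : ∀ i, Hom (M i) (N i)}
    (h : ∀ i, IsResolution B b (f i)) : IsResolution B b (Hom.directSum f) where
  isGraded := Hom.IsGraded.directSum fun i => (h i).isGraded
  surjective := Hom.directSum_surjective fun i => (h i).surjective
  isBddBelow := IsBddBelow.directSum fun i => (h i).isBddBelow
  flat := by
    have := fun i => (h i).flat
    exact inferInstanceAs (Module.Flat (MvPolynomial σ k) (⨁ i, (M i).carrier))
  exactOn Q _ _ hQ := ExactOn.directSum fun i => (h i).exactOn Q hQ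

theorem isResolution_id {M : MatrixFactorization.{u, u} (MvPolynomial σ k) φ} {b : ℤ}
    (hM : M.IsBddBelow b) (hflat : Module.Flat (MvPolynomial σ k) M.carrier) (B : Set σ) :
    IsResolution B b (Hom.id M) where
  isGraded := Hom.isGraded_id M
  surjective := Function.surjective_id
  isBddBelow := hM
  flat := hflat
  exactOn Q _ _ _ := by
    intro z hz _
    have h0 : z = 0 := by
      have e : (Hom.id M).toLin.lTensor Q = LinearMap.id := LinearMap.lTensor_id Q _
      rwa [e] at hz
    exact ⟨0, map_zero _, by rw [h0, map_zero]⟩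

/-- For the homological degrees in which the complex of a crossing vanishes. The zero module is
cyclic with annihilator generated by 1, which involves no variable. -/
theorem isCyclicResolution_zero {B : Set σ} {b : ℤ} (hb : b ≤ 0) :
    IsCyclicResolution B b (Hom.zero (zeroObj.{u, u} φ) (zeroObj.{u, u} φ)) where
  isGraded _ _ _ := Submodule.zero_mem _
  surjective := Function.surjective_to_subsingleton _
  isBddBelow := ofModule_isBddBelow _ _ hb
  flat := inferInstanceAs (Module.Flat (MvPolynomial σ k) PUnit.{u + 1})
  exactOn Q _ _ _ := fun z _ _ => by
    have : z = 0 := Subsingleton.elim (α := Q ⊗[MvPolynomial σ k] PUnit.{u + 1}) _ _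
    exact ⟨0, map_zero _, by rw [this, map_zero]⟩
  dPlus_eq_zero := rfl
  sgn_eq_id := ofModule_sgn _ _
  cyclic := by
    refine ⟨⊤, ⟨{1}, Set.singleton_subset_iff.2 (one_mem (supported k _)),
      Ideal.span_singleton_one.symm⟩, ⟨?_⟩⟩
    have : Subsingleton (MvPolynomial σ k ⧸ (⊤ : Ideal (MvPolynomial σ k))) :=
      Ideal.Quotient.subsingleton_iff.2 rfl
    exact LinearEquiv.ofSubsingleton _ _

theorem isCyclicResolution_koszul₂ {B : Set σ} {x₁ x₂ y₁ y₂ : MvPolynomial σ k}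
    (h : x₁ * y₁ + x₂ * y₂ = φ) (hx₁ : x₁ ∈ supported k B) (hx₂ : x₂ ∈ supported k B)
    (hreg : ∀ I : Ideal (MvPolynomial σ k), IdealAvoids B I → I.IsRegularPair x₁ x₂) :
    IsCyclicResolution B (-2)
      (Hom.toFH (koszul₂ x₁ x₂ y₁ y₂ h) (koszul₂_isNonpos x₁ x₂ y₁ y₂ h)) where
  isGraded := Hom.toFH_isGraded _ _
  surjective := Submodule.mkQ_surjective _
  isBddBelow := koszul₂_isBddBelow h
  flat := inferInstanceAs (Module.Flat (MvPolynomial σ k)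
    ((MvPolynomial σ k × MvPolynomial σ k) ⊗[MvPolynomial σ k]
      (MvPolynomial σ k × MvPolynomial σ k)))
  exactOn Q _ _ hQ := by
    obtain ⟨I, hI, ⟨e⟩⟩ := hQ
    exact exactOn_koszul₂_toFH_of_equiv h e (hreg I hI)
  dPlus_eq_zero := rfl
  sgn_eq_id := ofModule_sgn _ _
  cyclic := by
    refine ⟨Ideal.span {x₁, x₂}, idealAvoids_span ?_, nonempty_koszul₂_fH_equiv h⟩
    rw [compl_compl]
    rintro _ (rfl | rfl)
    exacts [hx₁, hx₂]

/-- Induction that splits off the first factor. Only this factor has to resolve a cyclic module; the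
remaining product has direct sums as its terms, whose targets need not be cyclic, so the conclusion
is the weaker `IsResolution`. Each factor adds b to the lower bound. -/
theorem IsResolution.tensorFamily : ∀ {n : ℕ} {φ : Fin n → MvPolynomial σ k}
    {C E : ∀ i, MFComplex.{u, u} (MvPolynomial σ k) (φ i)} (g : ∀ i, MFComplex.Hom (C i) (E i))
    {B : Fin n → Set σ} (b : ℤ), (∀ i m, IsCyclicResolution (B i) b ((g i).f m)) →
    (∀ i j, i ≠ j → Disjoint (B i) (B j)) →
    ∀ m, IsResolution (⋃ i, B i) (n * b) ((MFComplex.Hom.tensorFamily g).f m)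
  | 0, φ, C, E, g, B, b, _, _, m => by
    have hbdd : ((MFComplex.tensorFamily C).obj m).IsBddBelow ((0 : ℕ) * b) := by
      rw [Nat.cast_zero, zero_mul]
      rcases m with (_ | m) | m
      · exact ofModule_isBddBelow (φ := (0 : MvPolynomial σ k)) (MvPolynomial σ k)
          (fun a => zero_smul _ a) le_rfl
      · exact ofModule_isBddBelow (φ := (0 : MvPolynomial σ k)) PUnit.{u + 1} (fun _ => rfl) le_rfl
      · exact ofModule_isBddBelow (φ := (0 : MvPolynomial σ k)) PUnit.{u + 1} (fun _ => rfl) le_rfl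
    have hflat : Module.Flat (MvPolynomial σ k) ((MFComplex.tensorFamily C).obj m).carrier := by
      rcases m with (_ | m) | m
      · exact inferInstanceAs (Module.Flat (MvPolynomial σ k) (MvPolynomial σ k))
      · exact inferInstanceAs (Module.Flat (MvPolynomial σ k) PUnit.{u + 1})
      · exact inferInstanceAs (Module.Flat (MvPolynomial σ k) PUnit.{u + 1})
    -- The empty product is the unit complex, and the map on it is the identity.
    exact isResolution_id hbdd hflat _
  | n + 1, φ, C, E, g, B, b, h, hB, m => by
    have hB' : ∀ i : Fin n, Disjoint (B 0) (B i.succ) := fun i => hB _ _ (Fin.succ_ne_zero i).symm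
    have ih := IsResolution.tensorFamily (fun i => g i.succ) b (fun i => h i.succ)
      (fun i j hij => hB _ _ (fun e => hij (Fin.succ_injective n e)))
    have hU : (⋃ i, B i) = B 0 ∪ ⋃ i : Fin n, B i.succ := by
      ext x
      simp [Fin.exists_fin_succ]
    have hn : ((n + 1 : ℕ) : ℤ) * b = b + n * b := by push_cast; ring
    rw [hU, hn]
    have key := IsResolution.directSum (ι := {p : ℤ × ℤ // p.1 + p.2 = m}) fun p =>
      (h 0 p.1.1).tensor (ih p.1.2) (Set.disjoint_iUnion_right.2 hB')
    -- The change of potential in `MFComplex.tensorFamily` keeps the underlying data, so the fields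
    -- of `key` are reused one by one.
    exact ⟨key.isGraded, key.surjective, key.isBddBelow, key.flat, key.exactOn⟩

end MvPolynomial

/-! ### Flatness and boundedness of the edge factors. -/

namespace MatrixFactorization

variable {S : Type u} [CommRing S]

theorem flat_tensorFamily_twoTerm : ∀ {n : ℕ} (x y : Fin n → S),
    Module.Flat S (tensorFamily fun i => twoTerm (x i) (y i)).carrier
  | 0, _, _ => inferInstanceAs (Module.Flat S S)
  | n + 1, x, y => by
    have := flat_tensorFamily_twoTerm (fun i => x i.succ) (fun i => y i.succ)
    exact inferInstanceAs (Module.Flat S ((S × S) ⊗[S]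
      (tensorFamily fun i : Fin n => twoTerm (x i.succ) (y i.succ)).carrier))

theorem isBddBelow_tensorFamily_twoTerm : ∀ {n : ℕ} (x y : Fin n → S),
    (tensorFamily fun i => twoTerm (x i) (y i)).IsBddBelow (-n)
  | 0, _, _ => ofModule_isBddBelow (φ := (0 : S)) S (fun a => zero_smul S a) (by simp)
  | n + 1, x, y => by
    have h := (twoTerm_isBddBelow (x 0) (y 0)).tensor
      (isBddBelow_tensorFamily_twoTerm (fun i => x i.succ) (fun i => y i.succ))
    have e : (-((n + 1 : ℕ) : ℤ)) = -1 + -n := by push_cast; ring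
    rw [e]
    exact h

end MatrixFactorization

/-! ### Application to the crossings of a tangle diagram. -/

namespace TangleDiagram

open MatrixFactorization

variable (T : TangleDiagram) {k : Type u} [Field k]

/-- The flags at a crossing. -/
def crossingFlags (x : Fin T.numCrossings) : Set T.Flag :=
  {T.outFlag x .left, T.outFlag x .right, T.inFlag x .right, T.inFlag x .left}

/-- An edge has separate variables at its two ends, so even adjacent crossings share none. This
independence is what allows the crossings to be resolved successively. -/
theorem disjoint_crossingFlags {x y : Fin T.numCrossings} (h : x ≠ y) :
    Disjoint (T.crossingFlags x) (T.crossingFlags y) := by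
  rw [Set.disjoint_left]
  intro f hf hf'
  simp only [crossingFlags, Set.mem_insert_iff, Set.mem_singleton_iff] at hf hf'
  rcases hf with rfl | rfl | rfl | rfl <;> simp [outFlag, inFlag, h] at hf'

/-- In each homological degree the map is one of the two Koszul resolutions or a map between zero
modules. -/
theorem isCyclicResolution_toFHL {p : Polynomial k} {x : Fin T.numCrossings}
    (c : T.CrossingChoice p x) (positive : Bool) (m : ℤ) :
    MvPolynomial.IsCyclicResolution (T.crossingFlags x) (-2) ((c.toFHL positive).f m) := by
  have hij : T.outFlag x .left ≠ T.outFlag x .right := by simp [outFlag]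
  have hlm : T.inFlag x .left ≠ T.inFlag x .right := by simp [inFlag]
  have hoi : ∀ s s', T.outFlag x s ≠ T.inFlag x s' := fun s s' => by simp [outFlag, inFlag]
  have hs : ∀ f ∈ T.crossingFlags x, T.t k f ∈ MvPolynomial.supported k (T.crossingFlags x) :=
    fun f hf => MvPolynomial.X_mem_supported_of_mem hf
  have h1 := hs (T.outFlag x .left) (by simp [crossingFlags])
  have h2 := hs (T.outFlag x .right) (by simp [crossingFlags])
  have h3 := hs (T.inFlag x .right) (by simp [crossingFlags])
  have h4 := hs (T.inFlag x .left) (by simp [crossingFlags])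
  have hL' := MvPolynomial.isCyclicResolution_koszul₂ c.potential'
    (sub_mem (sub_mem (add_mem h1 h2) h3) h4) (sub_mem (mul_mem h1 h2) (mul_mem h3 h4))
    fun I hI => MvPolynomial.isRegularPair_singular hI hij (hoi _ _) (hoi _ _) (hoi _ _) (hoi _ _)
  have hL'' := MvPolynomial.isCyclicResolution_koszul₂ c.potential''
    (sub_mem h1 h4) (sub_mem h2 h3)
    fun I hI => MvPolynomial.isRegularPair_smoothing hI (hoi _ _) hij (hoi _ _) (hoi _ _)
  have h0 := MvPolynomial.isCyclicResolution_zero (B := T.crossingFlags x) (b := -2)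
    (φ := crossingPotential p (T.t k (T.outFlag x .left)) (T.t k (T.outFlag x .right))
      (T.t k (T.inFlag x .right)) (T.t k (T.inFlag x .left))) (by norm_num)
  -- A negative crossing occupies homological degrees 0 and 1, a positive one degrees 0 and -1.
  cases positive
  · rcases m with (_ | _ | m) | m
    exacts [hL'', hL', h0, h0]
  · rcases m with (_ | m) | (_ | m)
    exacts [hL'', h0, hL', h0]

/-- Gathers the input of `isNearIso_of_kerExact` in a form that does not depend on the ring of
scalars. -/
theorem toKRhat_f (p : Polynomial k) (c : ∀ x, T.CrossingChoice p x) (n : ℤ) :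
    ∃ b, ((T.KR p c).obj n).IsBddBelow b ∧ ((T.toKRhat p c).f n).IsGraded ∧
      Function.Surjective ((T.toKRhat p c).f n).toLin ∧
      KerExact ((T.KR p c).obj n).dPlus ((T.toKRhat p c).f n).toLin := by
  have h := MvPolynomial.IsResolution.tensorFamily
    (fun x => (c x).toFHL (T.positive x)) (-2)
    (fun x m => T.isCyclicResolution_toFHL (c x) (T.positive x) m)
    (fun x y hxy => T.disjoint_crossingFlags hxy) n
  have hflat : Module.Flat (T.FlagRing k) (T.edges p).carrier := by
    have := flat_tensorFamily_twoTerm (fun e => T.t k (.head e) - T.t k (.tail e))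
      (fun e => dividedDifference p (T.t k (.head e)) (T.t k (.tail e)))
    have := flat_tensorFamily_twoTerm (fun o => T.t k (.mark o) - T.t k (.mark o))
      (fun o => dividedDifference p (T.t k (.mark o)) (T.t k (.mark o)))
    exact inferInstanceAs (Module.Flat (T.FlagRing k)
      ((tensorFamily (T.Ledge p)).carrier ⊗[T.FlagRing k] (tensorFamily (T.Lcircle p)).carrier))
  have hbdd := (isBddBelow_tensorFamily_twoTerm (fun e => T.t k (.head e) - T.t k (.tail e))
      (fun e => dividedDifference p (T.t k (.head e)) (T.t k (.tail e)))).tensor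
    (isBddBelow_tensorFamily_twoTerm (fun o => T.t k (.mark o) - T.t k (.mark o))
      (fun o => dividedDifference p (T.t k (.mark o)) (T.t k (.mark o))))
  -- The coefficients are taken to be the ring itself and then removed by the unit isomorphism.
  have hex := KerExact.congr (h.exactOn _ (MvPolynomial.moduleAvoids_self _))
    (TensorProduct.lid (T.FlagRing k) _) (TensorProduct.lid (T.FlagRing k) _)
    (d' := ((MFComplex.tensorFamily fun x => (c x).L (T.positive x)).obj n).dPlus)
    (f' := ((MFComplex.Hom.tensorFamily fun x => (c x).toFHL (T.positive x)).f n).toLin)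
    (fun z => by
      induction z using TensorProduct.induction_on with
      | zero => simp
      | tmul r a => simp
      | add a b ha hb => simp only [map_add, ha, hb])
    (fun z => by
      induction z using TensorProduct.induction_on with
      | zero => simp
      | tmul r a => simp
      | add a b ha hb => simp only [map_add, ha, hb])
  exact ⟨_, hbdd.tensor h.isBddBelow, (Hom.isGraded_id _).tensor h.isGraded,
    LinearMap.lTensor_surjective _ h.surjective,
    KerExact.id_tensor h.isBddBelow h.isGraded hex⟩

end TangleDiagram

theorem proposition2p4 {k : Type u} [Field k] (p : Polynomial k) (hp : p.eval 0 = 0)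
    (T : TangleDiagram) (c : ∀ x, T.CrossingChoice p x) :
    MFComplex.IsDegreewiseNearIso.{u, u, u, w} (T.toKRhat p c) ∧
      MFComplex.IsDegreewiseNearIso.{u, u, u, w}
        ((T.toKRhat p c).restrictScalars (T.algebraMap_leafPotential p)) := by
  constructor
  · intro n
    obtain ⟨b, h1, h2, h3, h4⟩ := T.toKRhat_f p c n
    exact MatrixFactorization.isNearIso_of_kerExact h1 h2 h3 h4
  -- Gradedness, surjectivity and acyclicity concern elements only, so they hold verbatim over the
  -- subring. There D is projective over the subring, and no flatness of the source over it is
  -- required.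
  · intro n
    obtain ⟨b, h1, h2, h3, h4⟩ := T.toKRhat_f p c n
    refine MatrixFactorization.isNearIso_of_kerExact (b := b) (fun i hi => ?_) h2 h3 h4
    -- Vanishing of a graded piece is transferred elementwise, as the two zero submodules are over
    -- different rings.
    refine (Submodule.eq_bot_iff _).2 fun a ha => ?_
    exact (Submodule.eq_bot_iff _).1 (h1 i hi) a ha
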